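/- Conventions. For a locally finite set $L\subset\mathbb R$ let $\Xi=\sum_{\lambda\in L}\delta_\lambda$ be the corresponding simple point measure ($L$ may be finite, or bounded on one side). Locally weak convergence of measures on $\mathbb R$ means convergence of the integrals of all continuous compactly supported functions. On the Riemann sphere $\mathbb C\cup\{\infty\}$ let $d$ be the chordal distance, $d(z_1,z_2)=|z_2-z_1|/\sqrt{(1+|z_1|^2)(1+|z_2|^2)}$, extended by continuity to $\infty$. Fix $\alpha\in(0,1)$ and $h\in\mathbb R$. Let $I$ be a set of positive integers containing all sufficiently large integers. We say that locally finite sets $(L_n)_{n\in I}$ and $L$, with point measures $\Xi_n$ and $\Xi$, satisfy condition (P) if: 1. $\Xi_n\to\Xi$ locally weakly as $n\to\infty$. 2. There are $\tau_\ell>0$ $(\ell\ge 0)$ with $\tau_\ell\to0$ as $\ell\to\infty$ and, for all $n\in I$ and $\ell\ge1$, $\displaystyle\int_{\mathbb R}\frac{\mathbf 1(|\lambda|>\ell)}{|\lambda|^{1+\alpha}}\,d\Xi_n(\lambda)\le\tau_\ell$. 3. For all $\ell>0$ and $n\in I$ the finite limit $\displaystyle h_{n,\ell}=\lim_{\ell'\to\infty}\int_{\mathbb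 R}\frac{\mathbf 1(\ell<|\lambda|<\ell')}{\lambda}\,d\Xi_n(\lambda)$ exists, and so does the similar limit $h_\ell$ defined with $\Xi$. 4. For every $\ell>0$ with $\ell,-\ell\notin L$ the finite limit $\lim_{n\to\infty}h_{n,\ell}$ exists, and $\lim_{\ell\to\infty}\lim_{n\to\infty}h_{n,\ell}=h$ and $\lim_{\ell\to\infty}h_\ell=0$, where $\ell$ is restricted to $\ell,-\ell\notin L$. Theorem. Suppose that $(L_n)_{n\ge1}$ and $L$ satisfy (P) with $I=\{1,2,\dots\}$. Let $\gamma_{n,k}>0$ and $\gamma_k>0$ ($n\ge1$, $k\in\mathbb Z$) satisfy $\gamma_{n,k}\to\gamma_k$ as $n\to\infty$ for each $k$, and suppose that for some $\bar\gamma>0$, $c>0$ and $\alpha'$ with $0<(1+\alpha)\alpha'<1$, for all $n,m\ge1$, $$\Bigl|\sum_{k=0}^{m-1}\gamma_{n,k}-\bar\gamma m\Bigr|\le c\,m^{\alpha'},\qquad \Bigl|\sum_{k=-m}^{-1}\gamma_{n,k}-\bar\gamma m\Bigr|\le c\,m^{\alpha'}.$$ Let $\lambda^*\in\mathbb R\setminus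 L$. Let $\Lambda$ be the weighted version of $\Xi$ in which the $k$-th point of $L$ after $\lambda^*$ has weight $\gamma_k$ if $k\ge1$, and the $(1-k)$-th point of $L$ before $\lambda^*$ has weight $\gamma_k$ if $k\le0$; whenever $\lambda^*\notin L_n$, define $\Lambda_n$ similarly from $\Xi_n$ and $(\gamma_{n,k})_k$. Then: (a) $\lambda^*\notin L_n$ for all sufficiently large $n$. (b) For every $n\geq 1$ with $\lambda^*\notin L_n$, the limit $S_n(z)=\lim_{\ell\to\infty}\int_{[-\ell,\ell]}\frac{1}{\lambda-z}\,d\Lambda_n(\lambda)$ exists for all $z\in\mathbb C\setminus L_n$, and $S_n$ is meromorphic on $\mathbb C$, its poles being exactly the points of $L_n$, all simple. Likewise $S(z)=\lim_{\ell\to\infty}\int_{[-\ell,\ell]}\frac{1}{\lambda-z}\,d\Lambda(\lambda)$ exists for all $z\in\mathbb C\setminus L$ and is meromorphic on $\mathbb C$, its poles being exactly the points of $L$, all simple. (c) As $n\to\infty$, $S_n\to S+\bar\gamma h$ uniformly on compact subsets of $\mathbb C$ with respect to $d$ (the functions take the value $\infty$ at their poles). (d) Let $h'\in\mathbb R$,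 and exclude only the degenerate case where $L=\emptyset$ and $h'=0$ (in which $S\equiv 0$ and $S^{-1}(h')=\mathbb C$). Let $I'$ be the set of all $n\ge1$ such that $\lambda^*\notin L_n$ and such that $L_n\neq\emptyset$ or $h'+\bar\gamma h\ne0$; it contains all sufficiently large $n$. Then $L_n'=S_n^{-1}(h'+\bar\gamma h)$, for $n\in I'$, and $L'=S^{-1}(h')$ are subsets of $\mathbb R$, and $(L'_n)_{n\in I'}$ and $L'$ again satisfy (P), with the same $\alpha$ and $h$ (and possibly other $\tau_\ell$). In particular, the sum $\Xi'_n$ of delta masses at $S_n^{-1}(h'+\bar\gamma h)$ converges locally weakly to the sum $\Xi'$ of delta masses at $S^{-1}(h')$. -/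

import Mathlib

open MeasureTheory Filter Topology Set

noncomputable section

namespace StieltjesChain

/-- A set of reals is locally finite: only finitely many points in each bounded interval. -/
def LocallyFiniteSet (L : Set ℝ) : Prop := ∀ R : ℝ, (L ∩ Icc (-R) R).Finite

/-- The simple point measure `Ξ = ∑_{x ∈ L} δ_x`. -/
def pointMeasure (L : Set ℝ) : Measure ℝ :=
  Measure.sum fun x : L => Measure.dirac (x : ℝ)

/-- The label of the point `x` of `L` relative to a base point `a ∉ L`: the label is `k ≥ 1` if `x`
is the `k`-th point of `L` after `a`, and it is `k ≤ 0` if `x` is the `(1 - k)`-th point of `L`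
before `a`. -/
def pointIndex (L : Set ℝ) (a x : ℝ) : ℤ :=
  if a < x then ((L ∩ Ioc a x).ncard : ℤ) else 1 - ((L ∩ Ico x a).ncard : ℤ)

/-- The weighted point measure `Λ`: the point of `L` with label `k` has weight `γ k`. -/
def weightedMeasure (L : Set ℝ) (γ : ℤ → ℝ) (a : ℝ) : Measure ℝ :=
  Measure.sum fun x : L => ENNReal.ofReal (γ (pointIndex L a x)) • Measure.dirac (x : ℝ)

/-- Local weak convergence of measures on the line: convergence of the integrals of all continuous
compactly supported functions. -/
def TendstoLocallyWeakly (Ξs : ℕ → Measure ℝ) (Ξ : Measure ℝ) : Prop :=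
  ∀ f : ℝ → ℝ, Continuous f → HasCompactSupport f →
    Tendsto (fun n => ∫ x, f x ∂(Ξs n)) atTop (𝓝 (∫ x, f x ∂Ξ))

/-- `v` is the limit, as `ℓ' → ∞`, of `∫ 1(ℓ < |x| < ℓ') / x dΞ(x)`, where `Ξ = ∑_{x ∈ L} δ_x`. -/
def IsTailPrincipalValue (L : Set ℝ) (ℓ v : ℝ) : Prop :=
  Tendsto (fun ℓ' : ℝ => ∫ x in {x : ℝ | ℓ < |x| ∧ |x| < ℓ'}, x⁻¹ ∂(pointMeasure L))
    atTop (𝓝 v)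

/-- The conditions on the point measures `Ξ_n = ∑_{x ∈ Ls n} δ_x`, where `n` runs through the index
set `I` (which contains all large `n`), and on `Ξ = ∑_{x ∈ L} δ_x`. -/
structure PointAssumptions (I : Set ℕ) (Ls : ℕ → Set ℝ) (L : Set ℝ) (α h : ℝ) : Prop where
  eventually_mem : ∀ᶠ n in atTop, n ∈ I
  locallyFinite : ∀ n ∈ I, LocallyFiniteSet (Ls n)
  locallyFinite_limit : LocallyFiniteSet L
  tendsto : TendstoLocallyWeakly (fun n => pointMeasure (Ls n)) (pointMeasure L)
  tail : ∃ τ : ℝ → ℝ, (∀ ℓ : ℝ, 0 ≤ ℓ → 0 < τ ℓ) ∧ Tendsto τ atTop (𝓝 0) ∧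
    ∀ n ∈ I, ∀ ℓ : ℝ, 1 ≤ ℓ →
      ∫⁻ x in {x : ℝ | ℓ < |x|}, ENNReal.ofReal (1 / |x| ^ (1 + α)) ∂(pointMeasure (Ls n))
        ≤ ENNReal.ofReal (τ ℓ)
  /-- `H n ℓ` is `h_{n,ℓ}`, `Hlim ℓ` is `h_ℓ`, and `G ℓ` is the limit of `h_{n,ℓ}` in `n`. -/
  principalValue : ∃ (H : ℕ → ℝ → ℝ) (Hlim G : ℝ → ℝ),
    (∀ n ∈ I, ∀ ℓ : ℝ, 0 < ℓ → IsTailPrincipalValue (Ls n) ℓ (H n ℓ)) ∧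
    (∀ ℓ : ℝ, 0 < ℓ → IsTailPrincipalValue L ℓ (Hlim ℓ)) ∧
    (∀ ℓ : ℝ, 0 < ℓ → ℓ ∉ L → -ℓ ∉ L → Tendsto (fun n => H n ℓ) atTop (𝓝 (G ℓ))) ∧
    Tendsto G (atTop ⊓ 𝓟 {ℓ : ℝ | ℓ ∉ L ∧ -ℓ ∉ L}) (𝓝 h) ∧
    Tendsto Hlim (atTop ⊓ 𝓟 {ℓ : ℝ | ℓ ∉ L ∧ -ℓ ∉ L}) (𝓝 0)

/-- `S` is given off `L` by the symmetric limit `lim_{ℓ → ∞} ∫_{[-ℓ,ℓ]} dΛ(x) / (x - z)`, where `Λ`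
is the weighted point measure (the values of `S` at the points of `L` are irrelevant). -/
def IsStieltjesTransform (L : Set ℝ) (γ : ℤ → ℝ) (a : ℝ) (S : ℂ → ℂ) : Prop :=
  ∀ z : ℂ, z ∉ Complex.ofReal '' L →
    Tendsto (fun ℓ : ℝ => ∫ x in Icc (-ℓ) ℓ, 1 / ((x : ℂ) - z) ∂(weightedMeasure L γ a))
      atTop (𝓝 (S z))

/-- `S` is meromorphic on `ℂ`, its poles are exactly the points of `L`, and they are all simple. -/
def IsMeromorphicWithSimplePoles (L : Set ℝ) (S : ℂ → ℂ) : Prop :=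
  (∀ z : ℂ, MeromorphicAt S z) ∧
  (∀ z : ℂ, z ∉ Complex.ofReal '' L → AnalyticAt ℂ S z) ∧
  (∀ x ∈ L, meromorphicOrderAt S (x : ℂ) = -1)

/-- The function `S` with poles at `L`, as a function into the Riemann sphere `ℂ ∪ {∞}`. -/
def toSphere (L : Set ℝ) (S : ℂ → ℂ) (z : ℂ) : OnePoint ℂ :=
  open Classical in if z ∈ Complex.ofReal '' L then OnePoint.infty else OnePoint.some (S z)

/-- The chordal distance on the Riemann sphere. -/
def chordalDist : OnePoint ℂ → OnePoint ℂ → ℝ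
  | OnePoint.some z, OnePoint.some w =>
      ‖w - z‖ / Real.sqrt ((1 + ‖z‖ ^ 2) * (1 + ‖w‖ ^ 2))
  | OnePoint.some z, OnePoint.infty => 1 / Real.sqrt (1 + ‖z‖ ^ 2)
  | OnePoint.infty, OnePoint.some w => 1 / Real.sqrt (1 + ‖w‖ ^ 2)
  | OnePoint.infty, OnePoint.infty => 0

/-- Uniform convergence on the compact subsets of `ℂ` for the chordal distance. -/
def TendstoChordalOnCompacts (F : ℕ → ℂ → OnePoint ℂ) (f : ℂ → OnePoint ℂ) : Prop :=
  ∀ K : Set ℂ, IsCompact K → ∀ ε : ℝ, 0 < ε →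
    ∀ᶠ n in atTop, ∀ z ∈ K, chordalDist (F n z) (f z) < ε

/-- The level set `S⁻¹(t)` in `ℂ` of a function `S` with poles at `L`. -/
def levelSet (L : Set ℝ) (S : ℂ → ℂ) (t : ℝ) : Set ℂ :=
  {z : ℂ | toSphere L S z = OnePoint.some (t : ℂ)}

/-- The real points of the level set. -/
def realLevelSet (L : Set ℝ) (S : ℂ → ℂ) (t : ℝ) : Set ℝ :=
  {x : ℝ | (x : ℂ) ∈ levelSet L S t}

end StieltjesChain

end

open MeasureTheory Filter Topology Set

noncomputable section

namespace StieltjesChain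

/-! The proof compares weighted sums with unweighted ones by Abel summation. By condition 2 a
configuration has at most a constant times `r ^ (1 + α)` points in `[-r, r]`, uniformly in `n`.
Hence the accumulated difference between the weights and `γbar`, of order `m ^ α'` after `m` points,
is of order `x ^ β` at distance `x`, with `β = (1 + α) * α' < 1`. Summation by parts against a
function that decays like `1 / |x|` (`abs_sum_window_annulus_le`) leaves an error of order `r ^ (β -
1)` beyond radius `r`. So the part of the weighted principal value beyond `r` is `γbar` times the
unweighted one, up to a uniform error `E r → 0`. Letting first `n → ∞` and then `r → ∞` gives
`S_n(a) → S(a) + γbar * h` at the base point (`exists_principalValue`, `tendsto_principalValue`).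

At other points, `S(z) - S(a)` is the sum of the weights against `1 / (x - z) - 1 / (x - a) = O(1 /
x ^ 2)`. This converges absolutely with uniformly small tails, again by Abel summation. Finitely
many points then matter, and their positions and weights converge, which gives locally uniform
convergence off `L`. At a point of `L` one polar term is split off; it makes both functions large,
hence chordally close (`tendstoChordalOnCompacts`).

Positive weights make `Im S / Im z` positive, so level sets are real. On the line `S` increases
strictly between poles, from `-∞` to `+∞` between consecutive ones, so a level set interlaces `L`
(`separates_levelSet`, `levelSet_separates`). Monotonicity, the intermediate value theorem and
convergence of the transforms give convergence of the level sets (`locConv_realLevelSet`).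
Interlacing sets have counts differing by at most one on every bounded interval. Abel summation with
bounded partial sums then bounds the change of tail sums and tail principal values by a constant
over `r`, so (P) is inherited with the same `α` and `h` (`PointAssumptions.of_interlacing`). -/

/-! ### Locally finite sets and their finite windows. -/

/-- The finite set of the points of `L` in `A` (empty if there are infinitely many). -/
def window (L A : Set ℝ) : Finset ℝ :=
  open Classical in if h : (L ∩ A).Finite then h.toFinset else ∅

lemma mem_window_of_finite {L A : Set ℝ} (h : (L ∩ A).Finite) {x : ℝ} :
    x ∈ window L A ↔ x ∈ L ∧ x ∈ A := by
  rw [window, dif_pos h]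
  simp

lemma LocallyFiniteSet.finite_inter {L : Set ℝ} (hL : LocallyFiniteSet L) {A : Set ℝ}
    (hA : Bornology.IsBounded A) : (L ∩ A).Finite := by
  obtain ⟨R, hR⟩ := hA.subset_closedBall 0
  refine (hL R).subset fun x hx => ⟨hx.1, ?_⟩
  have := hR hx.2
  rwa [Real.closedBall_eq_Icc, zero_sub, zero_add] at this

lemma LocallyFiniteSet.mem_window {L : Set ℝ} (hL : LocallyFiniteSet L) {A : Set ℝ}
    (hA : Bornology.IsBounded A) {x : ℝ} : x ∈ window L A ↔ x ∈ L ∧ x ∈ A :=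
  mem_window_of_finite (hL.finite_inter hA)

lemma LocallyFiniteSet.union {L M : Set ℝ} (hL : LocallyFiniteSet L) (hM : LocallyFiniteSet M) :
    LocallyFiniteSet (L ∪ M) := fun R => by
  rw [union_inter_distrib_right]
  exact (hL R).union (hM R)

lemma LocallyFiniteSet.countable {L : Set ℝ} (hL : LocallyFiniteSet L) : L.Countable := by
  have : L = ⋃ n : ℕ, L ∩ Icc (-(n : ℝ)) n := by
    ext x
    simp only [mem_iUnion, mem_inter_iff, mem_Icc]
    refine ⟨fun hx => ?_, fun ⟨n, hn⟩ => hn.1⟩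
    obtain ⟨n, hn⟩ := exists_nat_ge |x|
    exact ⟨n, hx, abs_le.1 hn⟩
  rw [this]
  exact countable_iUnion fun n => (hL n).countable

/-- `L` and its reflection are countable, so admissible radii are dense. Such radii keep points off
window boundaries, as condition 4 and the matching of points require. -/
lemma LocallyFiniteSet.exists_mem_Ioo {L : Set ℝ} (hL : LocallyFiniteSet L) {u v : ℝ}
    (huv : u < v) : ∃ r ∈ Ioo u v, r ∉ L ∧ -r ∉ L := by
  have hc : (L ∪ (fun x : ℝ => -x) '' L).Countable := hL.countable.union (hL.countable.image _)
  obtain ⟨r, hr, hr'⟩ := (hc.dense_compl ℝ).exists_between huv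
  exact ⟨r, hr', fun h => hr (Or.inl h), fun h => hr (Or.inr ⟨-r, h, neg_neg r⟩)⟩

lemma LocallyFiniteSet.exists_ball {L : Set ℝ} (hL : LocallyFiniteSet L) (x : ℝ) :
    ∃ r > 0, ∀ y ∈ L, |y - x| < r → y = x := by
  have hf : ((L ∩ Metric.closedBall x 1) \ {x}).Finite :=
    (hL.finite_inter Metric.isBounded_closedBall).subset sdiff_subset
  have hx : ∀ᶠ y in 𝓝 x, y ∉ (L ∩ Metric.closedBall x 1) \ {x} :=
    hf.isClosed.isOpen_compl.mem_nhds fun h => h.2 rfl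
  obtain ⟨r, hr, h⟩ := Metric.eventually_nhds_iff.1 hx
  refine ⟨min r 1, by positivity, fun y hy hyx => by_contra fun hne => h (y := y) ?_ ⟨⟨hy, ?_⟩, hne⟩⟩
  · rw [Real.dist_eq]; exact hyx.trans_le (min_le_left _ _)
  · rw [Metric.mem_closedBall, Real.dist_eq]; exact (hyx.trans_le (min_le_right _ _)).le

/-- The annulus `r < |x| ≤ t`. -/
def annulus (r t : ℝ) : Set ℝ := {x : ℝ | r < |x| ∧ |x| ≤ t}

lemma isBounded_annulus (r t : ℝ) : Bornology.IsBounded (annulus r t) :=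
  (Metric.isBounded_Icc (-t) t).subset fun _ hx => abs_le.1 hx.2

lemma isBounded_open_annulus (r t : ℝ) : Bornology.IsBounded {x : ℝ | r < |x| ∧ |x| < t} :=
  (isBounded_annulus r t).subset fun _ hx => ⟨hx.1, hx.2.le⟩

lemma LocallyFiniteSet.mem_annulus {L : Set ℝ} (hL : LocallyFiniteSet L) {r t x : ℝ} :
    x ∈ window L (annulus r t) ↔ x ∈ L ∧ r < |x| ∧ |x| ≤ t :=
  hL.mem_window (isBounded_annulus r t)

lemma LocallyFiniteSet.mem_Icc {L : Set ℝ} (hL : LocallyFiniteSet L) {r t x : ℝ} :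
    x ∈ window L (Icc r t) ↔ x ∈ L ∧ r ≤ x ∧ x ≤ t :=
  hL.mem_window (Metric.isBounded_Icc r t)

lemma LocallyFiniteSet.sum_window_annulus_add {E : Type*} [AddCommMonoid E] {L : Set ℝ}
    (hL : LocallyFiniteSet L) (f : ℝ → E) {r t t' : ℝ} (hrt : r ≤ t) (htt : t ≤ t') :
    ∑ x ∈ window L (annulus r t'), f x =
      ∑ x ∈ window L (annulus r t), f x + ∑ x ∈ window L (annulus t t'), f x := by
  classical
  rw [← Finset.sum_union]
  · refine Finset.sum_congr ?_ fun _ _ => rfl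
    ext x
    simp only [Finset.mem_union, hL.mem_annulus]
    grind
  · rw [Finset.disjoint_left]
    intro x
    simp only [hL.mem_annulus]
    grind

lemma LocallyFiniteSet.sum_window_Icc_add {E : Type*} [AddCommMonoid E] {L : Set ℝ}
    (hL : LocallyFiniteSet L) (f : ℝ → E) {r t : ℝ} (hrt : r ≤ t) :
    ∑ x ∈ window L (Icc (-t) t), f x =
      ∑ x ∈ window L (Icc (-r) r), f x + ∑ x ∈ window L (annulus r t), f x := by
  classical
  rw [← Finset.sum_union]
  · refine Finset.sum_congr ?_ fun _ _ => rfl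
    ext x
    simp only [Finset.mem_union, hL.mem_annulus, hL.mem_Icc, ← abs_le]
    grind
  · rw [Finset.disjoint_left]
    intro x
    simp only [hL.mem_annulus, hL.mem_Icc, ← abs_le]
    grind

/-! ### Integrals against point measures as finite sums. -/

section Integrals

lemma restrict_sum_dirac {L A : Set ℝ} (h : (L ∩ A).Finite) (hA : MeasurableSet A)
    (w : ℝ → ENNReal) :
    (Measure.sum fun x : L => w x • Measure.dirac (x : ℝ)).restrict A =
      ∑ x ∈ window L A, w x • Measure.dirac x := by
  ext s hs
  rw [Measure.restrict_apply hs, Measure.sum_apply _ (hs.inter hA), Measure.finsetSum_apply]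
  simp only [Measure.smul_apply, Measure.dirac_apply' _ (hs.inter hA), Measure.dirac_apply' _ hs]
  rw [tsum_subtype L (fun x => w x • (s ∩ A).indicator (1 : ℝ → ENNReal) x),
    tsum_eq_sum (s := window L A)]
  · refine Finset.sum_congr rfl fun x hx => ?_
    rw [mem_window_of_finite h] at hx
    rw [indicator_of_mem hx.1]
    by_cases hxs : x ∈ s
    · rw [indicator_of_mem hxs, indicator_of_mem (mem_inter hxs hx.2)]
    · rw [indicator_of_notMem hxs, indicator_of_notMem fun h => hxs h.1]
  · intro x hx
    rw [mem_window_of_finite h] at hx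
    by_cases hxL : x ∈ L
    · rw [indicator_of_mem hxL, indicator_of_notMem fun h => hx ⟨hxL, h.2⟩, smul_zero]
    · rw [indicator_of_notMem hxL]

variable {E : Type*} [NormedAddCommGroup E] [NormedSpace ℝ E] [CompleteSpace E]

lemma setIntegral_sum_dirac {L A : Set ℝ} (h : (L ∩ A).Finite) (hA : MeasurableSet A)
    (w : ℝ → ℝ) (hw : ∀ x ∈ L, 0 ≤ w x) (f : ℝ → E) :
    ∫ x in A, f x ∂(Measure.sum fun x : L => ENNReal.ofReal (w x) • Measure.dirac (x : ℝ)) =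
      ∑ x ∈ window L A, w x • f x := by
  rw [restrict_sum_dirac h hA (fun x => ENNReal.ofReal (w x)), integral_finsetSum_measure]
  · refine Finset.sum_congr rfl fun x hx => ?_
    rw [mem_window_of_finite h] at hx
    rw [integral_smul_measure, integral_dirac, ENNReal.toReal_ofReal (hw x hx.1)]
  · intro x _
    exact (integrable_dirac (by simp [enorm_lt_top])).smul_measure ENNReal.ofReal_ne_top

lemma setIntegral_pointMeasure {L A : Set ℝ} (h : (L ∩ A).Finite) (hA : MeasurableSet A)
    (f : ℝ → E) :
    ∫ x in A, f x ∂(pointMeasure L) = ∑ x ∈ window L A, f x := by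
  have := setIntegral_sum_dirac h hA (fun _ => 1) (fun _ _ => zero_le_one) f
  simpa [pointMeasure] using this

lemma integral_pointMeasure {L : Set ℝ} (hL : LocallyFiniteSet L) {f : ℝ → E} {u v : ℝ}
    (hf : ∀ x, x ∉ Icc u v → f x = 0) :
    ∫ x, f x ∂(pointMeasure L) = ∑ x ∈ window L (Icc u v), f x := by
  rw [← setIntegral_pointMeasure (hL.finite_inter (Metric.isBounded_Icc u v)) measurableSet_Icc,
    setIntegral_eq_integral_of_forall_compl_eq_zero hf]

/-- The integral is a sum of nonnegative terms, that is, the supremum of its finite partial sums.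
The tail condition thus becomes one on finite sets, with no summability to carry along. -/
lemma setLIntegral_pointMeasure_le_iff {L A : Set ℝ} (hA : MeasurableSet A) {f : ℝ → ℝ}
    (hf : ∀ x ∈ A, 0 ≤ f x) (hfm : Measurable f) {t : ℝ} (ht : 0 ≤ t) :
    ∫⁻ x in A, ENNReal.ofReal (f x) ∂(pointMeasure L) ≤ ENNReal.ofReal t ↔
      ∀ F : Finset ℝ, (∀ x ∈ F, x ∈ L ∧ x ∈ A) → ∑ x ∈ F, f x ≤ t := by
  classical
  have key : ∫⁻ x in A, ENNReal.ofReal (f x) ∂(pointMeasure L) =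
      ∑' x : ℝ, (L ∩ A).indicator (fun x => ENNReal.ofReal (f x)) x := by
    rw [← lintegral_indicator hA, pointMeasure, lintegral_sum_measure]
    simp_rw [lintegral_dirac' _ ((hfm.ennreal_ofReal).indicator hA)]
    rw [tsum_subtype L (fun x => A.indicator (fun x => ENNReal.ofReal (f x)) x),
      ← indicator_indicator]
  rw [key, ENNReal.tsum_eq_iSup_sum, iSup_le_iff]
  have hs : ∀ F : Finset ℝ, (∀ x ∈ F, x ∈ L ∧ x ∈ A) →
      ∑ x ∈ F, (L ∩ A).indicator (fun x => ENNReal.ofReal (f x)) x =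
        ENNReal.ofReal (∑ x ∈ F, f x) := by
    intro F hF
    rw [ENNReal.ofReal_sum_of_nonneg fun x hx => hf x (hF x hx).2]
    exact Finset.sum_congr rfl fun x hx => indicator_of_mem (mem_inter (hF x hx).1 (hF x hx).2) _
  constructor
  · intro h F hF
    have := h F
    rwa [hs F hF, ENNReal.ofReal_le_ofReal_iff ht] at this
  · intro h F
    have h1 : ∑ x ∈ F, (L ∩ A).indicator (fun x => ENNReal.ofReal (f x)) x =
        ∑ x ∈ F with x ∈ L ∩ A, (L ∩ A).indicator (fun x => ENNReal.ofReal (f x)) x := by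
      rw [Finset.sum_filter]
      refine Finset.sum_congr rfl fun x _ => ?_
      split_ifs with hx
      · rfl
      · exact indicator_of_notMem hx _
    have h2 : ∀ x ∈ F.filter (· ∈ L ∩ A), x ∈ L ∧ x ∈ A := fun x hx => (Finset.mem_filter.1 hx).2
    rw [h1, hs _ h2]
    exact ENNReal.ofReal_le_ofReal (h _ h2)

end Integrals

/-! ### Locally weak convergence as convergence of points. -/

/-- Convergence of locally finite sets, as simple point configurations. -/
structure LocConv (Ls : ℕ → Set ℝ) (L : Set ℝ) : Prop where
  exists_near : ∀ x ∈ L, ∀ ε > 0, ∀ᶠ n in atTop, ∃ y ∈ Ls n, |y - x| < ε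
  subsingleton : ∀ x ∈ L, ∃ ε > 0, ∀ᶠ n in atTop,
    ∀ y ∈ Ls n, ∀ z ∈ Ls n, |y - x| < ε → |z - x| < ε → y = z
  avoid : ∀ x ∉ L, ∃ ε > 0, ∀ᶠ n in atTop, ∀ y ∈ Ls n, ε ≤ |y - x|

/-- A continuous function that is `1` on `[x - r, x + r]` and vanishes off `(x - 2r, x + 2r)`. -/
def plateau (x r y : ℝ) : ℝ := max 0 (min 1 (2 - |y - x| / r))

lemma continuous_plateau (x r : ℝ) : Continuous (plateau x r) := by
  unfold plateau; fun_prop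

lemma plateau_nonneg (x r y : ℝ) : 0 ≤ plateau x r y := le_max_left _ _

lemma plateau_eq_one {x r y : ℝ} (hr : 0 < r) (h : |y - x| ≤ r) : plateau x r y = 1 := by
  have : |y - x| / r ≤ 1 := (div_le_one hr).2 h
  rw [plateau, min_eq_left (by linarith), max_eq_right zero_le_one]

lemma plateau_eq_zero {x r y : ℝ} (hr : 0 < r) (h : 2 * r ≤ |y - x|) : plateau x r y = 0 := by
  have : 2 ≤ |y - x| / r := (le_div_iff₀ hr).2 h
  rw [plateau, max_eq_left ((min_le_right _ _).trans (by linarith))]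

lemma hasCompactSupport_plateau {x r : ℝ} (hr : 0 < r) : HasCompactSupport (plateau x r) := by
  refine HasCompactSupport.intro (isCompact_closedBall x (2 * r)) fun y hy => ?_
  rw [Metric.mem_closedBall, Real.dist_eq, not_le] at hy
  exact plateau_eq_zero hr hy.le

lemma integral_plateau {L : Set ℝ} (hL : LocallyFiniteSet L) {x r : ℝ} (hr : 0 < r) :
    ∫ y, plateau x r y ∂(pointMeasure L) =
      ∑ y ∈ window L (Icc (x - 2 * r) (x + 2 * r)), plateau x r y := by
  refine integral_pointMeasure hL fun y hy => plateau_eq_zero hr ?_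
  by_contra! h
  rw [abs_lt] at h
  exact hy ⟨by linarith, by linarith⟩

lemma sum_plateau_le {L : Set ℝ} (hL : LocallyFiniteSet L) {x r : ℝ} (hr : 0 < r)
    {F : Finset ℝ} (hF : ∀ y ∈ F, y ∈ L ∧ |y - x| ≤ r) :
    (F.card : ℝ) ≤ ∫ y, plateau x r y ∂(pointMeasure L) := by
  rw [integral_plateau hL hr]
  calc (F.card : ℝ) = ∑ y ∈ F, plateau x r y := by
        rw [Finset.sum_congr rfl fun y hy => plateau_eq_one hr (hF y hy).2]; simp
    _ ≤ _ := Finset.sum_le_sum_of_subset_of_nonneg (fun y hy => ?_)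
        fun y _ _ => plateau_nonneg _ _ _
  have := abs_le.1 (hF y hy).2
  exact hL.mem_Icc.2 ⟨(hF y hy).1, by linarith, by linarith⟩

/-- Around any `x`, a narrow plateau function sees no point of `L` other than possibly `x`, so its
integrals tend to `1` or `0`. A positive integral forces a nearby point, an integral below `2`
allows at most one, and an integral below `1` allows none. -/
lemma LocConv.of_tendsto {Ls : ℕ → Set ℝ} {L : Set ℝ}
    (hLs : ∀ᶠ n in atTop, LocallyFiniteSet (Ls n)) (hL : LocallyFiniteSet L)
    (h : TendstoLocallyWeakly (fun n => pointMeasure (Ls n)) (pointMeasure L)) :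
    LocConv Ls L := by
  have key : ∀ x, ∃ r > 0, (∀ y ∈ L, |y - x| < r → y = x) ∧
      ∀ s, 0 < s → 2 * s ≤ r → Tendsto (fun n => ∫ y, plateau x s y ∂(pointMeasure (Ls n))) atTop
        (𝓝 (open Classical in if x ∈ L then 1 else 0)) := by
    intro x
    obtain ⟨r, hr, hx⟩ := hL.exists_ball x
    refine ⟨r, hr, hx, fun s hs hsr => ?_⟩
    convert h _ (continuous_plateau x s) (hasCompactSupport_plateau hs) using 2
    rw [integral_plateau hL hs]
    split_ifs with hxL
    · rw [Finset.sum_eq_single x, plateau_eq_one hs (by simpa using hs.le)]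
      · intro y hy hyx
        refine plateau_eq_zero hs ?_
        by_contra! hlt
        exact hyx (hx y (hL.mem_Icc.1 hy).1 (hlt.trans_le hsr))
      · intro hx'
        exact absurd (hL.mem_Icc.2 ⟨hxL, by linarith, by linarith⟩) hx'
    · refine (Finset.sum_eq_zero fun y hy => plateau_eq_zero hs ?_).symm
      by_contra! hlt
      have hyL := (hL.mem_Icc.1 hy).1
      exact hxL (hx y hyL (hlt.trans_le hsr) ▸ hyL)
  refine ⟨fun x hx ε hε => ?_, fun x hx => ?_, fun x hx => ?_⟩
  · obtain ⟨r, hr, -, hlim⟩ := key x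
    have hs : 0 < min (ε / 2) (r / 2) := by positivity
    have := hlim _ hs (by linarith [min_le_right (ε / 2) (r / 2)])
    rw [if_pos hx] at this
    filter_upwards [this.eventually (lt_mem_nhds zero_lt_one), hLs] with n hn hLn
    rw [integral_plateau hLn hs] at hn
    obtain ⟨y, hy, hpos⟩ := Finset.exists_lt_of_sum_lt (Finset.sum_const_zero.trans_lt hn)
    refine ⟨y, (hLn.mem_Icc.1 hy).1, ?_⟩
    by_contra! hle
    rw [plateau_eq_zero hs (by linarith [min_le_left (ε / 2) (r / 2)])] at hpos
    exact lt_irrefl _ hpos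
  · obtain ⟨r, hr, -, hlim⟩ := key x
    have hs : 0 < r / 2 := by positivity
    have := hlim _ hs (by linarith)
    rw [if_pos hx] at this
    refine ⟨r / 2, hs, ?_⟩
    filter_upwards [this.eventually (gt_mem_nhds one_lt_two), hLs] with n hn hLn y hy z hz h1 h2
    by_contra hyz
    have := sum_plateau_le hLn hs (F := {y, z}) (x := x) (by
      intro p hp
      rw [Finset.mem_insert, Finset.mem_singleton] at hp
      rcases hp with rfl | rfl
      exacts [⟨hy, h1.le⟩, ⟨hz, h2.le⟩])
    rw [Finset.card_pair hyz] at this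
    push_cast at this
    linarith
  · obtain ⟨r, hr, -, hlim⟩ := key x
    have hs : 0 < r / 2 := by positivity
    have := hlim _ hs (by linarith)
    rw [if_neg hx] at this
    refine ⟨r / 2, hs, ?_⟩
    filter_upwards [this.eventually (gt_mem_nhds zero_lt_one), hLs] with n hn hLn y hy
    by_contra! hlt
    have := sum_plateau_le hLn hs (F := {y}) (x := x) (by
      intro p hp
      rw [Finset.mem_singleton] at hp
      exact hp ▸ ⟨hy, hlt.le⟩)
    rw [Finset.card_singleton] at this
    push_cast at this
    linarith

/-- `φ n x` is a nearly nearest point of `Ls n`; the slack `1 / (n + 1)` is there because the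
distance need not be attained. Endpoints off `L` keep matched points from crossing the boundary.
Injectivity holds because the limits are distinct. Surjectivity follows from compactness: each point
of the interval has a neighbourhood in which `Ls n` eventually has no point, or only the matched
one. -/
lemma LocConv.exists_matching {Ls : ℕ → Set ℝ} {L : Set ℝ} (hL : LocallyFiniteSet L)
    (h : LocConv Ls L) :
    ∃ φ : ℕ → ℝ → ℝ, (∀ x ∈ L, Tendsto (fun n => φ n x) atTop (𝓝 x)) ∧
      ∀ u v, u ∉ L → v ∉ L →
        ∀ᶠ n in atTop, BijOn (φ n) (L ∩ Icc u v) (Ls n ∩ Icc u v) := by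
  have hinf : ∀ n x, ∃ y, (Ls n).Nonempty →
      y ∈ Ls n ∧ dist x y < Metric.infDist x (Ls n) + 1 / ((n : ℝ) + 1) := by
    intro n x
    by_cases hn : (Ls n).Nonempty
    · obtain ⟨y, hy, hxy⟩ := (Metric.infDist_lt_iff hn).1
        (lt_add_of_pos_right (Metric.infDist x (Ls n)) (Nat.one_div_pos_of_nat (α := ℝ) (n := n)))
      exact ⟨y, fun _ => ⟨hy, hxy⟩⟩
    · exact ⟨0, fun h => absurd h hn⟩
  choose φ hφ using hinf
  have hlim : ∀ x ∈ L, Tendsto (fun n => φ n x) atTop (𝓝 x) := by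
    intro x hx
    rw [Metric.tendsto_nhds]
    intro ε hε
    filter_upwards [h.exists_near x hx (ε / 2) (by positivity),
      tendsto_one_div_add_atTop_nhds_zero_nat.eventually (gt_mem_nhds (half_pos hε))]
      with n ⟨y, hy, hyx⟩ hn
    have h1 := (hφ n x ⟨y, hy⟩).2
    have h2 := Metric.infDist_le_dist_of_mem (x := x) hy
    rw [dist_comm x y, Real.dist_eq] at h2
    rw [dist_comm]
    linarith
  have hmem : ∀ x ∈ L, ∀ᶠ n in atTop, φ n x ∈ Ls n := by
    intro x hx
    filter_upwards [h.exists_near x hx 1 one_pos] with n ⟨y, hy, _⟩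
    exact (hφ n x ⟨y, hy⟩).1
  refine ⟨φ, hlim, fun u v hu hv => ?_⟩
  have hfin : (L ∩ Icc u v).Finite := hL.finite_inter (Metric.isBounded_Icc u v)
  have hmaps : ∀ᶠ n in atTop, MapsTo (φ n) (L ∩ Icc u v) (Ls n ∩ Icc u v) := by
    have : ∀ᶠ n in atTop, ∀ x ∈ L ∩ Icc u v, φ n x ∈ Ls n ∩ Icc u v := by
      rw [eventually_all_finite hfin]
      intro x hx
      have hux : u < x := lt_of_le_of_ne hx.2.1 fun h => hu (h ▸ hx.1)
      have hxv : x < v := lt_of_le_of_ne hx.2.2 fun h => hv (h ▸ hx.1)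
      filter_upwards [hmem x hx.1, (hlim x hx.1).eventually (Icc_mem_nhds hux hxv)] with n h1 h2
      exact ⟨h1, h2⟩
    exact this
  have hinj : ∀ᶠ n in atTop, InjOn (φ n) (L ∩ Icc u v) := by
    have : ∀ᶠ n in atTop, ∀ x ∈ L ∩ Icc u v, ∀ y ∈ L ∩ Icc u v, φ n x = φ n y → x = y := by
      rw [eventually_all_finite hfin]
      intro x hx
      rw [eventually_all_finite hfin]
      intro y hy
      by_cases hxy : x = y
      · exact Eventually.of_forall fun _ _ => hxy
      · filter_upwards [((hlim x hx.1).sub (hlim y hy.1)).eventually_ne (sub_ne_zero.2 hxy)]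
          with n hn h
        exact absurd (sub_eq_zero.2 h) hn
    filter_upwards [this] with n hn x hx y hy hxy
    exact hn x hx y hy hxy
  have hsurj : ∀ᶠ n in atTop, ∀ y ∈ Icc u v, y ∈ Ls n → y ∈ φ n '' (L ∩ Icc u v) := by
    refine isCompact_Icc.induction_on
      (p := fun s => ∀ᶠ n in atTop, ∀ y ∈ s, y ∈ Ls n → y ∈ φ n '' (L ∩ Icc u v)) ?_ ?_ ?_ ?_
    · simp
    · intro s t hst ht
      filter_upwards [ht] with n hn y hy
      exact hn y (hst hy)
    · intro s t hs ht
      filter_upwards [hs, ht] with n h1 h2 y hy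
      exact hy.elim (h1 y) (h2 y)
    · intro x hx
      by_cases hxL : x ∈ L
      · obtain ⟨ε, hε, hsub⟩ := h.subsingleton x hxL
        refine ⟨Metric.ball x ε, mem_nhdsWithin_of_mem_nhds (Metric.ball_mem_nhds x hε), ?_⟩
        filter_upwards [hsub, hmem x hxL, (hlim x hxL).eventually (Metric.ball_mem_nhds x hε)]
          with n h1 h2 h3 y hy hyL
        rw [Real.dist_eq] at h3
        rw [Metric.mem_ball, Real.dist_eq] at hy
        exact ⟨x, ⟨hxL, hx⟩, h1 _ h2 _ hyL h3 hy⟩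
      · obtain ⟨ε, hε, hav⟩ := h.avoid x hxL
        refine ⟨Metric.ball x ε, mem_nhdsWithin_of_mem_nhds (Metric.ball_mem_nhds x hε), ?_⟩
        filter_upwards [hav] with n h1 y hy hyL
        rw [Metric.mem_ball, Real.dist_eq] at hy
        exact absurd hy (not_lt.2 (h1 y hyL))
  filter_upwards [hmaps, hinj, hsurj] with n h1 h2 h3
  exact ⟨h1, h2, fun y hy => h3 y hy.2 hy.1⟩

lemma sum_window_eq_of_bijOn {E : Type*} [AddCommMonoid E] {L M A : Set ℝ} {φ : ℝ → ℝ}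
    (hL : (L ∩ A).Finite) (h : BijOn φ (L ∩ A) (M ∩ A)) (f : ℝ → E) :
    ∑ y ∈ window M A, f y = ∑ x ∈ window L A, f (φ x) := by
  have hM : (M ∩ A).Finite := h.image_eq ▸ hL.image φ
  refine (Finset.sum_nbij φ ?_ ?_ ?_ fun _ _ => rfl).symm
  · intro x hx
    exact (mem_window_of_finite hM).2 (h.mapsTo ((mem_window_of_finite hL).1 hx))
  · intro x hx y hy hxy
    exact h.injOn ((mem_window_of_finite hL).1 hx) ((mem_window_of_finite hL).1 hy) hxy
  · intro y hy
    obtain ⟨x, hx, rfl⟩ := h.surjOn ((mem_window_of_finite hM).1 hy)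
    exact ⟨x, (mem_window_of_finite hL).2 hx, rfl⟩

lemma LocConv.tendsto_sum {E : Type*} [AddCommMonoid E] [TopologicalSpace E] [ContinuousAdd E]
    {Ls : ℕ → Set ℝ} {L : Set ℝ} (hL : LocallyFiniteSet L) (h : LocConv Ls L) {f : ℝ → E}
    {u v : ℝ} (hu : u ∉ L) (hv : v ∉ L) (hf : ∀ x ∈ L ∩ Icc u v, ContinuousAt f x) :
    Tendsto (fun n => ∑ y ∈ window (Ls n) (Icc u v), f y) atTop
      (𝓝 (∑ x ∈ window L (Icc u v), f x)) := by
  obtain ⟨φ, hφ, hbij⟩ := h.exists_matching hL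
  have : Tendsto (fun n => ∑ x ∈ window L (Icc u v), f (φ n x)) atTop
      (𝓝 (∑ x ∈ window L (Icc u v), f x)) := by
    refine tendsto_finsetSum _ fun x hx => ?_
    have hx' := hL.mem_Icc.1 hx
    exact (hf x hx').tendsto.comp (hφ x hx'.1)
  refine this.congr' ?_
  filter_upwards [hbij u v hu hv] with n hn
  exact (sum_window_eq_of_bijOn (hL.finite_inter (Metric.isBounded_Icc u v)) hn f).symm

lemma LocConv.tendstoLocallyWeakly {Ls : ℕ → Set ℝ} {L : Set ℝ}
    (hLs : ∀ᶠ n in atTop, LocallyFiniteSet (Ls n)) (hL : LocallyFiniteSet L) (h : LocConv Ls L) :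
    TendstoLocallyWeakly (fun n => pointMeasure (Ls n)) (pointMeasure L) := by
  intro f hf hfs
  obtain ⟨R, hR⟩ := hfs.isCompact.isBounded.subset_closedBall 0
  obtain ⟨v, hv, hv1, hv2⟩ := hL.exists_mem_Ioo (lt_add_one R)
  have hsupp : ∀ x, x ∉ Icc (-v) v → f x = 0 := by
    intro x hx
    by_contra hne
    have := hR (subset_tsupport f hne)
    rw [Metric.mem_closedBall, dist_zero_right, Real.norm_eq_abs] at this
    exact hx (abs_le.1 (this.trans hv.1.le))
  rw [integral_pointMeasure hL hsupp]
  refine (h.tendsto_sum hL hv2 hv1 fun x _ => hf.continuousAt).congr' ?_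
  filter_upwards [hLs] with n hn
  exact (integral_pointMeasure hn hsupp).symm

lemma LocConv.tendsto_sum_annulus {Ls : ℕ → Set ℝ} {L : Set ℝ}
    (hL : LocallyFiniteSet L) (h : LocConv Ls L) {f : ℝ → ℝ} {r t : ℝ} (hr : 0 < r)
    (hf : ∀ x, r ≤ |x| → ContinuousAt f x)
    (hr1 : r ∉ L) (hr2 : -r ∉ L) (ht1 : t ∉ L) (ht2 : -t ∉ L) :
    Tendsto (fun n => ∑ y ∈ window (Ls n) (annulus r t), f y) atTop
      (𝓝 (∑ x ∈ window L (annulus r t), f x)) := by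
  obtain ⟨φ, hφ, hbij⟩ := h.exists_matching hL
  have hfin : (L ∩ annulus r t).Finite := hL.finite_inter (isBounded_annulus r t)
  have : Tendsto (fun n => ∑ x ∈ window L (annulus r t), f (φ n x)) atTop
      (𝓝 (∑ x ∈ window L (annulus r t), f x)) := by
    refine tendsto_finsetSum _ fun x hx => ?_
    have hx' := hL.mem_annulus.1 hx
    exact (hf x hx'.2.1.le).tendsto.comp (hφ x hx'.1)
  refine this.congr' ?_
  have hav : ∀ p ∉ L, ∀ᶠ n in atTop, p ∉ Ls n := fun p hp => by
    obtain ⟨ε, hε, hp⟩ := h.avoid p hp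
    filter_upwards [hp] with n hn hmem
    have := hn p hmem
    rw [sub_self, abs_zero] at this
    exact absurd hε (not_lt.2 this)
  filter_upwards [hbij r t hr1 ht1, hbij (-t) (-r) ht2 hr2, hav r hr1, hav _ hr2] with n h1 h2 h3 h4
  refine (sum_window_eq_of_bijOn hfin ?_ f).symm
  -- Once `±r` are excluded, the half-open annulus meets the set in two closed intervals, to each of
  -- which the matching applies.
  have hset : ∀ M : Set ℝ, r ∉ M → -r ∉ M →
      M ∩ annulus r t = (M ∩ Icc (-t) (-r)) ∪ (M ∩ Icc r t) := by
    intro M hM1 hM2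
    ext x
    simp only [annulus, mem_inter_iff, mem_union, mem_ofPred_eq, mem_Icc]
    have e1 : x ∈ M → x ≠ r := fun hx h => hM1 (h ▸ hx)
    have e2 : x ∈ M → x ≠ -r := fun hx h => hM2 (h ▸ hx)
    constructor
    · rintro ⟨hx, h5, h6⟩
      rcases le_total 0 x with h0 | h0
      · rw [abs_of_nonneg h0] at h5 h6; exact Or.inr ⟨hx, h5.le, h6⟩
      · rw [abs_of_nonpos h0] at h5 h6; exact Or.inl ⟨hx, by linarith, by linarith⟩
    · rintro (⟨hx, h5, h6⟩ | ⟨hx, h5, h6⟩)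
      · have := lt_of_le_of_ne h6 (e2 hx)
        rw [abs_of_nonpos (by linarith)]
        exact ⟨hx, by linarith, by linarith⟩
      · have := lt_of_le_of_ne h5 (e1 hx).symm
        rw [abs_of_nonneg (by linarith)]
        exact ⟨hx, by linarith, by linarith⟩
  rw [hset L hr1 hr2, hset (Ls n) h3 h4]
  refine h2.union h1 ?_
  rintro x (hx | hx) y (hy | hy) hxy
  · exact h2.injOn hx hy hxy
  · have e1 := (h2.mapsTo hx).2.2
    have e2 := (h1.mapsTo hy).2.1
    rw [hxy] at e1; linarith
  · have e1 := (h1.mapsTo hx).2.1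
    have e2 := (h2.mapsTo hy).2.2
    rw [hxy] at e1; linarith
  · exact h1.injOn hx hy hxy

/-! ### Abel summation against functions decaying like `1 / |x|`. -/

section Abel

/-- The right side is the integral of `x ^ (β - 2)` over `[m, q]`, and the left side replaces `x ^
β` by its minimum there. Being an integral, the bound telescopes in the Abel summation. The
algebraic proof is Bernoulli's inequality for the exponent `1 - β` at `m / q`. -/
lemma rpow_mul_inv_sub_inv_le {β m q : ℝ} (hβ0 : 0 ≤ β) (hβ1 : β < 1) (hm : 0 < m) (hmq : m ≤ q) :
    m ^ β * (1 / m - 1 / q) ≤ (m ^ (β - 1) - q ^ (β - 1)) / (1 - β) := by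
  have hq : 0 < q := hm.trans_le hmq
  have hs0 : 0 < m / q := by positivity
  have hb := rpow_one_add_le_one_add_mul_self (s := m / q - 1) (p := 1 - β) (by linarith)
    (by linarith) (by linarith)
  rw [add_sub_cancel] at hb
  have h1 : q ^ (β - 1) = m ^ (β - 1) * (m / q) ^ (1 - β) := by
    rw [Real.div_rpow hm.le hq.le, show 1 - β = -(β - 1) by ring, Real.rpow_neg hm.le,
      Real.rpow_neg hq.le]
    have := Real.rpow_pos_of_pos hm (β - 1)
    field_simp
  have h2 : m ^ β = m ^ (β - 1) * m := by
    rw [← Real.rpow_add_one hm.ne']; congr 1; ring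
  have h3 : m ^ β * (1 / m - 1 / q) = m ^ (β - 1) * (1 - m / q) := by
    rw [h2]; field_simp
  rw [h3, h1, le_div_iff₀ (by linarith)]
  have := Real.rpow_pos_of_pos hm (β - 1)
  nlinarith

/-- `f` decays at least as fast as `1 / |x|`, with increments controlled by those of `1 / |x|`,
on each of the half-lines `x ≤ -r` and `x ≥ r`. -/
def DecaysLikeInv (f : ℝ → ℝ) (r A : ℝ) : Prop :=
  ∀ x y : ℝ, r ≤ |x| → |x| ≤ |y| → 0 < x * y →
    |f x| ≤ A / |x| ∧ |f x - f y| ≤ A * (1 / |x| - 1 / |y|)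

lemma DecaysLikeInv.comp_neg {f : ℝ → ℝ} {r A : ℝ} (hf : DecaysLikeInv f r A) :
    DecaysLikeInv (fun x => f (-x)) r A := by
  intro x y h1 h2 h3
  have := hf (-x) (-y) (by rwa [abs_neg]) (by rwa [abs_neg, abs_neg]) (by linarith)
  rwa [abs_neg, abs_neg] at this

/-- Abel summation by induction on the largest point `m`. The free endpoint `q` makes the induction
close: the hypothesis is used with endpoint `m`, and passing from `f m` to `f q` costs the full
partial sum times an increment of `f`. -/
lemma abs_sum_sub_le {f u : ℝ → ℝ} {r A C β : ℝ} (hr : 0 < r) (hβ0 : 0 ≤ β) (hβ1 : β < 1)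
    (hA : 0 ≤ A) (hC : 0 ≤ C) (hf : DecaysLikeInv f r A) (F : Finset ℝ) :
    (∀ x ∈ F, r ≤ x) → (∀ x ∈ F, |∑ y ∈ F with y ≤ x, u y| ≤ C * x ^ β) →
    ∀ q, r ≤ q → (∀ x ∈ F, x ≤ q) →
      |∑ y ∈ F, u y * f y - (∑ y ∈ F, u y) * f q| ≤
        C * A * ((r ^ (β - 1) - q ^ (β - 1)) / (1 - β)) := by
  classical
  induction F using Finset.induction_on_max with
  | empty =>
    intro _ _ q hq _
    have : q ^ (β - 1) ≤ r ^ (β - 1) := Real.rpow_le_rpow_of_nonpos hr hq (by linarith)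
    have : 0 ≤ (r ^ (β - 1) - q ^ (β - 1)) / (1 - β) := div_nonneg (by linarith) (by linarith)
    simp only [Finset.sum_empty, zero_mul, sub_zero, abs_zero]
    positivity
  | insert m F hm ih =>
    intro hF hD q hq hFq
    have hmF : m ∉ F := fun h => lt_irrefl _ (hm m h)
    have hrm : r ≤ m := hF m (Finset.mem_insert_self _ _)
    have hmq : m ≤ q := hFq m (Finset.mem_insert_self _ _)
    have hm0 : 0 < m := hr.trans_le hrm
    have ih' := ih (fun x hx => hF x (Finset.mem_insert_of_mem hx)) (fun x hx => by
      have := hD x (Finset.mem_insert_of_mem hx)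
      rwa [Finset.filter_insert, if_neg (not_le.2 (hm x hx))] at this) m hrm fun x hx => (hm x hx).le
    have hDm := hD m (Finset.mem_insert_self _ _)
    rw [Finset.filter_true_of_mem fun y hy => by
      rcases Finset.mem_insert.1 hy with rfl | h
      exacts [le_rfl, (hm y h).le]] at hDm
    have hfm := (hf m q (by rwa [abs_of_pos hm0])
      (by rwa [abs_of_pos hm0, abs_of_pos (hm0.trans_le hmq)]) (mul_pos hm0 (hm0.trans_le hmq))).2
    rw [abs_of_pos hm0, abs_of_pos (hm0.trans_le hmq)] at hfm
    have e : ∑ y ∈ insert m F, u y * f y - (∑ y ∈ insert m F, u y) * f q =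
        (∑ y ∈ F, u y * f y - (∑ y ∈ F, u y) * f m) +
          (∑ y ∈ insert m F, u y) * (f m - f q) := by
      rw [Finset.sum_insert hmF, Finset.sum_insert hmF]; ring
    rw [e]
    refine (abs_add_le _ _).trans ?_
    rw [abs_mul]
    have h1 : |∑ y ∈ insert m F, u y| * |f m - f q| ≤ (C * m ^ β) * (A * (1 / m - 1 / q)) :=
      mul_le_mul hDm hfm (abs_nonneg _) (by positivity)
    have h2 := mul_le_mul_of_nonneg_left (rpow_mul_inv_sub_inv_le hβ0 hβ1 hm0 hmq)
      (mul_nonneg hC hA)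
    have h3 : C * A * ((r ^ (β - 1) - q ^ (β - 1)) / (1 - β)) =
        C * A * ((r ^ (β - 1) - m ^ (β - 1)) / (1 - β)) +
          C * A * ((m ^ (β - 1) - q ^ (β - 1)) / (1 - β)) := by ring
    rw [h3]
    nlinarith

/-- With `q` the largest point, the boundary term is at most `C * q ^ β * (A / q)`, of the same
order as the rest since `β < 1`. -/
lemma abs_sum_mul_le {f u : ℝ → ℝ} {r A C β : ℝ} (hr : 0 < r) (hβ0 : 0 ≤ β) (hβ1 : β < 1)
    (hA : 0 ≤ A) (hC : 0 ≤ C) (hf : DecaysLikeInv f r A) (F : Finset ℝ)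
    (hF : ∀ x ∈ F, r ≤ x) (hD : ∀ x ∈ F, |∑ y ∈ F with y ≤ x, u y| ≤ C * x ^ β) :
    |∑ y ∈ F, u y * f y| ≤ C * A * (1 + 1 / (1 - β)) * r ^ (β - 1) := by
  have h1β : 0 < 1 - β := by linarith
  have hrp := Real.rpow_pos_of_pos hr (β - 1)
  rcases F.eq_empty_or_nonempty with rfl | hne
  · simp only [Finset.sum_empty, abs_zero]
    positivity
  have hq := F.max'_mem hne
  set q := F.max' hne with hqdef
  have hrq : r ≤ q := hF q hq
  have hq0 : 0 < q := hr.trans_le hrq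
  have h1 := abs_sum_sub_le hr hβ0 hβ1 hA hC hf F hF hD q hrq fun x hx => F.le_max' x hx
  have hDq := hD q hq
  rw [Finset.filter_true_of_mem fun y hy => F.le_max' y hy] at hDq
  have hfq := (hf q q (by rwa [abs_of_pos hq0]) le_rfl (mul_pos hq0 hq0)).1
  rw [abs_of_pos hq0] at hfq
  have h2 : |(∑ y ∈ F, u y) * f q| ≤ C * A * r ^ (β - 1) := by
    rw [abs_mul]
    calc _ ≤ (C * q ^ β) * (A / q) := mul_le_mul hDq hfq (abs_nonneg _) (by positivity)
      _ = C * A * q ^ (β - 1) := by rw [Real.rpow_sub_one hq0.ne']; ring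
      _ ≤ _ := by
        gcongr C * A * ?_
        exact Real.rpow_le_rpow_of_nonpos hr hrq (by linarith)
  have h3 : (r ^ (β - 1) - q ^ (β - 1)) / (1 - β) ≤ r ^ (β - 1) / (1 - β) := by
    gcongr
    linarith [Real.rpow_pos_of_pos hq0 (β - 1)]
  have h4 := mul_le_mul_of_nonneg_left h3 (mul_nonneg hC hA)
  have h5 := abs_add_le (∑ y ∈ F, u y * f y - (∑ y ∈ F, u y) * f q) ((∑ y ∈ F, u y) * f q)
  rw [sub_add_cancel] at h5
  have h6 : C * A * (1 + 1 / (1 - β)) * r ^ (β - 1) =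
    C * A * r ^ (β - 1) + C * A * (r ^ (β - 1) / (1 - β)) := by ring
  linarith

/-- The two half-lines are treated separately, the negative one by reflection, whence the factor
`2`. -/
lemma abs_sum_window_annulus_le {L : Set ℝ} (hL : LocallyFiniteSet L) {f u : ℝ → ℝ}
    {r t A C β : ℝ} (hr : 0 < r) (hβ0 : 0 ≤ β) (hβ1 : β < 1) (hA : 0 ≤ A) (hC : 0 ≤ C)
    (hf : DecaysLikeInv f r A)
    (hpos : ∀ x, r < x → |∑ y ∈ window L (Ioc r x), u y| ≤ C * x ^ β)
    (hneg : ∀ x, r < x → |∑ y ∈ window L (Ico (-x) (-r)), u y| ≤ C * x ^ β) :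
    |∑ y ∈ window L (annulus r t), u y * f y| ≤
      2 * (C * A * (1 + 1 / (1 - β))) * r ^ (β - 1) := by
  classical
  set F := window L (annulus r t) with hFdef
  have hmem : ∀ x, x ∈ F ↔ x ∈ L ∧ r < |x| ∧ |x| ≤ t := fun x => hL.mem_annulus
  have hsplit : ∑ y ∈ F, u y * f y = ∑ y ∈ F with 0 < y, u y * f y +
      ∑ y ∈ (F.filter (¬ 0 < ·)).image (fun x => -x), u (-y) * f (-y) := by
    rw [Finset.sum_image fun x _ y _ h => neg_injective h]
    simp only [neg_neg]
    exact (Finset.sum_filter_add_sum_filter_not _ _ _).symm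
  have h1 : |∑ y ∈ F with 0 < y, u y * f y| ≤ C * A * (1 + 1 / (1 - β)) * r ^ (β - 1) := by
    refine abs_sum_mul_le hr hβ0 hβ1 hA hC hf _ ?_ ?_
    · intro x hx
      rw [Finset.mem_filter, hmem] at hx
      have := hx.1.2.1
      rw [abs_of_pos hx.2] at this
      exact this.le
    · intro x hx
      rw [Finset.mem_filter, hmem] at hx
      have hx2 := hx.1.2
      rw [abs_of_pos hx.2] at hx2
      convert hpos x hx2.1 using 4
      ext y
      rw [Finset.mem_filter, Finset.mem_filter, hmem, hL.mem_window (Metric.isBounded_Ioc r x),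
        Set.mem_Ioc]
      constructor
      · rintro ⟨⟨⟨a1, a2, a3⟩, a4⟩, a5⟩
        rw [abs_of_pos a4] at a2
        exact ⟨a1, a2, a5⟩
      · rintro ⟨a1, a2, a3⟩
        rw [abs_of_pos (hr.trans a2)]
        exact ⟨⟨⟨a1, a2, a3.trans hx2.2⟩, hr.trans a2⟩, a3⟩
  have h2 : |∑ y ∈ (F.filter (¬ 0 < ·)).image (fun x => -x), u (-y) * f (-y)| ≤
      C * A * (1 + 1 / (1 - β)) * r ^ (β - 1) := by
    have hmem' : ∀ x, x ∈ (F.filter (¬ 0 < ·)).image (fun x => -x) ↔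
        -x ∈ L ∧ r < x ∧ x ≤ t := by
      intro x
      rw [Finset.mem_image]
      constructor
      · rintro ⟨y, hy, rfl⟩
        rw [Finset.mem_filter, hmem] at hy
        obtain ⟨⟨a1, a2, a3⟩, a4⟩ := hy
        rw [abs_of_nonpos (not_lt.1 a4)] at a2 a3
        exact ⟨by rwa [neg_neg], a2, a3⟩
      · rintro ⟨a1, a2, a3⟩
        refine ⟨-x, ?_, neg_neg x⟩
        rw [Finset.mem_filter, hmem, abs_neg, abs_of_pos (hr.trans a2)]
        exact ⟨⟨a1, a2, a3⟩, by linarith⟩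
    refine abs_sum_mul_le (u := fun y => u (-y)) hr hβ0 hβ1 hA hC hf.comp_neg _ ?_ ?_
    · intro x hx
      exact ((hmem' x).1 hx).2.1.le
    · intro x hx
      rw [hmem'] at hx
      convert hneg x hx.2.1 using 2
      refine Finset.sum_nbij (fun x => -x) ?_ ?_ ?_ fun _ _ => rfl
      · intro y hy
        rw [Finset.mem_filter, hmem'] at hy
        exact (hL.mem_window (Metric.isBounded_Ico _ _)).2 ⟨hy.1.1, by linarith, by linarith⟩
      · exact fun y _ z _ h => neg_injective h
      · intro y hy
        have hy' := (hL.mem_window (Metric.isBounded_Ico _ _)).1 hy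
        refine ⟨-y, ?_, neg_neg y⟩
        rw [Finset.mem_coe, Finset.mem_filter, hmem', neg_neg]
        exact ⟨⟨hy'.1, by linarith [hy'.2.2], by linarith [hy'.2.1]⟩, by linarith [hy'.2.1]⟩
  rw [hsplit]
  refine (abs_add_le _ _).trans ?_
  linarith

lemma decaysLikeInv_inv {r : ℝ} (hr : 0 < r) : DecaysLikeInv (fun x => x⁻¹) r 1 := by
  intro x y h1 h2 h3
  have hx : 0 < |x| := hr.trans_le h1
  have hy : 0 < |y| := hx.trans_le h2
  refine ⟨by rw [abs_inv, one_div], ?_⟩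
  rw [one_mul, inv_sub_inv (abs_pos.1 hx) (abs_pos.1 hy), abs_div, abs_mul, div_sub_div _ _ hx.ne' hy.ne']
  gcongr
  rcases pos_and_pos_or_neg_and_neg_of_mul_pos h3 with ⟨a, b⟩ | ⟨a, b⟩
  · rw [abs_of_pos a, abs_of_pos b] at *
    rw [abs_of_nonneg (by linarith)]; linarith
  · rw [abs_of_neg a, abs_of_neg b] at *
    rw [abs_of_nonpos (by linarith)]; linarith

/-- Since `2 * |a| ≤ r`, each of `|x - a|` and `|y - a|` is at least half of `|x|` and `|y|`; the
two halves give `4`. -/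
lemma decaysLikeInv_inv_sub {a r : ℝ} (hr : 0 < r) (ha : 2 * |a| ≤ r) :
    DecaysLikeInv (fun x => (x - a)⁻¹) r 4 := by
  have key : ∀ x, r ≤ |x| → |x| / 2 ≤ |x - a| := fun x hx => by
    have := abs_sub_abs_le_abs_sub x a
    linarith
  intro x y h1 h2 h3
  have hx : 0 < |x| := hr.trans_le h1
  have hy : 0 < |y| := hx.trans_le h2
  have kx := key x h1
  have ky := key y (h1.trans h2)
  have hxa : 0 < |x - a| := by linarith
  have hya : 0 < |y - a| := by linarith
  refine ⟨?_, ?_⟩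
  · rw [abs_inv, inv_eq_one_div, div_le_div_iff₀ hxa hx]; linarith
  · have e : |y - x| = |y| - |x| := by
      rcases pos_and_pos_or_neg_and_neg_of_mul_pos h3 with ⟨a, b⟩ | ⟨a, b⟩
      · rw [abs_of_pos a, abs_of_pos b] at *
        rw [abs_of_nonneg (by linarith)]
      · rw [abs_of_neg a, abs_of_neg b] at *
        rw [abs_of_nonpos (by linarith)]; ring
    rw [inv_sub_inv (abs_pos.1 hxa) (abs_pos.1 hya), abs_div, abs_mul, div_sub_div _ _ hx.ne' hy.ne',
      sub_sub_sub_cancel_right, e, mul_div_assoc', div_le_div_iff₀ (by positivity) (by positivity)]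
    have : |x| * |y| ≤ 4 * (|x - a| * |y - a|) := by nlinarith
    nlinarith [mul_le_mul_of_nonneg_left this (sub_nonneg.2 h2)]

/-- Bernoulli's inequality bounds `1 - (|x| / |y|) ^ p` by `p * (1 - |x| / |y|)`, and `p ≤ 2` gives
the constant. The remaining factor `1 / |x| ^ p` is at most `1 / |x|` because `|x| ≥ 1`. -/
lemma decaysLikeInv_rpow {p r : ℝ} (hr : 1 ≤ r) (hp1 : 1 ≤ p) (hp2 : p ≤ 2) :
    DecaysLikeInv (fun x => 1 / |x| ^ p) r 2 := by
  intro x y h1 h2 _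
  have hx1 : 1 ≤ |x| := hr.trans h1
  have hx : 0 < |x| := by linarith
  have hy : 0 < |y| := hx.trans_le h2
  have hxp : 0 < |x| ^ p := by positivity
  have hyp : 0 < |y| ^ p := by positivity
  have hle : |x| ≤ |x| ^ p := by
    simpa using Real.rpow_le_rpow_of_exponent_le hx1 hp1
  refine ⟨?_, ?_⟩
  · rw [abs_of_pos (by positivity)]
    rw [div_le_div_iff₀ hxp hx]; linarith
  · have hmono : |x| ^ p ≤ |y| ^ p := Real.rpow_le_rpow hx.le h2 (by linarith)
    rw [abs_of_nonneg (sub_nonneg.2 (one_div_le_one_div_of_le hxp hmono))]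
    have hs0 : 0 < |x| / |y| := by positivity
    have hs1 : |x| / |y| ≤ 1 := (div_le_one hy).2 h2
    have hb := one_add_mul_self_le_rpow_one_add (s := |x| / |y| - 1) (by linarith) hp1
    rw [add_sub_cancel, Real.div_rpow hx.le hy.le] at hb
    have e1 : 1 / |x| ^ p - 1 / |y| ^ p = (1 / |x| ^ p) * (1 - |x| ^ p / |y| ^ p) := by
      field_simp
    have e2 : 2 * (1 / |x| - 1 / |y|) = (1 / |x|) * (2 * (1 - |x| / |y|)) := by
      field_simp
    rw [e1, e2]
    refine mul_le_mul (one_div_le_one_div_of_le hx hle) ?_ ?_ (by positivity)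
    · nlinarith
    · rw [sub_nonneg, div_le_one hyp]; exact hmono

end Abel

/-! ### Labels, weights and their discrepancy from the mean. -/

/-- The weight of the real `x` in the weighted version of `L`, equal to `0` off `L`. -/
def pointWeight (L : Set ℝ) (γ : ℤ → ℝ) (a x : ℝ) : ℝ :=
  L.indicator (fun x => γ (pointIndex L a x)) x

lemma pointWeight_of_mem {L : Set ℝ} {γ : ℤ → ℝ} {a x : ℝ} (hx : x ∈ L) :
    pointWeight L γ a x = γ (pointIndex L a x) := indicator_of_mem hx _

lemma LocallyFiniteSet.ncard_eq {L : Set ℝ} (hL : LocallyFiniteSet L) {A : Set ℝ} (hA : Bornology.IsBounded A) :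
    (L ∩ A).ncard = (window L A).card := by
  rw [window, dif_pos (hL.finite_inter hA), Set.ncard_eq_toFinset_card _ (hL.finite_inter hA)]

/-- Labels increase strictly along `L`, so they map the window injectively into `1, …, N`, with `N`
its cardinality; hence onto. Sums over points become sums over consecutive labels, to which the
hypotheses on the weights apply. -/
lemma LocallyFiniteSet.sum_pointIndex_Ioc {L : Set ℝ} (hL : LocallyFiniteSet L) {a : ℝ} (t : ℝ)
    (g : ℤ → ℝ) :
    ∑ x ∈ window L (Ioc a t), g (pointIndex L a x) =
      ∑ k ∈ Finset.Icc (1 : ℤ) ((window L (Ioc a t)).card : ℤ), g k := by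
  classical
  have hm : ∀ {s x}, x ∈ window L (Ioc a s) ↔ x ∈ L ∧ a < x ∧ x ≤ s := fun {s x} =>
    hL.mem_window (Metric.isBounded_Ioc a s)
  have hidx : ∀ x, a < x → pointIndex L a x = ((window L (Ioc a x)).card : ℤ) := fun x hx => by
    rw [pointIndex, if_pos hx, hL.ncard_eq (Metric.isBounded_Ioc a x)]
  have hmono : ∀ x y, y ∈ L → a < x → x < y → pointIndex L a x < pointIndex L a y := by
    intro x y hy hax hxy
    rw [hidx x hax, hidx y (hax.trans hxy), Nat.cast_lt]
    refine Finset.card_lt_card (Finset.ssubset_iff_subset_ne.2 ⟨fun z hz => ?_, fun h => ?_⟩)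
    · rw [hm] at hz ⊢
      exact ⟨hz.1, hz.2.1, hz.2.2.trans hxy.le⟩
    · have : y ∈ window L (Ioc a x) := h ▸ hm.2 ⟨hy, hax.trans hxy, le_rfl⟩
      exact absurd (hm.1 this).2.2 (not_le.2 hxy)
  have hinj : Set.InjOn (pointIndex L a) (window L (Ioc a t)) := by
    intro x hx y hy hxy
    have hx' := hm.1 hx
    have hy' := hm.1 hy
    rcases lt_trichotomy x y with h | h | h
    · exact absurd hxy (hmono x y hy'.1 hx'.2.1 h).ne
    · exact h
    · exact absurd hxy (hmono y x hx'.1 hy'.2.1 h).ne'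
  rw [← Finset.sum_image (f := g) hinj]
  congr 1
  refine Finset.eq_of_subset_of_card_le (fun k hk => ?_) ?_
  · obtain ⟨x, hx, rfl⟩ := Finset.mem_image.1 hk
    have hx' := hm.1 hx
    rw [hidx x hx'.2.1, Finset.mem_Icc]
    norm_cast
    refine ⟨Finset.card_pos.2 ⟨x, hm.2 ⟨hx'.1, hx'.2.1, le_rfl⟩⟩, Finset.card_le_card fun y hy => ?_⟩
    rw [hm] at hy ⊢
    exact ⟨hy.1, hy.2.1, hy.2.2.trans hx'.2.2⟩
  · rw [Finset.card_image_of_injOn hinj, Int.card_Icc]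
    simp

lemma LocallyFiniteSet.sum_pointIndex_Ico {L : Set ℝ} (hL : LocallyFiniteSet L) {a : ℝ} (t : ℝ)
    (g : ℤ → ℝ) :
    ∑ x ∈ window L (Ico t a), g (pointIndex L a x) =
      ∑ k ∈ Finset.Icc (1 - (window L (Ico t a)).card : ℤ) 0, g k := by
  classical
  have hm : ∀ {s x}, x ∈ window L (Ico s a) ↔ x ∈ L ∧ s ≤ x ∧ x < a := fun {s x} =>
    hL.mem_window (Metric.isBounded_Ico s a)
  have hidx : ∀ x, x < a → pointIndex L a x = 1 - ((window L (Ico x a)).card : ℤ) := fun x hx => by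
    rw [pointIndex, if_neg (not_lt.2 hx.le), hL.ncard_eq (Metric.isBounded_Ico x a)]
  have hmono : ∀ x y, x ∈ L → y < a → x < y → pointIndex L a x < pointIndex L a y := by
    intro x y hx hya hxy
    rw [hidx x (hxy.trans hya), hidx y hya, sub_lt_sub_iff_left, Nat.cast_lt]
    refine Finset.card_lt_card (Finset.ssubset_iff_subset_ne.2 ⟨fun z hz => ?_, fun h => ?_⟩)
    · rw [hm] at hz ⊢
      exact ⟨hz.1, hxy.le.trans hz.2.1, hz.2.2⟩
    · have : x ∈ window L (Ico y a) := h ▸ hm.2 ⟨hx, le_rfl, hxy.trans hya⟩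
      exact absurd (hm.1 this).2.1 (not_le.2 hxy)
  have hinj : Set.InjOn (pointIndex L a) (window L (Ico t a)) := by
    intro x hx y hy hxy
    have hx' := hm.1 hx
    have hy' := hm.1 hy
    rcases lt_trichotomy x y with h | h | h
    · exact absurd hxy (hmono x y hx'.1 hy'.2.2 h).ne
    · exact h
    · exact absurd hxy (hmono y x hy'.1 hx'.2.2 h).ne'
  rw [← Finset.sum_image (f := g) hinj]
  congr 1
  refine Finset.eq_of_subset_of_card_le (fun k hk => ?_) ?_
  · obtain ⟨x, hx, rfl⟩ := Finset.mem_image.1 hk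
    have hx' := hm.1 hx
    rw [hidx x hx'.2.2, Finset.mem_Icc, sub_le_sub_iff_left, sub_nonpos]
    norm_cast
    refine ⟨Finset.card_le_card fun y hy => ?_, Finset.card_pos.2 ⟨x, hm.2 ⟨hx'.1, le_rfl, hx'.2.2⟩⟩⟩
    rw [hm] at hy ⊢
    exact ⟨hy.1, hx'.2.1.trans hy.2.1, hy.2.2⟩
  · rw [Finset.card_image_of_injOn hinj, Int.card_Icc]
    simp

/-- Positive weights whose partial sums are close to those of the constant `γbar`. -/
structure WeightBounds (γ : ℤ → ℝ) (γbar c p : ℝ) : Prop where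
  pos : ∀ k, 0 < γ k
  right : ∀ m : ℕ, 1 ≤ m →
    |(∑ k ∈ Finset.Ico (0 : ℤ) (m : ℤ), γ k) - γbar * (m : ℝ)| ≤ c * (m : ℝ) ^ p
  left : ∀ m : ℕ, 1 ≤ m →
    |(∑ k ∈ Finset.Ico (-(m : ℤ)) (0 : ℤ), γ k) - γbar * (m : ℝ)| ≤ c * (m : ℝ) ^ p

section Discrepancy

variable {γ : ℤ → ℝ} {γbar c p : ℝ}

lemma WeightBounds.abs_zero_sub_le (h : WeightBounds γ γbar c p) : |γ 0 - γbar| ≤ c := by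
  have := h.right 1 le_rfl
  have e : Finset.Ico (0 : ℤ) ((1 : ℕ) : ℤ) = {0} := by decide
  rw [e] at this
  simpa using this

/-- The hypothesis sums labels from `0`, whereas points to the right of the base point start at
label `1`. The sum over `m + 1` labels is used and label `0` removed, at a cost of at most `c`. -/
lemma WeightBounds.sum_Icc_one_le (h : WeightBounds γ γbar c p) (hc : 0 < c) (hp : 0 < p) (m : ℕ) :
    |∑ k ∈ Finset.Icc (1 : ℤ) (m : ℤ), (γ k - γbar)| ≤ 2 * c * ((m : ℝ) + 1) ^ p := by
  have h1 := h.right (m + 1) (by omega)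
  have h0 := h.abs_zero_sub_le
  have e : Finset.Ico (0 : ℤ) ((m + 1 : ℕ) : ℤ) = insert 0 (Finset.Icc (1 : ℤ) (m : ℤ)) := by
    ext k; simp only [Finset.mem_Ico, Finset.mem_insert, Finset.mem_Icc]; omega
  rw [e, Finset.sum_insert (by simp)] at h1
  have h2 : (1 : ℝ) ≤ ((m : ℝ) + 1) ^ p := Real.one_le_rpow (by simp) hp.le
  have h3 : ∑ k ∈ Finset.Icc (1 : ℤ) (m : ℤ), (γ k - γbar) =
      (γ 0 + ∑ k ∈ Finset.Icc (1 : ℤ) (m : ℤ), γ k - γbar * ((m + 1 : ℕ) : ℝ)) - (γ 0 - γbar) := by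
    rw [Finset.sum_sub_distrib, Finset.sum_const, Int.card_Icc]
    simp
    ring
  rw [h3]
  push_cast at h1 ⊢
  refine (abs_sub _ _).trans ?_
  nlinarith

lemma WeightBounds.sum_Icc_zero_le (h : WeightBounds γ γbar c p) (hc : 0 < c) (hp : 0 < p) (m : ℕ) :
    |∑ k ∈ Finset.Icc (1 - m : ℤ) 0, (γ k - γbar)| ≤ 2 * c * ((m : ℝ) + 1) ^ p := by
  have h2 : (1 : ℝ) ≤ ((m : ℝ) + 1) ^ p := Real.one_le_rpow (by simp) hp.le
  have h0 := h.abs_zero_sub_le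
  -- Labels `1 - m, …, 0` are label `0` together with `m - 1` negative ones. The hypothesis needs at
  -- least one negative label, so `m = 0` and `m = 1` are separate.
  match m with
  | 0 => simp; positivity
  | 1 => simp at h2 ⊢; nlinarith
  | m + 2 =>
    have h1 := h.left (m + 1) (by omega)
    have e : Finset.Icc (1 - (m + 2 : ℕ) : ℤ) 0 = insert 0 (Finset.Ico (-((m + 1 : ℕ) : ℤ)) 0) := by
      ext k; simp only [Finset.mem_Ico, Finset.mem_insert, Finset.mem_Icc]; omega
    have h3 : ∑ k ∈ Finset.Icc (1 - (m + 2 : ℕ) : ℤ) 0, (γ k - γbar) =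
        (γ 0 - γbar) + (∑ k ∈ Finset.Ico (-((m + 1 : ℕ) : ℤ)) 0, γ k - γbar * ((m + 1 : ℕ) : ℝ)) := by
      rw [e, Finset.sum_insert (by simp), Finset.sum_sub_distrib, Finset.sum_const, Int.card_Ico]
      simp
      ring
    rw [h3]
    have h4 : (((m + 1 : ℕ) : ℝ)) ^ p ≤ (((m + 2 : ℕ) : ℝ) + 1) ^ p := by
      refine Real.rpow_le_rpow (by positivity) ?_ hp.le
      push_cast; linarith
    refine (abs_add_le _ _).trans ?_
    nlinarith

end Discrepancy

/-! ### Density at infinity and tails of the weighted sums. -/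

/-- A locally finite set with quantitative control of its density at infinity. -/
structure TailBounds (L : Set ℝ) (α B : ℝ) (τ : ℝ → ℝ) : Prop where
  locallyFinite : LocallyFiniteSet L
  tail : ∀ r : ℝ, 1 ≤ r → ∀ F : Finset ℝ, (∀ x ∈ F, x ∈ L ∧ r < |x|) →
    ∑ x ∈ F, 1 / |x| ^ (1 + α) ≤ τ r
  card_le : ((window L (Icc (-1) 1)).card : ℝ) ≤ B

namespace TailBounds

variable {L : Set ℝ} {α B : ℝ} {τ : ℝ → ℝ}

lemma tail_nonneg (h : TailBounds L α B τ) {r : ℝ} (hr : 1 ≤ r) : 0 ≤ τ r := by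
  simpa using h.tail r hr ∅ (by simp)

/-- Each point with `1 < |x| ≤ r` contributes at least `r ^ (-(1 + α))` to the tail sum beyond `1`.
-/
lemma card_le_rpow (h : TailBounds L α B τ) (hα : 0 < α) {r : ℝ} (hr : 1 ≤ r) {F : Finset ℝ}
    (hF : ∀ x ∈ F, x ∈ L ∧ |x| ≤ r) : (F.card : ℝ) ≤ (B + τ 1) * r ^ (1 + α) := by
  classical
  have hr1 : (1 : ℝ) ≤ r ^ (1 + α) := Real.one_le_rpow hr (by linarith)
  have hB : 0 ≤ B := le_trans (Nat.cast_nonneg _) h.card_le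
  have h1 : ((F.filter (|·| ≤ 1)).card : ℝ) ≤ B := by
    refine le_trans (Nat.cast_le.2 (Finset.card_le_card fun x hx => ?_)) h.card_le
    rw [Finset.mem_filter] at hx
    exact h.locallyFinite.mem_Icc.2 ⟨(hF x hx.1).1, abs_le.1 hx.2⟩
  have h2 : ((F.filter (¬ |·| ≤ 1)).card : ℝ) ≤ τ 1 * r ^ (1 + α) := by
    have := h.tail 1 le_rfl (F.filter (¬ |·| ≤ 1)) fun x hx => by
      rw [Finset.mem_filter] at hx
      exact ⟨(hF x hx.1).1, not_le.1 hx.2⟩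
    have hle : ((F.filter (¬ |·| ≤ 1)).card : ℝ) * (1 / r ^ (1 + α)) ≤
        ∑ x ∈ F.filter (¬ |·| ≤ 1), 1 / |x| ^ (1 + α) := by
      rw [← nsmul_eq_mul]
      refine Finset.card_nsmul_le_sum _ _ _ fun x hx => ?_
      rw [Finset.mem_filter] at hx
      have hx1 : 0 < |x| := by linarith [not_le.1 hx.2]
      exact one_div_le_one_div_of_le (by positivity)
        (Real.rpow_le_rpow hx1.le (hF x hx.1).2 (by linarith))
    have h3 := hle.trans this
    rwa [mul_one_div, div_le_iff₀ (by positivity)] at h3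
  have h3 : (F.card : ℝ) = (F.filter (|·| ≤ 1)).card + (F.filter (¬ |·| ≤ 1)).card := by
    norm_cast
    exact (Finset.card_filter_add_card_filter_not _).symm
  rw [h3]
  nlinarith

end TailBounds

section WeightedTails

variable {L : Set ℝ} {α B : ℝ} {τ : ℝ → ℝ} {γ : ℤ → ℝ} {γbar c p a : ℝ}

lemma card_add_one_rpow_le (h : TailBounds L α B τ) (hα : 0 < α) (hp : 0 < p) {x : ℝ} (hx : 1 ≤ x)
    {F : Finset ℝ} (hF : ∀ y ∈ F, y ∈ L ∧ |y| ≤ x) :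
    ((F.card : ℝ) + 1) ^ p ≤ (B + τ 1 + 1) ^ p * x ^ ((1 + α) * p) := by
  have hx1 : (1 : ℝ) ≤ x ^ (1 + α) := Real.one_le_rpow hx (by linarith)
  have hB : 0 ≤ B := le_trans (Nat.cast_nonneg _) h.card_le
  have hτ := h.tail_nonneg le_rfl
  rw [Real.rpow_mul (by linarith), ← Real.mul_rpow (by positivity) (by positivity)]
  refine Real.rpow_le_rpow (by positivity) ?_ hp.le
  have := h.card_le_rpow hα hx hF
  nlinarith

/-- The count of points converts a discrepancy in the label into one in the position, with exponent
`(1 + α) * p`. Labels start at `a`, so `(r, x]` is the difference of two windows starting at `a`;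
this doubles the constant. -/
lemma abs_sum_pointWeight_Ioc_le (h : TailBounds L α B τ) (hα : 0 < α) (hp : 0 < p)
    (hγ : WeightBounds γ γbar c p) (hc : 0 < c) {r x : ℝ} (hr : 1 ≤ r)
    (har : |a| ≤ r) (hrx : r < x) :
    |∑ y ∈ window L (Ioc r x), (pointWeight L γ a y - γbar)| ≤
      4 * c * (B + τ 1 + 1) ^ p * x ^ ((1 + α) * p) := by
  classical
  have hL := h.locallyFinite
  obtain ⟨har1, har2⟩ := abs_le.1 har
  have key : ∀ t, r ≤ t → t ≤ x → |∑ y ∈ window L (Ioc a t), (pointWeight L γ a y - γbar)| ≤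
      2 * c * (B + τ 1 + 1) ^ p * x ^ ((1 + α) * p) := by
    intro t hrt htx
    have h1 := hγ.sum_Icc_one_le hc hp (window L (Ioc a t)).card
    rw [← hL.sum_pointIndex_Ioc (a := a) t fun k => γ k - γbar] at h1
    have h2 := card_add_one_rpow_le h hα hp (hr.trans hrx.le) (F := window L (Ioc a t))
      fun y hy => by
        have := (hL.mem_window (Metric.isBounded_Ioc a t)).1 hy
        exact ⟨this.1, abs_le.2 ⟨by linarith [this.2.1], this.2.2.trans htx⟩⟩
    have h3 : ∑ y ∈ window L (Ioc a t), (pointWeight L γ a y - γbar) =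
        ∑ y ∈ window L (Ioc a t), (γ (pointIndex L a y) - γbar) :=
      Finset.sum_congr rfl fun y hy => by
        rw [pointWeight_of_mem ((hL.mem_window (Metric.isBounded_Ioc a t)).1 hy).1]
    rw [h3]
    nlinarith
  have hsplit : ∑ y ∈ window L (Ioc a x), (pointWeight L γ a y - γbar) =
      ∑ y ∈ window L (Ioc a r), (pointWeight L γ a y - γbar) +
        ∑ y ∈ window L (Ioc r x), (pointWeight L γ a y - γbar) := by
    rw [← Finset.sum_union]
    · refine Finset.sum_congr ?_ fun _ _ => rfl
      ext y
      simp only [Finset.mem_union, hL.mem_window (Metric.isBounded_Ioc _ _), Set.mem_Ioc]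
      grind
    · rw [Finset.disjoint_left]
      intro y
      simp only [hL.mem_window (Metric.isBounded_Ioc _ _), Set.mem_Ioc]
      grind
  have k1 := key x hrx.le le_rfl
  have k2 := key r le_rfl hrx.le
  rw [hsplit] at k1
  have := abs_sub (∑ y ∈ window L (Ioc a r), (pointWeight L γ a y - γbar) +
        ∑ y ∈ window L (Ioc r x), (pointWeight L γ a y - γbar))
        (∑ y ∈ window L (Ioc a r), (pointWeight L γ a y - γbar))
  rw [add_sub_cancel_left] at this
  linarith

lemma abs_sum_pointWeight_Ico_le (h : TailBounds L α B τ) (hα : 0 < α) (hp : 0 < p)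
    (hγ : WeightBounds γ γbar c p) (hc : 0 < c) {r x : ℝ} (hr : 1 ≤ r)
    (har : |a| ≤ r) (hrx : r < x) :
    |∑ y ∈ window L (Ico (-x) (-r)), (pointWeight L γ a y - γbar)| ≤
      4 * c * (B + τ 1 + 1) ^ p * x ^ ((1 + α) * p) := by
  classical
  have hL := h.locallyFinite
  obtain ⟨har1, har2⟩ := abs_le.1 har
  have key : ∀ t, r ≤ t → t ≤ x → |∑ y ∈ window L (Ico (-t) a), (pointWeight L γ a y - γbar)| ≤
      2 * c * (B + τ 1 + 1) ^ p * x ^ ((1 + α) * p) := by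
    intro t hrt htx
    have h1 := hγ.sum_Icc_zero_le hc hp (window L (Ico (-t) a)).card
    rw [← hL.sum_pointIndex_Ico (a := a) (-t) fun k => γ k - γbar] at h1
    have h2 := card_add_one_rpow_le h hα hp (hr.trans hrx.le) (F := window L (Ico (-t) a))
      fun y hy => by
        have := (hL.mem_window (Metric.isBounded_Ico (-t) a)).1 hy
        exact ⟨this.1, abs_le.2 ⟨by linarith [this.2.1], by linarith [this.2.2]⟩⟩
    have h3 : ∑ y ∈ window L (Ico (-t) a), (pointWeight L γ a y - γbar) =
        ∑ y ∈ window L (Ico (-t) a), (γ (pointIndex L a y) - γbar) :=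
      Finset.sum_congr rfl fun y hy => by
        rw [pointWeight_of_mem ((hL.mem_window (Metric.isBounded_Ico (-t) a)).1 hy).1]
    rw [h3]
    nlinarith
  have hsplit : ∑ y ∈ window L (Ico (-x) a), (pointWeight L γ a y - γbar) =
      ∑ y ∈ window L (Ico (-r) a), (pointWeight L γ a y - γbar) +
        ∑ y ∈ window L (Ico (-x) (-r)), (pointWeight L γ a y - γbar) := by
    rw [← Finset.sum_union]
    · refine Finset.sum_congr ?_ fun _ _ => rfl
      ext y
      simp only [Finset.mem_union, hL.mem_window (Metric.isBounded_Ico _ _), Set.mem_Ico]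
      grind
    · rw [Finset.disjoint_left]
      intro y
      simp only [hL.mem_window (Metric.isBounded_Ico _ _), Set.mem_Ico]
      grind
  have k1 := key x hrx.le le_rfl
  have k2 := key r le_rfl hrx.le
  rw [hsplit] at k1
  have := abs_sub (∑ y ∈ window L (Ico (-r) a), (pointWeight L γ a y - γbar) +
        ∑ y ∈ window L (Ico (-x) (-r)), (pointWeight L γ a y - γbar))
        (∑ y ∈ window L (Ico (-r) a), (pointWeight L γ a y - γbar))
  rw [add_sub_cancel_left] at this
  linarith

/-- Bound for the tails beyond `r` of the weighted configurations. -/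
def tailError (α B γbar c p a : ℝ) (τ : ℝ → ℝ) (r : ℝ) : ℝ :=
  γbar * (1 + 2 * |a|) * τ r +
    2 * ((4 * c * (B + τ 1 + 1) ^ p) * 4 * (1 + 1 / (1 - (1 + α) * p))) * r ^ ((1 + α) * p - 1)

lemma tendsto_tailError (hp1 : (1 + α) * p < 1) (hτ : Tendsto τ atTop (𝓝 0)) :
    Tendsto (tailError α B γbar c p a τ) atTop (𝓝 0) := by
  have h1 : Tendsto (fun r : ℝ => r ^ ((1 + α) * p - 1)) atTop (𝓝 0) := by
    have := tendsto_rpow_neg_atTop (y := 1 - (1 + α) * p) (by linarith)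
    simpa using this
  have := (hτ.const_mul (γbar * (1 + 2 * |a|))).add (h1.const_mul
    (2 * ((4 * c * (B + τ 1 + 1) ^ p) * 4 * (1 + 1 / (1 - (1 + α) * p)))))
  rw [mul_zero, mul_zero, add_zero] at this
  exact this

lemma inv_sq_le_one_div_rpow (hα1 : α < 1) {x : ℝ} (hx : 1 ≤ |x|) :
    (x ^ 2)⁻¹ ≤ 1 / |x| ^ (1 + α) := by
  rw [← one_div, ← sq_abs, ← Real.rpow_natCast]
  exact one_div_le_one_div_of_le (by positivity)
    (Real.rpow_le_rpow_of_exponent_le hx (by push_cast; linarith))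

lemma abs_sum_pointWeight_sub_le (h : TailBounds L α B τ) (hα : 0 < α) (hp : 0 < p)
    (hp1 : (1 + α) * p < 1) (hγ : WeightBounds γ γbar c p) (hc : 0 < c) {f : ℝ → ℝ} {r : ℝ} (t : ℝ)
    (hr : 1 ≤ r) (har : |a| ≤ r) (hf : DecaysLikeInv f r 4) :
    |∑ y ∈ window L (annulus r t), (pointWeight L γ a y - γbar) * f y| ≤
      2 * ((4 * c * (B + τ 1 + 1) ^ p) * 4 * (1 + 1 / (1 - (1 + α) * p))) *
        r ^ ((1 + α) * p - 1) := by
  have hB : 0 ≤ B := le_trans (Nat.cast_nonneg _) h.card_le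
  have hτ := h.tail_nonneg le_rfl
  exact abs_sum_window_annulus_le h.locallyFinite (by linarith) (by positivity) hp1 (by norm_num)
    (by positivity) hf (fun x hx => abs_sum_pointWeight_Ioc_le h hα hp hγ hc hr har hx)
    (fun x hx => abs_sum_pointWeight_Ico_le h hα hp hγ hc hr har hx)

lemma sum_annulus_inv_sq_le (h : TailBounds L α B τ) (hα1 : α < 1) {r : ℝ} (t : ℝ) (hr : 1 ≤ r) :
    ∑ y ∈ window L (annulus r t), (y ^ 2)⁻¹ ≤ τ r := by
  have hL := h.locallyFinite
  refine (Finset.sum_le_sum fun y hy => ?_).trans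
    (h.tail r hr (window L (annulus r t)) fun y hy => ?_)
  · exact inv_sq_le_one_div_rpow hα1 (hr.trans (hL.mem_annulus.1 hy).2.1.le)
  · exact ⟨(hL.mem_annulus.1 hy).1, (hL.mem_annulus.1 hy).2.1⟩

lemma decaysLikeInv_inv_sq {r : ℝ} (hr : 1 ≤ r) : DecaysLikeInv (fun x => (x ^ 2)⁻¹) r 4 := by
  intro x y h1 h2 h3
  have := decaysLikeInv_rpow hr (p := 2) (by norm_num) le_rfl x y h1 h2 h3
  have e : ∀ z : ℝ, 1 / |z| ^ (2 : ℝ) = (z ^ 2)⁻¹ := fun z => by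
    rw [one_div, Real.rpow_two, sq_abs]
  simp only [e] at this
  have hx : 0 < |x| := by linarith
  refine ⟨this.1.trans (by gcongr; norm_num), this.2.trans ?_⟩
  gcongr
  · rw [sub_nonneg]; exact one_div_le_one_div_of_le hx h2
  · norm_num

/-- The weights need not be uniformly bounded, so `γbar` is split off: the difference is handled by
Abel summation, and the constant part by the tail condition, as `1 + α < 2`. -/
lemma sum_annulus_pointWeight_inv_sq_le (h : TailBounds L α B τ) (hα : 0 < α) (hα1 : α < 1)
    (hp : 0 < p) (hp1 : (1 + α) * p < 1) (hγ : WeightBounds γ γbar c p) (hγbar : 0 < γbar)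
    (hc : 0 < c) {r : ℝ} (t : ℝ) (hr : 1 ≤ r) (har : |a| ≤ r) :
    ∑ y ∈ window L (annulus r t), pointWeight L γ a y / y ^ 2 ≤ tailError α B γbar c p a τ r := by
  have h1 := abs_sum_pointWeight_sub_le (a := a) h hα hp hp1 hγ hc t hr har (decaysLikeInv_inv_sq hr)
  have h2 := sum_annulus_inv_sq_le h hα1 t hr
  have h3 : ∑ y ∈ window L (annulus r t), pointWeight L γ a y / y ^ 2 =
      ∑ y ∈ window L (annulus r t), (pointWeight L γ a y - γbar) * (y ^ 2)⁻¹ +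
        γbar * ∑ y ∈ window L (annulus r t), (y ^ 2)⁻¹ := by
    rw [Finset.mul_sum, ← Finset.sum_add_distrib]
    exact Finset.sum_congr rfl fun y _ => by ring
  have h4 := (abs_le.1 h1).2
  have h5 := mul_le_mul_of_nonneg_left h2 hγbar.le
  have h6 := mul_nonneg (mul_nonneg hγbar.le (abs_nonneg a)) (h.tail_nonneg hr)
  rw [h3, tailError]
  nlinarith

/-- Replacing the weights by `γbar` costs the Abel error, and replacing `1 / (y - a)` by `1 / y`
costs at most `2 * |a| / y ^ 2` per point. These are the second term and the `2 * |a|` part of the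
first term of `tailError`. -/
lemma abs_sum_annulus_pointWeight_sub_le (h : TailBounds L α B τ) (hα : 0 < α) (hα1 : α < 1)
    (hp : 0 < p) (hp1 : (1 + α) * p < 1) (hγ : WeightBounds γ γbar c p) (hγbar : 0 < γbar)
    (hc : 0 < c) {r : ℝ} (t : ℝ) (hr : 1 ≤ r) (har : 2 * |a| ≤ r) :
    |∑ y ∈ window L (annulus r t), pointWeight L γ a y / (y - a) -
      γbar * ∑ y ∈ window L (annulus r t), y⁻¹| ≤ tailError α B γbar c p a τ r := by
  have hL := h.locallyFinite
  have ha0 := abs_nonneg a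
  have h1 := abs_sum_pointWeight_sub_le (a := a) h hα hp hp1 hγ hc t hr (by linarith)
    (decaysLikeInv_inv_sub (by linarith) har)
  have h2 := sum_annulus_inv_sq_le h hα1 t hr
  have h3 : ∑ y ∈ window L (annulus r t), pointWeight L γ a y / (y - a) -
      γbar * ∑ y ∈ window L (annulus r t), y⁻¹ =
      ∑ y ∈ window L (annulus r t), (pointWeight L γ a y - γbar) * (y - a)⁻¹ +
        γbar * ∑ y ∈ window L (annulus r t), ((y - a)⁻¹ - y⁻¹) := by
    rw [Finset.mul_sum, Finset.mul_sum, ← Finset.sum_add_distrib, ← Finset.sum_sub_distrib]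
    exact Finset.sum_congr rfl fun y _ => by ring
  have h4 : |∑ y ∈ window L (annulus r t), ((y - a)⁻¹ - y⁻¹)| ≤ 2 * |a| * τ r := by
    refine (Finset.abs_sum_le_sum_abs _ _).trans ?_
    refine le_trans ?_ (mul_le_mul_of_nonneg_left h2 (by positivity))
    rw [Finset.mul_sum]
    refine Finset.sum_le_sum fun y hy => ?_
    have hy' := (hL.mem_annulus.1 hy).2.1
    have hy0 : 0 < |y| := by linarith
    have hya : |y| / 2 ≤ |y - a| := by
      have := abs_sub_abs_le_abs_sub y a
      linarith
    have hya0 : 0 < |y - a| := by linarith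
    rw [inv_sub_inv (abs_pos.1 hya0) (abs_pos.1 hy0), abs_div, abs_mul, sub_sub_cancel, ← sq_abs y,
      ← div_eq_mul_inv, div_le_div_iff₀ (by positivity) (by positivity)]
    nlinarith [mul_le_mul_of_nonneg_left hya (mul_nonneg ha0 hy0.le)]
  rw [h3, tailError]
  refine (abs_add_le _ _).trans ?_
  rw [abs_mul γbar, abs_of_pos hγbar]
  have h5 := mul_le_mul_of_nonneg_left h4 hγbar.le
  have h6 := mul_nonneg hγbar.le (h.tail_nonneg hr)
  nlinarith

end WeightedTails

/-! ### Principal values at the base point. -/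

lemma exists_tendsto_of_abs_sub_le {g E : ℝ → ℝ} {r₀ : ℝ} (hE : Tendsto E atTop (𝓝 0))
    (h : ∀ r t, r₀ ≤ r → r ≤ t → |g t - g r| ≤ E r) :
    ∃ v, Tendsto g atTop (𝓝 v) ∧ ∀ r, r₀ ≤ r → |v - g r| ≤ E r := by
  have hc : Cauchy (map g atTop) := by
    rw [Metric.cauchy_iff]
    refine ⟨inferInstance, fun ε hε => ?_⟩
    obtain ⟨r, hr, hr0⟩ := ((hE.eventually (gt_mem_nhds (half_pos hε))).and
      (eventually_ge_atTop r₀)).exists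
    refine ⟨g '' Ici r, image_mem_map (Ici_mem_atTop r), ?_⟩
    rintro _ ⟨x, hx, rfl⟩ _ ⟨y, hy, rfl⟩
    have h1 := h r x hr0 hx
    have h2 := h r y hr0 hy
    rw [abs_le] at h1 h2
    rw [Real.dist_eq, abs_lt]
    constructor <;> linarith
  obtain ⟨v, hv⟩ := CompleteSpace.complete hc
  refine ⟨v, hv, fun r hr => ?_⟩
  have : Tendsto (fun t => |g t - g r|) atTop (𝓝 |v - g r|) :=
    (Tendsto.sub_const hv _).abs
  exact le_of_tendsto this ((eventually_ge_atTop r).mono fun t ht => h r t hr ht)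

/-- The sums over `r < |x| < t` and over `r < |x| ≤ t` have the same limit. -/
lemma isTailPrincipalValue_iff {L : Set ℝ} (hL : LocallyFiniteSet L) {r v : ℝ} :
    IsTailPrincipalValue L r v ↔
      Tendsto (fun t => ∑ x ∈ window L (annulus r t), x⁻¹) atTop (𝓝 v) := by
  classical
  have hmeas : ∀ t : ℝ, MeasurableSet {x : ℝ | r < |x| ∧ |x| < t} := fun t =>
    ((isOpen_lt continuous_const continuous_abs).inter
      (isOpen_lt continuous_abs continuous_const)).measurableSet
  have h1 : ∀ t : ℝ, ∫ x in {x : ℝ | r < |x| ∧ |x| < t}, x⁻¹ ∂(pointMeasure L) =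
      ∑ x ∈ window L {x : ℝ | r < |x| ∧ |x| < t}, x⁻¹ := fun t =>
    setIntegral_pointMeasure (hL.finite_inter (isBounded_open_annulus r t)) (hmeas t) _
  have h2 : Tendsto (fun t : ℝ => ∑ x ∈ window L (annulus r t), x⁻¹ -
      ∑ x ∈ window L {x : ℝ | r < |x| ∧ |x| < t}, x⁻¹) atTop (𝓝 0) := by
    have hb : Tendsto (fun t : ℝ => 2 * t⁻¹) atTop (𝓝 0) := by
      simpa using tendsto_inv_atTop_zero.const_mul (2 : ℝ)
    refine squeeze_zero_norm' ?_ hb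
    filter_upwards [eventually_gt_atTop 0] with t ht
    have hsub : window L {x : ℝ | r < |x| ∧ |x| < t} ⊆ window L (annulus r t) := by
      intro x hx
      rw [hL.mem_window (isBounded_open_annulus r t)] at hx
      exact hL.mem_annulus.2 ⟨hx.1, hx.2.1, hx.2.2.le⟩
    rw [← Finset.sum_sdiff hsub, add_sub_cancel_right]
    have hsub2 : window L (annulus r t) \ window L {x : ℝ | r < |x| ∧ |x| < t} ⊆ {t, -t} := by
      intro x hx
      rw [Finset.mem_sdiff, hL.mem_annulus, hL.mem_window (isBounded_open_annulus r t)] at hx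
      have : |x| = t := by
        by_contra hne
        exact hx.2 ⟨hx.1.1, hx.1.2.1, lt_of_le_of_ne hx.1.2.2 hne⟩
      rw [Finset.mem_insert, Finset.mem_singleton]
      exact eq_or_eq_neg_of_abs_eq this
    refine (norm_sum_le _ _).trans ?_
    calc _ ≤ ∑ x ∈ ({t, -t} : Finset ℝ), ‖x⁻¹‖ :=
          Finset.sum_le_sum_of_subset_of_nonneg hsub2 fun _ _ _ => norm_nonneg _
      _ = 2 * t⁻¹ := by
        rw [Finset.sum_pair (by linarith), norm_inv, norm_inv, norm_neg, Real.norm_eq_abs,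
          abs_of_pos ht]
        ring
  unfold IsTailPrincipalValue
  simp_rw [h1]
  constructor
  · intro h
    simpa using h.add h2
  · intro h
    simpa using h.sub h2

lemma IsTailPrincipalValue.eq_add {L : Set ℝ} (hL : LocallyFiniteSet L) {r t v w : ℝ}
    (hrt : r ≤ t) (hv : IsTailPrincipalValue L r v) (hw : IsTailPrincipalValue L t w) :
    v = ∑ x ∈ window L (annulus r t), x⁻¹ + w := by
  rw [isTailPrincipalValue_iff hL] at hv hw
  refine tendsto_nhds_unique hv ((hw.const_add _).congr' ?_)
  filter_upwards [eventually_ge_atTop t] with q hq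
  exact (hL.sum_window_annulus_add _ hrt hq).symm

/-- The principal value of `∑ w / (x - a)` and its approximation by truncated sums. -/
lemma exists_principalValue {L : Set ℝ} {α B γbar c p a : ℝ} {τ : ℝ → ℝ} {γ : ℤ → ℝ}
    (h : TailBounds L α B τ) (hτ : Tendsto τ atTop (𝓝 0)) (hα : 0 < α) (hα1 : α < 1) (hp : 0 < p)
    (hp1 : (1 + α) * p < 1) (hγ : WeightBounds γ γbar c p) (hγbar : 0 < γbar) (hc : 0 < c)
    {H : ℝ → ℝ} (hH : ∀ r, 0 < r → IsTailPrincipalValue L r (H r)) :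
    ∃ s, Tendsto (fun t => ∑ x ∈ window L (Icc (-t) t), pointWeight L γ a x / (x - a)) atTop (𝓝 s) ∧
      ∀ r, 1 ≤ r → 2 * |a| ≤ r →
        |s - ∑ x ∈ window L (Icc (-r) r), pointWeight L γ a x / (x - a) - γbar * H r| ≤
          tailError α B γbar c p a τ r := by
  have hL := h.locallyFinite
  have hH' : ∀ r, 0 < r → Tendsto (fun t => ∑ x ∈ window L (annulus r t), x⁻¹) atTop (𝓝 (H r)) :=
    fun r hr => (isTailPrincipalValue_iff hL).1 (hH r hr)
  set r₀ := max 1 (2 * |a|) with hr₀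
  have hr₀1 : 1 ≤ r₀ := le_max_left _ _
  have hr₀a : 2 * |a| ≤ r₀ := le_max_right _ _
  -- Neither sum need converge absolutely, but their difference is Cauchy with rate `tailError`; the
  -- assumed principal value then restores the subtracted sum.
  set g : ℝ → ℝ := fun t => ∑ x ∈ window L (Icc (-t) t), pointWeight L γ a x / (x - a) -
    γbar * ∑ x ∈ window L (annulus r₀ t), x⁻¹ with hg
  obtain ⟨v, hv, hvr⟩ := exists_tendsto_of_abs_sub_le (g := g) (r₀ := r₀)
    (tendsto_tailError (B := B) (γbar := γbar) (c := c) (a := a) hp1 hτ) (by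
    intro r t hr hrt
    have e : g t - g r = ∑ y ∈ window L (annulus r t), pointWeight L γ a y / (y - a) -
        γbar * ∑ y ∈ window L (annulus r t), y⁻¹ := by
      simp only [hg]
      rw [hL.sum_window_Icc_add _ hrt, hL.sum_window_annulus_add _ hr hrt]
      ring
    rw [e]
    exact abs_sum_annulus_pointWeight_sub_le h hα hα1 hp hp1 hγ hγbar hc t (hr₀1.trans hr)
      (hr₀a.trans hr))
  refine ⟨v + γbar * H r₀, ?_, fun r hr har => ?_⟩
  · have := hv.add ((hH' r₀ (by linarith)).const_mul γbar)
    refine this.congr fun t => ?_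
    simp only [hg]; ring
  · have hr' : r₀ ≤ r := max_le hr har
    have hHr := (hH r₀ (by linarith)).eq_add hL hr' (hH r (by linarith))
    have := hvr r hr'
    simp only [hg] at this
    rw [hHr]
    convert this using 2
    ring

/-! ### Passage to the limit of labels, weights, tails and principal values. -/

lemma LocConv.eventually_notMem {Ls : ℕ → Set ℝ} {L : Set ℝ} (h : LocConv Ls L) {a : ℝ}
    (ha : a ∉ L) : ∀ᶠ n in atTop, a ∉ Ls n := by
  obtain ⟨ε, hε, hn⟩ := h.avoid a ha
  filter_upwards [hn] with n hn hmem
  have := hn a hmem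
  rw [sub_self, abs_zero] at this
  exact absurd hε (not_lt.2 this)

lemma tendsto_eventually_le_of_le {φ : ℕ → ℝ → ℝ} {x y : ℝ}
    (hx : Tendsto (fun n => φ n x) atTop (𝓝 x)) (hy : Tendsto (fun n => φ n y) atTop (𝓝 y))
    (hxy : x ≤ y) : ∀ᶠ n in atTop, φ n x ≤ φ n y := by
  rcases hxy.eq_or_lt with rfl | h
  · exact Eventually.of_forall fun _ => le_rfl
  · exact (hx.eventually_lt hy h).mono fun _ h => h.le

/-- A label counts the points between `a` and `x`. The matching is eventually a bijection on an
interval from `a` to slightly beyond `x`, and keeps all matched points on the correct side of `φ n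
x`. The margin `r / 2` puts the endpoint off `L`. -/
lemma eventually_pointIndex_eq {Ls : ℕ → Set ℝ} {L : Set ℝ} (hL : LocallyFiniteSet L)
    (h : LocConv Ls L) {a : ℝ} (ha : a ∉ L) {φ : ℕ → ℝ → ℝ}
    (hφ : ∀ x ∈ L, Tendsto (fun n => φ n x) atTop (𝓝 x))
    (hbij : ∀ u v, u ∉ L → v ∉ L →
      ∀ᶠ n in atTop, BijOn (φ n) (L ∩ Icc u v) (Ls n ∩ Icc u v)) {x : ℝ} (hx : x ∈ L) :
    ∀ᶠ n in atTop, pointIndex (Ls n) a (φ n x) = pointIndex L a x := by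
  obtain ⟨r, hr, hxr⟩ := hL.exists_ball x
  rcases lt_or_gt_of_ne (fun h => ha (h ▸ hx) : a ≠ x) with hax | hax
  · have hv : x + r / 2 ∉ L := fun hmem => by
      have := hxr _ hmem (by rw [add_sub_cancel_left, abs_of_pos (by linarith)]; linarith)
      linarith
    have hset : L ∩ Icc a (x + r / 2) = L ∩ Ioc a x := by
      ext y
      simp only [mem_inter_iff, mem_Icc, mem_Ioc, and_congr_right_iff]
      intro hy
      constructor
      · rintro ⟨h1, h2⟩
        refine ⟨lt_of_le_of_ne h1 fun h => ha (h ▸ hy), ?_⟩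
        by_contra! hlt
        have := hxr y hy (by rw [abs_of_pos (by linarith)]; linarith)
        linarith
      · rintro ⟨h1, h2⟩
        exact ⟨h1.le, by linarith⟩
    have hfin : (L ∩ Icc a (x + r / 2)).Finite := hL.finite_inter (Metric.isBounded_Icc _ _)
    have hle : ∀ᶠ n in atTop, ∀ y ∈ L ∩ Icc a (x + r / 2), φ n y ≤ φ n x := by
      rw [eventually_all_finite hfin]
      intro y hy
      rw [hset] at hy
      exact tendsto_eventually_le_of_le (hφ y hy.1) (hφ x hx) hy.2.2
    filter_upwards [hbij _ _ ha hv, hle, h.eventually_notMem ha, (hφ x hx).eventually (lt_mem_nhds hax)]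
      with n h1 h2 h3 h4
    rw [pointIndex, pointIndex, if_pos h4, if_pos hax, ← hset, ← h1.injOn.ncard_image, h1.image_eq]
    congr 2
    have hxmem : φ n x ∈ Ls n ∩ Icc a (x + r / 2) := h1.mapsTo ⟨hx, hax.le, by linarith⟩
    ext y
    simp only [mem_inter_iff, Set.mem_Icc, Set.mem_Ioc, and_congr_right_iff]
    intro hy
    constructor
    · rintro ⟨b1, b2⟩
      exact ⟨b1.le, b2.trans hxmem.2.2⟩
    · rintro ⟨b1, b2⟩
      obtain ⟨z, hz, rfl⟩ := h1.surjOn ⟨hy, b1, b2⟩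
      exact ⟨lt_of_le_of_ne b1 fun h => h3 (h ▸ hy), h2 z hz⟩
  · have hv : x - r / 2 ∉ L := fun hmem => by
      have := hxr _ hmem (by rw [sub_sub_cancel_left, abs_neg, abs_of_pos (by linarith)]; linarith)
      linarith
    have hset : L ∩ Icc (x - r / 2) a = L ∩ Ico x a := by
      ext y
      simp only [mem_inter_iff, mem_Icc, mem_Ico, and_congr_right_iff]
      intro hy
      constructor
      · rintro ⟨h1, h2⟩
        refine ⟨?_, lt_of_le_of_ne h2 fun h => ha (h ▸ hy)⟩
        by_contra! hlt
        have := hxr y hy (by rw [abs_of_neg (by linarith)]; linarith)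
        linarith
      · rintro ⟨h1, h2⟩
        exact ⟨by linarith, h2.le⟩
    have hfin : (L ∩ Icc (x - r / 2) a).Finite := hL.finite_inter (Metric.isBounded_Icc _ _)
    have hle : ∀ᶠ n in atTop, ∀ y ∈ L ∩ Icc (x - r / 2) a, φ n x ≤ φ n y := by
      rw [eventually_all_finite hfin]
      intro y hy
      rw [hset] at hy
      exact tendsto_eventually_le_of_le (hφ x hx) (hφ y hy.1) hy.2.1
    filter_upwards [hbij _ _ hv ha, hle, h.eventually_notMem ha, (hφ x hx).eventually (gt_mem_nhds hax)]
      with n h1 h2 h3 h4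
    rw [pointIndex, pointIndex, if_neg (not_lt.2 h4.le), if_neg (not_lt.2 hax.le), ← hset,
      ← h1.injOn.ncard_image, h1.image_eq]
    congr 3
    have hxmem : φ n x ∈ Ls n ∩ Icc (x - r / 2) a := h1.mapsTo ⟨hx, by linarith, hax.le⟩
    ext y
    simp only [mem_inter_iff, Set.mem_Icc, Set.mem_Ico, and_congr_right_iff]
    intro hy
    constructor
    · rintro ⟨b1, b2⟩
      exact ⟨hxmem.2.1.trans b1, b2.le⟩
    · rintro ⟨b1, b2⟩
      obtain ⟨z, hz, rfl⟩ := h1.surjOn ⟨hy, b1, b2⟩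
      exact ⟨h2 z hz, lt_of_le_of_ne b2 fun h => h3 (h ▸ hy)⟩

/-- Convergence of weighted point configurations: `φ n x` is the point of the `n`-th configuration
close to the point `x` of the limit. -/
structure WeightedConv (Ls : ℕ → Set ℝ) (L : Set ℝ) (Ws : ℕ → ℝ → ℝ) (W : ℝ → ℝ)
    (φ : ℕ → ℝ → ℝ) : Prop where
  tendsto : ∀ x ∈ L, Tendsto (fun n => φ n x) atTop (𝓝 x)
  bijOn : ∀ u v, u ∉ L → v ∉ L →
    ∀ᶠ n in atTop, BijOn (φ n) (L ∩ Icc u v) (Ls n ∩ Icc u v)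
  tendsto_weight : ∀ x ∈ L, Tendsto (fun n => Ws n (φ n x)) atTop (𝓝 (W x))

lemma WeightedConv.eventually_mem {Ls : ℕ → Set ℝ} {L : Set ℝ} {Ws : ℕ → ℝ → ℝ} {W : ℝ → ℝ}
    {φ : ℕ → ℝ → ℝ} (h : WeightedConv Ls L Ws W φ) (hL : LocallyFiniteSet L) {x : ℝ} (hx : x ∈ L) :
    ∀ᶠ n in atTop, φ n x ∈ Ls n := by
  obtain ⟨v, hv, hv1, hv2⟩ := hL.exists_mem_Ioo (lt_add_one |x|)
  filter_upwards [h.bijOn _ _ hv2 hv1] with n hn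
  exact (hn.mapsTo ⟨hx, abs_le.1 hv.1.le⟩).1

lemma LocConv.exists_weightedConv {Ls : ℕ → Set ℝ} {L : Set ℝ} (hL : LocallyFiniteSet L)
    (h : LocConv Ls L) {a : ℝ} (ha : a ∉ L) {γs : ℕ → ℤ → ℝ} {γ : ℤ → ℝ}
    (hγ : ∀ k, Tendsto (fun n => γs n k) atTop (𝓝 (γ k))) :
    ∃ φ, WeightedConv Ls L (fun n => pointWeight (Ls n) (γs n) a) (pointWeight L γ a) φ := by
  obtain ⟨φ, hφ, hbij⟩ := h.exists_matching hL
  refine ⟨φ, hφ, hbij, fun x hx => ?_⟩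
  obtain ⟨v, hv, hv1, hv2⟩ := hL.exists_mem_Ioo (lt_add_one |x|)
  rw [pointWeight_of_mem hx]
  refine (hγ (pointIndex L a x)).congr' ?_
  filter_upwards [eventually_pointIndex_eq hL h ha hφ hbij hx, hbij _ _ hv2 hv1] with n h1 h2
  rw [pointWeight_of_mem (h2.mapsTo ⟨hx, abs_le.1 hv.1.le⟩).1, h1]

lemma WeightBounds.of_tendsto {γs : ℕ → ℤ → ℝ} {γ : ℤ → ℝ} {γbar c p : ℝ}
    (h : ∀ᶠ n in atTop, WeightBounds (γs n) γbar c p) (hpos : ∀ k, 0 < γ k)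
    (hγ : ∀ k, Tendsto (fun n => γs n k) atTop (𝓝 (γ k))) : WeightBounds γ γbar c p := by
  refine ⟨hpos, fun m hm => ?_, fun m hm => ?_⟩
  · refine le_of_tendsto (((tendsto_finsetSum _ fun k _ => hγ k).sub_const _).abs)
      (h.mono fun n hn => hn.right m hm)
  · refine le_of_tendsto (((tendsto_finsetSum _ fun k _ => hγ k).sub_const _).abs)
      (h.mono fun n hn => hn.left m hm)

/-- A Fatou argument for the tail: a finite subset of `L` beyond `r` is the limit of finite subsets
of `Ls n`, eventually beyond `r` too. The count bound comes from a slightly larger interval, since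
`±1` may lie in `L`. -/
lemma TailBounds.of_locConv {Ls : ℕ → Set ℝ} {L : Set ℝ} (hL : LocallyFiniteSet L)
    (h : LocConv Ls L) {α : ℝ} {τ : ℝ → ℝ}
    (hLs : ∀ᶠ n in atTop, LocallyFiniteSet (Ls n))
    (hτ : ∀ᶠ n in atTop, ∀ r : ℝ, 1 ≤ r → ∀ F : Finset ℝ, (∀ x ∈ F, x ∈ Ls n ∧ r < |x|) →
      ∑ x ∈ F, 1 / |x| ^ (1 + α) ≤ τ r) :
    ∃ B, TailBounds L α B τ ∧ ∀ᶠ n in atTop, TailBounds (Ls n) α B τ := by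
  classical
  obtain ⟨φ, hφ, hbij⟩ := h.exists_matching hL
  obtain ⟨v, hv, hv1, hv2⟩ := hL.exists_mem_Ioo (one_lt_two (α := ℝ))
  refine ⟨(window L (Icc (-v) v)).card, ⟨hL, fun r hr F hF => ?_, ?_⟩, ?_⟩
  · have hr0 : 0 < r := by linarith
    have hlim : Tendsto (fun n => ∑ x ∈ F, 1 / |φ n x| ^ (1 + α)) atTop
        (𝓝 (∑ x ∈ F, 1 / |x| ^ (1 + α))) := by
      refine tendsto_finsetSum _ fun x hx => ?_
      have hx0 : 0 < |x| := hr0.trans (hF x hx).2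
      exact tendsto_const_nhds.div (((hφ x (hF x hx).1).abs).rpow_const (Or.inl hx0.ne'))
        (by positivity)
    refine le_of_tendsto hlim ?_
    obtain ⟨R, hR⟩ := F.finite_toSet.isBounded.subset_closedBall 0
    obtain ⟨q, hq, hq1, hq2⟩ := hL.exists_mem_Ioo (lt_add_one R)
    have hFq : ∀ x ∈ F, x ∈ L ∩ Icc (-q) q := fun x hx => by
      have := hR hx
      rw [Metric.mem_closedBall, dist_zero_right, Real.norm_eq_abs] at this
      exact ⟨(hF x hx).1, abs_le.1 (this.trans hq.1.le)⟩
    have hlt : ∀ᶠ n in atTop, ∀ x ∈ F, r < |φ n x| := by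
      rw [Filter.eventually_all_finset]
      intro x hx
      exact (hφ x (hF x hx).1).abs.eventually (lt_mem_nhds (hF x hx).2)
    filter_upwards [hτ, hbij _ _ hq2 hq1, hlt] with n h1 h2 h3
    have := h1 r hr (F.image (φ n)) fun y hy => by
      obtain ⟨x, hx, rfl⟩ := Finset.mem_image.1 hy
      exact ⟨(h2.mapsTo (hFq x hx)).1, h3 x hx⟩
    rwa [Finset.sum_image fun x hx y hy hxy => h2.injOn (hFq x hx) (hFq y hy) hxy] at this
  · refine Nat.cast_le.2 (Finset.card_le_card fun x hx => ?_)
    rw [hL.mem_Icc] at hx ⊢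
    exact ⟨hx.1, by linarith [hv.1, hx.2.1], by linarith [hv.1, hx.2.2]⟩
  · filter_upwards [hτ, hbij _ _ hv2 hv1, hLs] with n h1 h2 h3
    refine ⟨h3, h1, ?_⟩
    have hfin : (L ∩ Icc (-v) v).Finite := hL.finite_inter (Metric.isBounded_Icc _ _)
    have hcard : (window (Ls n) (Icc (-v) v)).card = (window L (Icc (-v) v)).card := by
      rw [← h3.ncard_eq (Metric.isBounded_Icc _ _), ← hL.ncard_eq (Metric.isBounded_Icc _ _),
        ← h2.injOn.ncard_image, h2.image_eq]
    rw [← hcard]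
    refine Nat.cast_le.2 (Finset.card_le_card fun x hx => ?_)
    rw [h3.mem_Icc] at hx ⊢
    exact ⟨hx.1, by linarith [hv.1, hx.2.1], by linarith [hv.1, hx.2.2]⟩

/-- Convergence of the principal values at the base point. -/
lemma tendsto_principalValue {Ls : ℕ → Set ℝ} {L : Set ℝ} (hL : LocallyFiniteSet L)
    {Ws : ℕ → ℝ → ℝ} {W : ℝ → ℝ} {φ : ℕ → ℝ → ℝ} (hconv : WeightedConv Ls L Ws W φ) {a : ℝ}
    (ha : a ∉ L) {E H₀ G : ℝ → ℝ} {H : ℕ → ℝ → ℝ} {ss : ℕ → ℝ} {s γbar h r₀ : ℝ}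
    (hE : Tendsto E atTop (𝓝 0))
    (hs : ∀ r, r₀ ≤ r → |s - ∑ x ∈ window L (Icc (-r) r), W x / (x - a) - γbar * H₀ r| ≤ E r)
    (hss : ∀ᶠ n in atTop, ∀ r, r₀ ≤ r →
      |ss n - ∑ x ∈ window (Ls n) (Icc (-r) r), Ws n x / (x - a) - γbar * H n r| ≤ E r)
    (hH : ∀ r, 0 < r → r ∉ L → -r ∉ L → Tendsto (fun n => H n r) atTop (𝓝 (G r)))
    (hG : Tendsto G (atTop ⊓ 𝓟 {r : ℝ | r ∉ L ∧ -r ∉ L}) (𝓝 h))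
    (hH₀ : Tendsto H₀ (atTop ⊓ 𝓟 {r : ℝ | r ∉ L ∧ -r ∉ L}) (𝓝 0)) :
    Tendsto ss atTop (𝓝 (s + γbar * h)) := by
  have hne : (atTop ⊓ 𝓟 {r : ℝ | r ∉ L ∧ -r ∉ L}).NeBot := by
    rw [inf_principal_neBot_iff]
    intro U hU
    obtain ⟨b, hb⟩ := mem_atTop_sets.1 hU
    obtain ⟨r, hr, hr1, hr2⟩ := hL.exists_mem_Ioo (lt_add_one b)
    exact ⟨r, hb r hr.1.le, hr1, hr2⟩
  rw [Metric.tendsto_nhds]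
  intro ε hε
  -- The two approximation errors and the discrepancy of the principal values are what remains after
  -- `n → ∞` at fixed radius. The radius is therefore fixed first, off `L`, and `n` is taken large
  -- afterwards.
  have hlim : Tendsto (fun r => 2 * E r + |γbar * (G r - H₀ r - h)|)
      (atTop ⊓ 𝓟 {r : ℝ | r ∉ L ∧ -r ∉ L}) (𝓝 0) := by
    have h1 := (hE.mono_left (inf_le_left (b := 𝓟 {r : ℝ | r ∉ L ∧ -r ∉ L}))).const_mul 2
    have h2 := ((((hG.sub hH₀).sub_const h).const_mul γbar)).abs
    simpa using h1.add h2
  have hoff : ∀ᶠ r in atTop ⊓ 𝓟 {r : ℝ | r ∉ L ∧ -r ∉ L}, r ∉ L ∧ -r ∉ L :=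
    mem_inf_of_right (mem_principal_self _)
  obtain ⟨r, hr1, ⟨hrr, hr0⟩, hr2, hr3⟩ := ((hlim.eventually (gt_mem_nhds (half_pos hε))).and
    (((((eventually_ge_atTop r₀).and (eventually_gt_atTop 0))).filter_mono inf_le_left).and
      hoff)).exists
  have hsum : Tendsto (fun n => ∑ x ∈ window (Ls n) (Icc (-r) r), Ws n x / (x - a)) atTop
      (𝓝 (∑ x ∈ window L (Icc (-r) r), W x / (x - a))) := by
    have : Tendsto (fun n => ∑ x ∈ window L (Icc (-r) r), Ws n (φ n x) / (φ n x - a)) atTop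
        (𝓝 (∑ x ∈ window L (Icc (-r) r), W x / (x - a))) := by
      refine tendsto_finsetSum _ fun x hx => ?_
      have hxL := (hL.mem_Icc.1 hx).1
      exact (hconv.tendsto_weight x hxL).div ((hconv.tendsto x hxL).sub_const a)
        (sub_ne_zero.2 fun h => ha (h ▸ hxL))
    refine this.congr' ?_
    filter_upwards [hconv.bijOn _ _ hr3 hr2] with n hn
    exact (sum_window_eq_of_bijOn (hL.finite_inter (Metric.isBounded_Icc _ _)) hn
      fun y => Ws n y / (y - a)).symm
  have hA : Tendsto (fun n => |(∑ x ∈ window (Ls n) (Icc (-r) r), Ws n x / (x - a) + γbar * H n r) -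
      (∑ x ∈ window L (Icc (-r) r), W x / (x - a) + γbar * G r)|) atTop (𝓝 0) := by
    have := ((hsum.add ((hH r hr0 hr2 hr3).const_mul γbar)).sub_const
      (∑ x ∈ window L (Icc (-r) r), W x / (x - a) + γbar * G r)).abs
    simpa using this
  filter_upwards [hss, hA.eventually (gt_mem_nhds (half_pos hε))] with n h1 h2
  have h3 := h1 r hrr
  have h4 := hs r hrr
  rw [Real.dist_eq]
  have e : ss n - (s + γbar * h) =
      (ss n - ∑ x ∈ window (Ls n) (Icc (-r) r), Ws n x / (x - a) - γbar * H n r) -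
      (s - ∑ x ∈ window L (Icc (-r) r), W x / (x - a) - γbar * H₀ r) +
      ((∑ x ∈ window (Ls n) (Icc (-r) r), Ws n x / (x - a) + γbar * H n r) -
      (∑ x ∈ window L (Icc (-r) r), W x / (x - a) + γbar * G r)) +
      γbar * (G r - H₀ r - h) := by ring
  rw [e]
  refine (abs_add_le _ _).trans_lt ?_
  have h5 := (abs_add_le ((ss n - ∑ x ∈ window (Ls n) (Icc (-r) r), Ws n x / (x - a) - γbar * H n r) -
      (s - ∑ x ∈ window L (Icc (-r) r), W x / (x - a) - γbar * H₀ r))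
      ((∑ x ∈ window (Ls n) (Icc (-r) r), Ws n x / (x - a) + γbar * H n r) -
      (∑ x ∈ window L (Icc (-r) r), W x / (x - a) + γbar * G r)))
  have h6 := (abs_sub (ss n - ∑ x ∈ window (Ls n) (Icc (-r) r), Ws n x / (x - a) - γbar * H n r)
      (s - ∑ x ∈ window L (Icc (-r) r), W x / (x - a) - γbar * H₀ r))
  linarith

/-! ### The Stieltjes transform with normalized kernel. -/

/-- Positive masses `W` at the points of `L`, square summable against `1 / x`, with a bound `E` for
the tails. -/
structure Masses (L : Set ℝ) (W : ℝ → ℝ) (a r₀ : ℝ) (E : ℝ → ℝ) : Prop where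
  locallyFinite : LocallyFiniteSet L
  notMem : a ∉ L
  pos : ∀ x ∈ L, 0 < W x
  zero : ∀ x ∉ L, W x = 0
  one_le : 1 ≤ r₀
  abs_le : 2 * |a| ≤ r₀
  tail : ∀ r, r₀ ≤ r → ∀ t, ∑ x ∈ window L (annulus r t), W x / x ^ 2 ≤ E r

/-- The Stieltjes kernel normalized to vanish at `z = a`. -/
def kern (a x : ℝ) (z : ℂ) : ℂ := 1 / ((x : ℂ) - z) - 1 / ((x : ℂ) - a)

/-- The Stieltjes transform of the masses `W` with value `s` at `a`. -/
def stieltjes (W : ℝ → ℝ) (a s : ℝ) (z : ℂ) : ℂ := s + ∑' x : ℝ, (W x : ℂ) * kern a x z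

/-- The contribution of the masses in `|x| > r`. -/
def outerSum (W : ℝ → ℝ) (a r : ℝ) (z : ℂ) : ℂ :=
  ∑' x : ℝ, ((if r < |x| then W x else 0 : ℝ) : ℂ) * kern a x z

/-- The kernel equals `(z - a) / ((x - z) * (x - a))`, and both factors below have norm at least
`|x| / 2`. -/
lemma norm_kern_le {a x r : ℝ} {z : ℂ} (hr : 0 < r) (ha : 2 * |a| ≤ r) (hz : 2 * ‖z‖ ≤ r)
    (hx : r < |x|) : ‖kern a x z‖ ≤ 4 * (‖z‖ + |a|) / x ^ 2 := by
  have hx0 : 0 < |x| := hr.trans hx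
  have h1 : |x| / 2 ≤ ‖(x : ℂ) - z‖ := by
    have := norm_sub_norm_le (x : ℂ) z
    rw [Complex.norm_real, Real.norm_eq_abs] at this
    linarith
  have h2 : |x| / 2 ≤ ‖(x : ℂ) - a‖ := by
    have := norm_sub_norm_le (x : ℂ) a
    rw [Complex.norm_real, Complex.norm_real, Real.norm_eq_abs, Real.norm_eq_abs] at this
    linarith
  have h1' : 0 < ‖(x : ℂ) - z‖ := by linarith
  have h2' : 0 < ‖(x : ℂ) - a‖ := by linarith
  have h3 : ‖z - a‖ ≤ ‖z‖ + |a| := by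
    have := norm_sub_le z (a : ℂ)
    rwa [Complex.norm_real, Real.norm_eq_abs] at this
  have e : kern a x z = (z - a) / (((x : ℂ) - z) * ((x : ℂ) - a)) := by
    rw [kern, div_sub_div _ _ (norm_pos_iff.1 h1') (norm_pos_iff.1 h2')]
    congr 1; ring
  rw [e, norm_div, norm_mul, div_le_div_iff₀ (by positivity) (by rw [← sq_abs]; positivity)]
  have h4 : x ^ 2 ≤ 4 * (‖(x : ℂ) - z‖ * ‖(x : ℂ) - a‖) := by
    rw [← sq_abs]; nlinarith
  have := norm_nonneg (z - a)
  have := abs_nonneg a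
  have := norm_nonneg z
  nlinarith [mul_le_mul h3 h4 (sq_nonneg x) (by positivity)]

namespace Masses

variable {L : Set ℝ} {W : ℝ → ℝ} {a r₀ s : ℝ} {E : ℝ → ℝ}

lemma nonneg (h : Masses L W a r₀ E) (x : ℝ) : 0 ≤ W x := by
  by_cases hx : x ∈ L
  · exact (h.pos x hx).le
  · exact (h.zero x hx).ge

lemma sum_outer_le (h : Masses L W a r₀ E) {r : ℝ} (hr : r₀ ≤ r) (F : Finset ℝ) :
    ∑ x ∈ F, (if r < |x| then W x / x ^ 2 else 0) ≤ E r := by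
  classical
  obtain ⟨t, ht⟩ := F.finite_toSet.isBounded.subset_closedBall 0
  refine le_trans ?_ (h.tail r hr t)
  have : ∑ x ∈ F, (if r < |x| then W x / x ^ 2 else 0) =
      ∑ x ∈ F.filter (fun x => r < |x| ∧ x ∈ L), W x / x ^ 2 := by
    rw [Finset.sum_filter]
    refine Finset.sum_congr rfl fun x _ => ?_
    by_cases h1 : r < |x| <;> by_cases h2 : x ∈ L <;> simp [h1, h2, h.zero]
  rw [this]
  refine Finset.sum_le_sum_of_subset_of_nonneg (fun x hx => ?_)
    fun x _ _ => div_nonneg (h.nonneg x) (sq_nonneg x)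
  rw [Finset.mem_filter] at hx
  have := ht hx.1
  rw [Metric.mem_closedBall, dist_zero_right, Real.norm_eq_abs] at this
  exact h.locallyFinite.mem_annulus.2 ⟨hx.2.2, hx.2.1, this⟩

lemma outer_nonneg (h : Masses L W a r₀ E) (r x : ℝ) :
    0 ≤ (if r < |x| then W x / x ^ 2 else 0) := by
  split_ifs
  exacts [div_nonneg (h.nonneg x) (sq_nonneg x), le_rfl]

lemma summable_outer (h : Masses L W a r₀ E) {r : ℝ} (hr : r₀ ≤ r) :
    Summable fun x : ℝ => if r < |x| then W x / x ^ 2 else 0 :=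
  summable_of_sum_le (h.outer_nonneg r) (h.sum_outer_le hr)

lemma tsum_outer_le (h : Masses L W a r₀ E) {r : ℝ} (hr : r₀ ≤ r) :
    ∑' x : ℝ, (if r < |x| then W x / x ^ 2 else 0) ≤ E r :=
  (h.summable_outer hr).tsum_le_of_sum_le (h.sum_outer_le hr)

lemma norm_outer_term_le (h : Masses L W a r₀ E) {r : ℝ} (hr : r₀ ≤ r) {z : ℂ}
    (hz : 2 * ‖z‖ ≤ r) (x : ℝ) :
    ‖((if r < |x| then W x else 0 : ℝ) : ℂ) * kern a x z‖ ≤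
      4 * (‖z‖ + |a|) * (if r < |x| then W x / x ^ 2 else 0) := by
  split_ifs with hx
  · rw [norm_mul, Complex.norm_real, Real.norm_of_nonneg (h.nonneg x)]
    have := norm_kern_le (a := a) (by linarith [h.one_le]) (h.abs_le.trans hr) hz hx
    calc _ ≤ W x * (4 * (‖z‖ + |a|) / x ^ 2) := mul_le_mul_of_nonneg_left this (h.nonneg x)
      _ = _ := by ring
  · simp

lemma summable_outerSum (h : Masses L W a r₀ E) {r : ℝ} (hr : r₀ ≤ r) {z : ℂ} (hz : 2 * ‖z‖ ≤ r) :
    Summable fun x : ℝ => ((if r < |x| then W x else 0 : ℝ) : ℂ) * kern a x z :=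
  Summable.of_norm_bounded ((h.summable_outer hr).mul_left _) (h.norm_outer_term_le hr hz)

lemma norm_outerSum_le (h : Masses L W a r₀ E) {r : ℝ} (hr : r₀ ≤ r) {z : ℂ} (hz : 2 * ‖z‖ ≤ r) :
    ‖outerSum W a r z‖ ≤ 4 * (‖z‖ + |a|) * E r := by
  have hs := (h.summable_outer hr).mul_left (4 * (‖z‖ + |a|))
  refine (tsum_of_norm_bounded hs.hasSum (h.norm_outer_term_le hr hz)).trans ?_
  rw [tsum_mul_left]
  exact mul_le_mul_of_nonneg_left (h.tsum_outer_le hr) (by positivity)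

lemma hasSum_kern (h : Masses L W a r₀ E) {r : ℝ} (hr : r₀ ≤ r) {z : ℂ} (hz : 2 * ‖z‖ ≤ r) :
    HasSum (fun x : ℝ => (W x : ℂ) * kern a x z)
      (∑ x ∈ window L (Icc (-r) r), (W x : ℂ) * kern a x z + outerSum W a r z) := by
  have h1 : HasSum (fun x : ℝ => ((if r < |x| then 0 else W x : ℝ) : ℂ) * kern a x z)
      (∑ x ∈ window L (Icc (-r) r), (W x : ℂ) * kern a x z) := by
    have : ∑ x ∈ window L (Icc (-r) r), (W x : ℂ) * kern a x z =
        ∑ x ∈ window L (Icc (-r) r), ((if r < |x| then 0 else W x : ℝ) : ℂ) * kern a x z := by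
      refine Finset.sum_congr rfl fun x hx => ?_
      rw [if_neg (not_lt.2 (_root_.abs_le.2 (h.locallyFinite.mem_Icc.1 hx).2))]
    rw [this]
    refine hasSum_sum_of_ne_finset_zero fun x hx => ?_
    rw [h.locallyFinite.mem_Icc, ← _root_.abs_le] at hx
    split_ifs with hxr
    · simp
    · rw [h.zero x fun hxL => hx ⟨hxL, not_lt.1 hxr⟩]; simp
  refine (h1.add (h.summable_outerSum hr hz).hasSum).congr_fun fun x => ?_
  split_ifs <;> simp

lemma stieltjes_eq (h : Masses L W a r₀ E) {r : ℝ} (hr : r₀ ≤ r) {z : ℂ} (hz : 2 * ‖z‖ ≤ r) :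
    stieltjes W a s z =
      s + ∑ x ∈ window L (Icc (-r) r), (W x : ℂ) * kern a x z + outerSum W a r z := by
  rw [stieltjes, (h.hasSum_kern hr hz).tsum_eq, add_assoc]

lemma summable_kern (h : Masses L W a r₀ E) (z : ℂ) :
    Summable fun x : ℝ => (W x : ℂ) * kern a x z :=
  (h.hasSum_kern (r := max r₀ (2 * ‖z‖)) (le_max_left _ _) (le_max_right _ _)).summable

/-- Poles beyond `r` stay away from the ball of radius `r / 2`, where the series has a summable
majorant. -/
lemma differentiableOn_outerSum (h : Masses L W a r₀ E) {r : ℝ} (hr : r₀ ≤ r) :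
    DifferentiableOn ℂ (outerSum W a r) (Metric.ball 0 (r / 2)) := by
  have hr0 : 0 < r := by linarith [h.one_le]
  refine Complex.differentiableOn_tsum_of_summable_norm
    (u := fun x => 4 * (r / 2 + |a|) * (if r < |x| then W x / x ^ 2 else 0))
    ((h.summable_outer hr).mul_left _) (fun x => ?_) Metric.isOpen_ball fun x z hz => ?_
  · by_cases hx : r < |x|
    · simp only [if_pos hx, kern]
      intro z hz
      have hne : (x : ℂ) - z ≠ 0 := by
        rw [sub_ne_zero]
        rintro rfl
        rw [mem_ball_zero_iff, Complex.norm_real, Real.norm_eq_abs] at hz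
        linarith
      exact ((DifferentiableAt.div (by fun_prop) (by fun_prop) hne).sub
        (by fun_prop)).const_mul _ |>.differentiableWithinAt
    · simp only [if_neg hx, Complex.ofReal_zero, zero_mul]
      exact differentiableOn_const _
  · rw [mem_ball_zero_iff] at hz
    refine (h.norm_outer_term_le hr (by linarith) x).trans ?_
    exact mul_le_mul_of_nonneg_right (by linarith) (h.outer_nonneg r x)

/-- Splitting off the singular part coming from a finite set of points. -/
lemma exists_analyticAt (h : Masses L W a r₀ E) (s : ℝ) (z₀ : ℂ) :
    ∃ A : ℂ → ℂ, AnalyticAt ℂ A z₀ ∧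
      ∀ᶠ z in 𝓝 z₀, stieltjes W a s z =
        ∑ x ∈ window L ({x | (x : ℂ) = z₀}), (W x : ℂ) / ((x : ℂ) - z) + A z := by
  classical
  set r := max r₀ (2 * ‖z₀‖ + 1) with hrdef
  have hr : r₀ ≤ r := le_max_left _ _
  have hzr : 2 * ‖z₀‖ + 1 ≤ r := le_max_right _ _
  -- This window is empty or a single point, so regular points and poles are handled together.
  have hbd : Bornology.IsBounded {x : ℝ | (x : ℂ) = z₀} :=
    (Set.Subsingleton.finite fun x hx y hy => Complex.ofReal_injective (hx.trans hy.symm)).isBounded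
  have hm : ∀ x, x ∈ window L {x : ℝ | (x : ℂ) = z₀} ↔ x ∈ L ∧ (x : ℂ) = z₀ := fun x =>
    h.locallyFinite.mem_window hbd
  have hsub : window L {x : ℝ | (x : ℂ) = z₀} ⊆ window L (Icc (-r) r) := by
    intro x hx
    rw [hm] at hx
    rw [h.locallyFinite.mem_Icc, ← _root_.abs_le]
    have : ‖z₀‖ = |x| := by rw [← hx.2, Complex.norm_real, Real.norm_eq_abs]
    exact ⟨hx.1, by linarith [norm_nonneg z₀]⟩
  have hball : Metric.ball (0 : ℂ) (r / 2) ∈ 𝓝 z₀ :=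
    Metric.isOpen_ball.mem_nhds (by rw [mem_ball_zero_iff]; linarith)
  refine ⟨fun z => s + (∑ x ∈ window L (Icc (-r) r) \ window L {x : ℝ | (x : ℂ) = z₀},
      (W x : ℂ) * kern a x z - ∑ x ∈ window L {x : ℝ | (x : ℂ) = z₀}, (W x : ℂ) / ((x : ℂ) - a)) +
      outerSum W a r z, ?_, ?_⟩
  · refine (analyticAt_const.add (AnalyticAt.sub ?_ analyticAt_const)).add
      ((h.differentiableOn_outerSum hr).analyticAt hball)
    refine Finset.analyticAt_fun_sum _ fun x hx => ?_
    rw [Finset.mem_sdiff, hm, h.locallyFinite.mem_Icc] at hx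
    have hne : (x : ℂ) - z₀ ≠ 0 := sub_ne_zero.2 fun he => hx.2 ⟨hx.1.1, he⟩
    unfold kern
    exact analyticAt_const.mul
      ((analyticAt_const.div (analyticAt_const.sub analyticAt_id) hne).sub analyticAt_const)
  · filter_upwards [hball] with z hz
    rw [mem_ball_zero_iff] at hz
    rw [h.stieltjes_eq hr (by linarith), ← Finset.sum_sdiff hsub]
    have : ∑ x ∈ window L {x : ℝ | (x : ℂ) = z₀}, (W x : ℂ) * kern a x z =
        ∑ x ∈ window L {x : ℝ | (x : ℂ) = z₀}, (W x : ℂ) / ((x : ℂ) - z) -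
        ∑ x ∈ window L {x : ℝ | (x : ℂ) = z₀}, (W x : ℂ) / ((x : ℂ) - a) := by
      rw [← Finset.sum_sub_distrib]
      exact Finset.sum_congr rfl fun x _ => by rw [kern]; ring
    rw [this]
    ring

lemma window_singleton_of_notMem {z₀ : ℂ} (hz : z₀ ∉ Complex.ofReal '' L) :
    window L {x : ℝ | (x : ℂ) = z₀} = ∅ := by
  have : L ∩ {x : ℝ | (x : ℂ) = z₀} = ∅ :=
    eq_empty_of_forall_notMem fun x hx => hz ⟨x, hx.1, hx.2⟩
  ext x
  rw [mem_window_of_finite (this ▸ Set.finite_empty)]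
  simp only [Finset.notMem_empty, iff_false]
  exact fun hx => hz ⟨x, hx.1, hx.2⟩

lemma analyticAt_stieltjes (h : Masses L W a r₀ E) (s : ℝ) {z₀ : ℂ}
    (hz : z₀ ∉ Complex.ofReal '' L) : AnalyticAt ℂ (stieltjes W a s) z₀ := by
  obtain ⟨A, hA, hS⟩ := h.exists_analyticAt s z₀
  rw [window_singleton_of_notMem hz] at hS
  refine hA.congr ?_
  filter_upwards [hS] with z hz
  rw [hz]; simp

lemma exists_polar_part (h : Masses L W a r₀ E) (s : ℝ) {x : ℝ} (hx : x ∈ L) :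
    ∃ A : ℂ → ℂ, AnalyticAt ℂ A x ∧
      ∀ᶠ z in 𝓝 (x : ℂ), stieltjes W a s z = (W x : ℂ) / ((x : ℂ) - z) + A z := by
  obtain ⟨A, hA, hS⟩ := h.exists_analyticAt s x
  have : window L {y : ℝ | (y : ℂ) = x} = {x} := by
    ext y
    have e : {y : ℝ | (y : ℂ) = x} = {x} := by ext y; simp
    rw [e, h.locallyFinite.mem_window Bornology.isBounded_singleton]
    simp only [Set.mem_singleton_iff, Finset.mem_singleton, and_iff_right_iff_imp]
    rintro rfl; exact hx
  rw [this] at hS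
  simp only [Finset.sum_singleton] at hS
  exact ⟨A, hA, hS⟩

lemma isMeromorphicWithSimplePoles (h : Masses L W a r₀ E) (s : ℝ) :
    IsMeromorphicWithSimplePoles L (stieltjes W a s) := by
  have hpole : ∀ x ∈ L, ∃ g : ℂ → ℂ, AnalyticAt ℂ g x ∧ g x ≠ 0 ∧
      ∀ᶠ z in 𝓝[≠] (x : ℂ), stieltjes W a s z = (z - x) ^ (-1 : ℤ) • g z := by
    intro x hx
    obtain ⟨A, hA, hS⟩ := h.exists_polar_part s hx
    -- This is `z - x` times the polar form; its value `-W x` at `x` is nonzero because masses are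
    -- positive.
    refine ⟨fun z => -(W x : ℂ) + (z - x) * A z, analyticAt_const.add
      ((analyticAt_id.sub analyticAt_const).mul hA), ?_, ?_⟩
    · simpa using (h.pos x hx).ne'
    · filter_upwards [hS.filter_mono nhdsWithin_le_nhds, self_mem_nhdsWithin] with z hz hzx
      have hne : z - x ≠ 0 := sub_ne_zero.2 hzx
      rw [hz, zpow_neg_one, smul_eq_mul, ← neg_sub z, div_neg]
      field_simp
  have hmer : ∀ z : ℂ, MeromorphicAt (stieltjes W a s) z := by
    intro z
    by_cases hz : z ∈ Complex.ofReal '' L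
    · obtain ⟨x, hx, rfl⟩ := hz
      obtain ⟨g, hg, -, hS⟩ := hpole x hx
      have : MeromorphicAt (fun z : ℂ => (z - x) ^ (-1 : ℤ) • g z) x := by fun_prop
      exact this.congr (hS.mono fun z hz => hz.symm)
    · exact (h.analyticAt_stieltjes s hz).meromorphicAt
  refine ⟨hmer, fun z hz => h.analyticAt_stieltjes s hz, fun x hx => ?_⟩
  obtain ⟨g, hg, hg0, hS⟩ := hpole x hx
  have := (meromorphicOrderAt_eq_int_iff (hmer x) (n := -1)).2 ⟨g, hg, hg0, hS⟩
  exact_mod_cast this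

/-- The normalized sums converge absolutely, and the subtracted constants `W x / (x - a)` add up
symmetrically to `s`. Thus `s` must be the principal value at `a`. -/
lemma tendsto_sum_window (h : Masses L W a r₀ E) (hE : Tendsto E atTop (𝓝 0))
    (hs : Tendsto (fun t => ∑ x ∈ window L (Icc (-t) t), W x / (x - a)) atTop (𝓝 s)) (z : ℂ) :
    Tendsto (fun t : ℝ => ∑ x ∈ window L (Icc (-t) t), (W x : ℂ) * (1 / ((x : ℂ) - z))) atTop
      (𝓝 (stieltjes W a s z)) := by
  have h1 : Tendsto (fun t => outerSum W a t z) atTop (𝓝 0) := by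
    have hb : Tendsto (fun t => 4 * (‖z‖ + |a|) * E t) atTop (𝓝 0) := by
      simpa using hE.const_mul (4 * (‖z‖ + |a|))
    refine squeeze_zero_norm' ?_ hb
    filter_upwards [eventually_ge_atTop r₀, eventually_ge_atTop (2 * ‖z‖)] with t h1 h2
    exact h.norm_outerSum_le h1 h2
  have h2 : Tendsto (fun t : ℝ => ((∑ x ∈ window L (Icc (-t) t), W x / (x - a) - s : ℝ) : ℂ)) atTop
      (𝓝 0) := by
    have := (Complex.continuous_ofReal.tendsto _).comp (hs.sub_const s)
    rwa [sub_self, Complex.ofReal_zero] at this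
  have h3 := ((tendsto_const_nhds (x := stieltjes W a s z)).sub h1).add h2
  rw [sub_zero, add_zero] at h3
  refine h3.congr' ?_
  filter_upwards [eventually_ge_atTop r₀, eventually_ge_atTop (2 * ‖z‖)] with t h1 h2
  rw [h.stieltjes_eq h1 h2]
  have : ∑ x ∈ window L (Icc (-t) t), (W x : ℂ) * kern a x z =
      ∑ x ∈ window L (Icc (-t) t), (W x : ℂ) * (1 / ((x : ℂ) - z)) -
        ((∑ x ∈ window L (Icc (-t) t), W x / (x - a) : ℝ) : ℂ) := by
    push_cast
    rw [← Finset.sum_sub_distrib]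
    exact Finset.sum_congr rfl fun x _ => by rw [kern]; ring
  rw [this]
  push_cast
  ring

end Masses

lemma isStieltjesTransform {L : Set ℝ} {γ : ℤ → ℝ} {a r₀ s : ℝ} {E : ℝ → ℝ}
    (h : Masses L (pointWeight L γ a) a r₀ E) (hE : Tendsto E atTop (𝓝 0)) (hγ : ∀ k, 0 < γ k)
    (hs : Tendsto (fun t => ∑ x ∈ window L (Icc (-t) t), pointWeight L γ a x / (x - a)) atTop
      (𝓝 s)) :
    IsStieltjesTransform L γ a (stieltjes (pointWeight L γ a) a s) := by
  intro z _
  refine (h.tendsto_sum_window hE hs z).congr fun t => ?_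
  rw [weightedMeasure, setIntegral_sum_dirac
    (h.locallyFinite.finite_inter (Metric.isBounded_Icc _ _)) measurableSet_Icc
    (fun x => γ (pointIndex L a x)) (fun x _ => (hγ _).le)]
  refine Finset.sum_congr rfl fun x hx => ?_
  rw [pointWeight_of_mem (h.locallyFinite.mem_Icc.1 hx).1, Complex.real_smul]

/-! ### Level sets: reality, monotonicity and interlacing with the poles. -/

lemma mem_levelSet_iff {L : Set ℝ} {S : ℂ → ℂ} {t : ℝ} {z : ℂ} :
    z ∈ levelSet L S t ↔ z ∉ Complex.ofReal '' L ∧ S z = t := by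
  simp only [levelSet, toSphere, mem_ofPred_eq]
  split_ifs with h
  · simp [h]
  · simp [h]

lemma mem_realLevelSet_iff {L : Set ℝ} {S : ℂ → ℂ} {t x : ℝ} :
    x ∈ realLevelSet L S t ↔ x ∉ L ∧ S x = t := by
  rw [realLevelSet, mem_ofPred_eq, mem_levelSet_iff, Function.Injective.mem_set_image
    Complex.ofReal_injective]

/-- The Stieltjes transform on the real line. -/
def realStieltjes (W : ℝ → ℝ) (a s x : ℝ) : ℝ := s + ∑' p : ℝ, W p * (1 / (p - x) - 1 / (p - a))

lemma stieltjes_ofReal (W : ℝ → ℝ) (a s x : ℝ) :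
    stieltjes W a s x = (realStieltjes W a s x : ℂ) := by
  rw [stieltjes, realStieltjes]
  push_cast
  rfl

lemma mem_realLevelSet_stieltjes_iff {L : Set ℝ} {W : ℝ → ℝ} {a s t x : ℝ} :
    x ∈ realLevelSet L (stieltjes W a s) t ↔ x ∉ L ∧ realStieltjes W a s x = t := by
  rw [mem_realLevelSet_iff, stieltjes_ofReal, Complex.ofReal_inj]

/-- Between any two points of `M` there is a point of `L`. -/
def Separates (L M : Set ℝ) : Prop := ∀ x ∈ M, ∀ y ∈ M, x < y → ∃ p ∈ L, x < p ∧ p < y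

namespace Masses

variable {L : Set ℝ} {W : ℝ → ℝ} {a r₀ s : ℝ} {E : ℝ → ℝ}

/-- The constants in the kernel are real, so `Im S` is `Im z` times the sum of `W x / |x - z| ^ 2`,
which is positive. -/
lemma im_ne_zero (h : Masses L W a r₀ E) (hne : L.Nonempty) (s : ℝ) {z : ℂ} (hz : z.im ≠ 0) :
    (stieltjes W a s z).im ≠ 0 := by
  have h1 := Complex.hasSum_im (h.summable_kern z).hasSum
  have h2 : (fun x : ℝ => ((W x : ℂ) * kern a x z).im) =
      fun x : ℝ => z.im * (W x / Complex.normSq ((x : ℂ) - z)) := by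
    funext x
    have h3 : (1 / ((x : ℂ) - a)).im = 0 := by
      rw [← Complex.ofReal_sub, ← Complex.ofReal_one, ← Complex.ofReal_div, Complex.ofReal_im]
    rw [Complex.im_ofReal_mul, kern, Complex.sub_im, h3, one_div, Complex.inv_im]
    simp
    ring
  rw [h2] at h1
  have h3 : Summable fun x : ℝ => W x / Complex.normSq ((x : ℂ) - z) := by
    have := h1.summable.mul_left z.im⁻¹
    refine this.congr fun x => ?_
    field_simp
  obtain ⟨p, hp⟩ := hne
  have h4 : 0 < ∑' x : ℝ, W x / Complex.normSq ((x : ℂ) - z) := by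
    refine h3.tsum_pos (fun x => div_nonneg (h.nonneg x) (Complex.normSq_nonneg _)) p
      (div_pos (h.pos p hp) (Complex.normSq_pos.2 (sub_ne_zero.2 ?_)))
    rintro rfl
    simp at hz
  rw [stieltjes, Complex.add_im, Complex.ofReal_im, zero_add, ← h1.tsum_eq, tsum_mul_left]
  exact mul_ne_zero hz h4.ne'

lemma stieltjes_of_empty (h : Masses ∅ W a r₀ E) (s : ℝ) (z : ℂ) : stieltjes W a s z = s := by
  have : ∀ x : ℝ, (W x : ℂ) * kern a x z = 0 := fun x => by simp [h.zero x (notMem_empty x)]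
  simp [stieltjes, this]

lemma im_eq_zero_of_mem_levelSet (h : Masses L W a r₀ E) {s t : ℝ} (hne : L.Nonempty ∨ t ≠ s)
    {z : ℂ} (hz : z ∈ levelSet L (stieltjes W a s) t) : z.im = 0 := by
  rw [mem_levelSet_iff] at hz
  by_contra him
  rcases L.eq_empty_or_nonempty with rfl | hL
  · rw [h.stieltjes_of_empty, Complex.ofReal_inj] at hz
    rcases hne with hne | hne
    · exact not_nonempty_empty hne
    · exact hne hz.2.symm
  · exact h.im_ne_zero hL s him (by rw [hz.2, Complex.ofReal_im])

lemma summable_real (h : Masses L W a r₀ E) (x : ℝ) :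
    Summable fun p : ℝ => W p * (1 / (p - x) - 1 / (p - a)) := by
  have := h.summable_kern (x : ℂ)
  rw [← Complex.summable_ofReal]
  refine this.congr fun p => ?_
  simp [kern]

/-- Every `1 / (p - x)` increases on an interval not containing `p`; a single point of positive mass
makes the inequality strict. -/
lemma realStieltjes_lt (h : Masses L W a r₀ E) (hne : L.Nonempty) (s : ℝ) {x y : ℝ} (hxy : x < y)
    (hL : ∀ p ∈ L, p ∉ Icc x y) : realStieltjes W a s x < realStieltjes W a s y := by
  have key : ∀ p ∈ L, 1 / (p - x) < 1 / (p - y) := by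
    intro p hp
    have hp' := hL p hp
    rw [mem_Icc, not_and_or, not_le, not_le] at hp'
    rcases hp' with h1 | h1
    · exact one_div_lt_one_div_of_neg_of_lt (by linarith) (by linarith)
    · exact one_div_lt_one_div_of_lt (by linarith) (by linarith)
  obtain ⟨q, hq⟩ := hne
  refine add_lt_add_right (Summable.tsum_lt_tsum (i := q) (fun p => ?_) ?_ (h.summable_real x)
    (h.summable_real y)) s
  · by_cases hp : p ∈ L
    · exact mul_le_mul_of_nonneg_left (by linarith [key p hp]) (h.nonneg p)
    · simp [h.zero p hp]
  · exact mul_lt_mul_of_pos_left (by linarith [key q hq]) (h.pos q hq)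

lemma continuousAt_realStieltjes (h : Masses L W a r₀ E) (s : ℝ) {x : ℝ} (hx : x ∉ L) :
    ContinuousAt (realStieltjes W a s) x := by
  have h1 : ContinuousAt (stieltjes W a s) (x : ℂ) := by
    refine (h.analyticAt_stieltjes s ?_).continuousAt
    rwa [Function.Injective.mem_set_image Complex.ofReal_injective]
  have h2 : ContinuousAt (fun y : ℝ => (stieltjes W a s (y : ℂ)).re) x :=
    Complex.continuous_re.continuousAt.comp
      (ContinuousAt.comp (f := Complex.ofReal) h1 Complex.continuous_ofReal.continuousAt)
  refine h2.congr (Eventually.of_forall fun y => ?_)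
  simp only [stieltjes_ofReal, Complex.ofReal_re]

/-- Two solutions on a pole-free interval would contradict strict monotonicity. For empty `L` the
transform is the constant `s ≠ t`, and the level set is empty. -/
lemma separates_levelSet (h : Masses L W a r₀ E) {s t : ℝ} (hne : L.Nonempty ∨ t ≠ s) :
    Separates L (realLevelSet L (stieltjes W a s) t) := by
  intro x hx y hy hxy
  rw [mem_realLevelSet_stieltjes_iff] at hx hy
  by_contra! hcon
  rcases L.eq_empty_or_nonempty with rfl | hL
  · have := hx.2
    rw [← Complex.ofReal_inj, ← stieltjes_ofReal, h.stieltjes_of_empty, Complex.ofReal_inj] at this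
    rcases hne with hne | hne
    · exact not_nonempty_empty hne
    · exact hne this.symm
  · refine (h.realStieltjes_lt hL s hxy fun p hp hpI => ?_).ne (hx.2.trans hy.2.symm)
    have h1 : x < p := lt_of_le_of_ne hpI.1 fun he => hx.1 (he ▸ hp)
    exact (hcon p hp h1).not_gt (lt_of_le_of_ne hpI.2 fun he => hy.1 (he ▸ hp))

lemma exists_real_polar_part (h : Masses L W a r₀ E) (s : ℝ) {p : ℝ} (hp : p ∈ L) :
    ∃ B > 0, ∀ᶠ x in 𝓝 p, |realStieltjes W a s x - W p / (p - x)| ≤ B := by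
  obtain ⟨A, hA, hS⟩ := h.exists_polar_part s hp
  refine ⟨‖A p‖ + 1, by positivity, ?_⟩
  have h1 : ∀ᶠ z in 𝓝 (p : ℂ), ‖A z‖ ≤ ‖A p‖ + 1 :=
    (hA.continuousAt.norm.eventually (gt_mem_nhds (lt_add_one _))).mono fun z hz => hz.le
  filter_upwards [Complex.continuous_ofReal.continuousAt.eventually (hS.and h1)] with x hx
  have : ((realStieltjes W a s x - W p / (p - x) : ℝ) : ℂ) = A x := by
    push_cast
    rw [← stieltjes_ofReal, hx.1]; ring
  rw [← Real.norm_eq_abs, ← Complex.norm_real, this]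
  exact hx.2

lemma exists_lt_right (h : Masses L W a r₀ E) (s t : ℝ) {p : ℝ} (hp : p ∈ L) :
    ∀ᶠ x in 𝓝[>] p, realStieltjes W a s x < t := by
  obtain ⟨B, hB, hS⟩ := h.exists_real_polar_part s hp
  have hW := h.pos p hp
  -- Within this distance of `p` the polar term exceeds `B + |t| + 1`, which beats the bounded
  -- remainder and the level.
  have hd : 0 < W p / (B + |t| + 1) := by positivity
  filter_upwards [hS.filter_mono nhdsWithin_le_nhds, self_mem_nhdsWithin,
    mem_nhdsWithin_of_mem_nhds (Iio_mem_nhds (lt_add_of_pos_right p hd))] with x h1 h2 h3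
  have h4 : B + |t| + 1 < W p / (x - p) := by
    rw [lt_div_iff₀ (sub_pos.2 h2)]
    have : x - p < W p / (B + |t| + 1) := by linarith [mem_Iio.1 h3]
    rw [lt_div_iff₀ (by positivity)] at this
    linarith
  have h5 : W p / (p - x) = -(W p / (x - p)) := by rw [← neg_sub x p, div_neg]
  rw [h5] at h1
  linarith [(_root_.abs_le.1 h1).2, neg_abs_le t]

lemma exists_gt_left (h : Masses L W a r₀ E) (s t : ℝ) {p : ℝ} (hp : p ∈ L) :
    ∀ᶠ x in 𝓝[<] p, t < realStieltjes W a s x := by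
  obtain ⟨B, hB, hS⟩ := h.exists_real_polar_part s hp
  have hW := h.pos p hp
  have hd : 0 < W p / (B + |t| + 1) := by positivity
  filter_upwards [hS.filter_mono nhdsWithin_le_nhds, self_mem_nhdsWithin,
    mem_nhdsWithin_of_mem_nhds (Ioi_mem_nhds (sub_lt_self p hd))] with x h1 h2 h3
  have h4 : B + |t| + 1 < W p / (p - x) := by
    rw [lt_div_iff₀ (sub_pos.2 h2)]
    have : p - x < W p / (B + |t| + 1) := by linarith [mem_Ioi.1 h3]
    rw [lt_div_iff₀ (by positivity)] at this
    linarith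
  linarith [(_root_.abs_le.1 h1).1, le_abs_self t]

/-- Between `p` and the next point `q'` of `L`, the transform runs from `-∞` to `+∞`, so the
intermediate value theorem applies. The midpoint serves only to order the two test points. -/
lemma levelSet_separates (h : Masses L W a r₀ E) (s t : ℝ) :
    Separates (realLevelSet L (stieltjes W a s) t) L := by
  classical
  intro p hp q hq hpq
  have hfin : (window L (Ioc p q)).Nonempty :=
    ⟨q, (h.locallyFinite.mem_window (Metric.isBounded_Ioc p q)).2 ⟨hq, hpq, le_rfl⟩⟩
  set q' := (window L (Ioc p q)).min' hfin with hq'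
  have hq'mem := (h.locallyFinite.mem_window (Metric.isBounded_Ioc p q)).1
    ((window L (Ioc p q)).min'_mem hfin)
  rw [← hq'] at hq'mem
  have hgap : ∀ x, p < x → x < q' → x ∉ L := fun x h1 h2 hx => by
    have := (window L (Ioc p q)).min'_le x
      ((h.locallyFinite.mem_window (Metric.isBounded_Ioc p q)).2
        ⟨hx, h1, h2.le.trans hq'mem.2.2⟩)
    linarith
  have hpq' : p < q' := hq'mem.2.1
  obtain ⟨x, hx1, hx2⟩ := ((h.exists_lt_right s t hp).and
    (Ioo_mem_nhdsGT (show p < (p + q') / 2 by linarith))).exists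
  obtain ⟨y, hy1, hy2⟩ := ((h.exists_gt_left s t hq'mem.1).and
    (Ioo_mem_nhdsLT (show (p + q') / 2 < q' by linarith))).exists
  have hcont : ContinuousOn (realStieltjes W a s) (Icc x y) := fun w hw =>
    (h.continuousAt_realStieltjes s (hgap w (hx2.1.trans_le hw.1)
      (hw.2.trans_lt hy2.2))).continuousWithinAt
  obtain ⟨w, hw, hwt⟩ := intermediate_value_Icc (hx2.2.trans hy2.1).le hcont ⟨hx1.le, hy1.le⟩
  have h1 : p < w := hx2.1.trans_le hw.1
  have h2 : w < q' := hw.2.trans_lt hy2.2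
  exact ⟨w, mem_realLevelSet_stieltjes_iff.2 ⟨hgap w h1 h2, hwt⟩, h1, h2.trans_le hq'mem.2.2⟩

end Masses

/-! ### Sums and principal values over interlacing sets. -/

section Interlacing

lemma Separates.card_le {L M : Set ℝ} (h : Separates L M) (hL : LocallyFiniteSet L) {J : Set ℝ}
    (hJ : J.OrdConnected) (hJb : Bornology.IsBounded J) {F : Finset ℝ}
    (hF : ∀ x ∈ F, x ∈ M ∧ x ∈ J) : F.card ≤ (window L J).card + 1 := by
  refine Finset.card_le_of_interleaved fun x hx y hy hxy _ => ?_
  obtain ⟨p, hp, h1, h2⟩ := h x (hF x hx).1 y (hF y hy).1 hxy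
  exact ⟨p, (hL.mem_window hJb).2 ⟨hp, hJ.out (hF x hx).2 (hF y hy).2 ⟨h1.le, h2.le⟩⟩, h1, h2⟩

lemma Separates.locallyFinite {L M : Set ℝ} (h : Separates L M) (hL : LocallyFiniteSet L) :
    LocallyFiniteSet M := by
  intro R
  by_contra hinf
  obtain ⟨F, hF, hcard⟩ := Set.Infinite.exists_subset_card_eq hinf
    ((window L (Icc (-R) R)).card + 2)
  have := h.card_le hL ordConnected_Icc (Metric.isBounded_Icc (-R) R) (F := F) fun x hx => hF hx
  omega

lemma abs_card_window_sub_le {L M : Set ℝ} (hL : LocallyFiniteSet L) (hM : LocallyFiniteSet M)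
    (h1 : Separates L M) (h2 : Separates M L) {J : Set ℝ}
    (hJ : J.OrdConnected) (hJb : Bornology.IsBounded J) :
    |((window M J).card : ℝ) - (window L J).card| ≤ 1 := by
  have e1 := h1.card_le hL hJ hJb (F := window M J) fun x hx => (hM.mem_window hJb).1 hx
  have e2 := h2.card_le hM hJ hJb (F := window L J) fun x hx => (hL.mem_window hJb).1 hx
  have e1' : ((window M J).card : ℝ) ≤ (window L J).card + 1 := by exact_mod_cast e1
  have e2' : ((window L J).card : ℝ) ≤ (window M J).card + 1 := by exact_mod_cast e2
  rw [abs_le]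
  constructor <;> linarith

/-- Sums over interlacing sets of a function decaying like `1 / |x|` are close. -/
lemma abs_sum_window_sub_sum_window_le {L M : Set ℝ} (hL : LocallyFiniteSet L)
    (hM : LocallyFiniteSet M) (h1 : Separates L M) (h2 : Separates M L) {f : ℝ → ℝ} {r A : ℝ}
    (t : ℝ) (hr : 0 < r) (hA : 0 ≤ A) (hf : DecaysLikeInv f r A) :
    |∑ x ∈ window M (annulus r t), f x - ∑ x ∈ window L (annulus r t), f x| ≤ 4 * A / r := by
  classical
  have hU := hM.union hL
  -- With this signed indicator, partial sums over intervals are differences of counts, at most `1`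
  -- in absolute value. Abel summation with `β = 0` and `C = 1` gives `2 * (A * (1 + 1)) / r`.
  set u : ℝ → ℝ := fun x => (if x ∈ M then 1 else 0) - (if x ∈ L then 1 else 0) with hu
  have key : ∀ (J : Set ℝ) (_ : Bornology.IsBounded J) (g : ℝ → ℝ),
      ∑ x ∈ window (M ∪ L) J, u x * g x = ∑ x ∈ window M J, g x - ∑ x ∈ window L J, g x := by
    intro J hJ g
    have eM : window M J = (window (M ∪ L) J).filter (· ∈ M) := by
      ext x
      rw [Finset.mem_filter, hM.mem_window hJ, hU.mem_window hJ, mem_union]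
      tauto
    have eL : window L J = (window (M ∪ L) J).filter (· ∈ L) := by
      ext x
      rw [Finset.mem_filter, hL.mem_window hJ, hU.mem_window hJ, mem_union]
      tauto
    rw [eM, eL, Finset.sum_filter, Finset.sum_filter, ← Finset.sum_sub_distrib]
    refine Finset.sum_congr rfl fun x _ => ?_
    simp only [hu, sub_mul, ite_mul, one_mul, zero_mul]
  have hcard : ∀ (J : Set ℝ), J.OrdConnected → Bornology.IsBounded J → ∀ x : ℝ,
      |∑ y ∈ window (M ∪ L) J, u y| ≤ 1 * x ^ (0 : ℝ) := by
    intro J hJ hJb x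
    have := key J hJb fun _ => 1
    simp only [mul_one, Finset.sum_const, nsmul_eq_mul] at this
    rw [this, Real.rpow_zero, one_mul]
    exact abs_card_window_sub_le hL hM h1 h2 hJ hJb
  have := abs_sum_window_annulus_le hU (u := u) (t := t) (β := 0) (C := 1) hr le_rfl one_pos hA
    zero_le_one hf (fun x _ => hcard _ ordConnected_Ioc (Metric.isBounded_Ioc _ _) x)
    (fun x _ => hcard _ ordConnected_Ico (Metric.isBounded_Ico _ _) x)
  rw [key _ (isBounded_annulus r t)] at this
  refine this.trans (le_of_eq ?_)
  rw [zero_sub, Real.rpow_neg_one]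
  ring

/-- The principal values of interlacing sets. -/
lemma exists_isTailPrincipalValue {L M : Set ℝ} (hL : LocallyFiniteSet L)
    (hM : LocallyFiniteSet M) (h1 : Separates L M) (h2 : Separates M L) {r v : ℝ} (hr : 0 < r)
    (hv : IsTailPrincipalValue L r v) :
    ∃ v', IsTailPrincipalValue M r v' ∧ |v' - v| ≤ 4 / r := by
  rw [isTailPrincipalValue_iff hL] at hv
  simp_rw [isTailPrincipalValue_iff hM]
  have hE : Tendsto (fun r : ℝ => 4 * 1 / r) atTop (𝓝 0) := tendsto_const_nhds.div_atTop tendsto_id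
  obtain ⟨d, hd, hdr⟩ := exists_tendsto_of_abs_sub_le (r₀ := r)
    (g := fun t => ∑ x ∈ window M (annulus r t), x⁻¹ - ∑ x ∈ window L (annulus r t), x⁻¹) hE (by
    intro q t hq ht
    rw [hM.sum_window_annulus_add _ hq ht, hL.sum_window_annulus_add _ hq ht]
    have hq0 := hr.trans_le hq
    have := abs_sum_window_sub_sum_window_le hL hM h1 h2 t hq0 zero_le_one (decaysLikeInv_inv hq0)
    convert this using 2
    ring)
  refine ⟨d + v, (hd.add hv).congr fun t => by ring, ?_⟩
  -- The annulus from `r` to `r` is empty, so the rate of convergence at `r` bounds the limit `d`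
  -- itself.
  have hz : ∀ K : Set ℝ, LocallyFiniteSet K → ∑ x ∈ window K (annulus r r), x⁻¹ = 0 := by
    intro K hK
    refine Finset.sum_eq_zero fun x hx => ?_
    have := (hK.mem_annulus.1 hx).2
    exact absurd this.1 (not_lt.2 this.2)
  have := hdr r le_rfl
  simp only [hz L hL, hz M hM, sub_zero, mul_one] at this
  rwa [add_sub_cancel_right]

/-- The tail bound passes to interlacing sets. -/
lemma sum_rpow_le_of_separates {L M : Set ℝ} (hL : LocallyFiniteSet L)
    (hM : LocallyFiniteSet M) (h1 : Separates L M) (h2 : Separates M L) {α r T : ℝ} (hα : 0 < α)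
    (hα1 : α < 1) (hr : 1 ≤ r)
    (hT : ∀ F : Finset ℝ, (∀ x ∈ F, x ∈ L ∧ r < |x|) → ∑ x ∈ F, 1 / |x| ^ (1 + α) ≤ T)
    {F : Finset ℝ} (hF : ∀ x ∈ F, x ∈ M ∧ r < |x|) :
    ∑ x ∈ F, 1 / |x| ^ (1 + α) ≤ T + 8 / r := by
  obtain ⟨t, ht⟩ := F.finite_toSet.isBounded.subset_closedBall 0
  have e1 : ∑ x ∈ F, 1 / |x| ^ (1 + α) ≤ ∑ x ∈ window M (annulus r t), 1 / |x| ^ (1 + α) := by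
    refine Finset.sum_le_sum_of_subset_of_nonneg (fun x hx => ?_) fun x _ _ => by positivity
    have := ht hx
    rw [Metric.mem_closedBall, dist_zero_right, Real.norm_eq_abs] at this
    exact hM.mem_annulus.2 ⟨(hF x hx).1, (hF x hx).2, this⟩
  have e2 := hT (window L (annulus r t)) fun x hx =>
    ⟨(hL.mem_annulus.1 hx).1, (hL.mem_annulus.1 hx).2.1⟩
  have e3 := abs_sum_window_sub_sum_window_le hL hM h1 h2 t (by linarith) zero_le_two
    (decaysLikeInv_rpow hr (p := 1 + α) (by linarith) (by linarith))
  have e4 := (abs_le.1 e3).2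
  norm_num at e4 ⊢
  norm_num at e1 e2
  linarith

end Interlacing

/-! ### Convergence of the transforms, away from and near the poles. -/

/-- Convergent weighted configurations with uniform tails and convergent values at the base
point. -/
structure StieltjesConv (Ls : ℕ → Set ℝ) (L : Set ℝ) (Ws : ℕ → ℝ → ℝ) (W : ℝ → ℝ)
    (φ : ℕ → ℝ → ℝ) (a r₀ : ℝ) (E : ℝ → ℝ) (ss : ℕ → ℝ) (s : ℝ) : Prop where
  conv : WeightedConv Ls L Ws W φ
  locConv : LocConv Ls L
  masses : Masses L W a r₀ E
  eventually_masses : ∀ᶠ n in atTop, Masses (Ls n) (Ws n) a r₀ E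
  tail : Tendsto E atTop (𝓝 0)
  tendsto : Tendsto ss atTop (𝓝 s)

lemma norm_div_sub_div_le {w w' x x' δ : ℝ} {z : ℂ} (hδ : 0 < δ) (hx : δ ≤ ‖(x : ℂ) - z‖)
    (hx' : |x' - x| ≤ δ / 2) :
    ‖(w' : ℂ) / ((x' : ℂ) - z) - (w : ℂ) / ((x : ℂ) - z)‖ ≤
      |w' - w| * (2 / δ) + |w| * |x' - x| * (2 / δ ^ 2) := by
  have h1 : δ / 2 ≤ ‖(x' : ℂ) - z‖ := by
    have h2 := norm_sub_norm_le ((x : ℂ) - z) ((x : ℂ) - x')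
    have h3 : ‖(x : ℂ) - x'‖ = |x' - x| := by
      rw [← Complex.ofReal_sub, Complex.norm_real, Real.norm_eq_abs, abs_sub_comm]
    rw [sub_sub_sub_cancel_left, h3] at h2
    linarith
  have h1' : 0 < ‖(x' : ℂ) - z‖ := by linarith
  have hx0 : 0 < ‖(x : ℂ) - z‖ := by linarith
  have e : (w' : ℂ) / ((x' : ℂ) - z) - (w : ℂ) / ((x : ℂ) - z) =
      ((w' - w : ℝ) : ℂ) / ((x' : ℂ) - z) -
        ((w * (x' - x) : ℝ) : ℂ) / (((x' : ℂ) - z) * ((x : ℂ) - z)) := by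
    have := norm_pos_iff.1 h1'
    have := norm_pos_iff.1 hx0
    push_cast
    field_simp
    ring
  rw [e]
  refine (norm_sub_le _ _).trans (add_le_add ?_ ?_)
  · rw [norm_div, Complex.norm_real, Real.norm_eq_abs, div_eq_mul_inv]
    refine mul_le_mul_of_nonneg_left ?_ (abs_nonneg _)
    rw [← one_div, div_le_div_iff₀ h1' hδ]; linarith
  · rw [norm_div, norm_mul, Complex.norm_real, Real.norm_eq_abs, abs_mul, div_eq_mul_inv]
    refine mul_le_mul_of_nonneg_left ?_ (by positivity)
    rw [← one_div, div_le_div_iff₀ (by positivity) (by positivity)]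
    nlinarith

namespace StieltjesConv

variable {Ls : ℕ → Set ℝ} {L : Set ℝ} {Ws : ℕ → ℝ → ℝ} {W : ℝ → ℝ} {φ : ℕ → ℝ → ℝ} {a r₀ : ℝ}
  {E : ℝ → ℝ} {ss : ℕ → ℝ} {s : ℝ}

/-- Away from a finite set `P` of points, and after the subtraction of the corresponding polar
parts, the transforms converge uniformly on bounded sets. -/
lemma eventually_norm_sub_lt (h : StieltjesConv Ls L Ws W φ a r₀ E ss s) {P : Finset ℝ}
    (hP : ∀ x ∈ P, x ∈ L) {Z : Set ℂ} {R δ : ℝ} (hR : ∀ z ∈ Z, ‖z‖ ≤ R) (hδ : 0 < δ)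
    (hZ : ∀ z ∈ Z, ∀ x ∈ L, x ∉ P → δ ≤ ‖(x : ℂ) - z‖) {ε : ℝ} (hε : 0 < ε) :
    ∀ᶠ n in atTop, ∀ z ∈ Z,
      ‖(stieltjes (Ws n) a (ss n) z - ∑ x ∈ P, (Ws n (φ n x) : ℂ) / ((φ n x : ℂ) - z)) -
        (stieltjes W a s z - ∑ x ∈ P, (W x : ℂ) / ((x : ℂ) - z))‖ < ε := by
  classical
  have hL := h.masses.locallyFinite
  obtain ⟨q, hq⟩ := P.finite_toSet.isBounded.subset_closedBall 0
  have hb : Tendsto (fun r => 4 * (R + |a|) * E r) atTop (𝓝 0) := by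
    simpa using h.tail.const_mul (4 * (R + |a|))
  obtain ⟨b, hb'⟩ := eventually_atTop.1 (hb.eventually (gt_mem_nhds (show 0 < ε / 5 by positivity)))
  -- The radius is fixed before `n`: beyond it both outer sums are below `ε / 5`, and inside it lie
  -- `P` and all relevant `z`.
  obtain ⟨r, hr, hr1, hr2⟩ := hL.exists_mem_Ioo (lt_add_one (max (max b r₀) (max q (2 * R))))
  have hmax := hr.1.le
  rw [max_le_iff, max_le_iff, max_le_iff] at hmax
  obtain ⟨⟨hbr, hr0⟩, hqr, hRr⟩ := hmax
  have hEr := hb' r hbr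
  set F := window L (Icc (-r) r) with hF
  have hmF : ∀ x, x ∈ F ↔ x ∈ L ∧ -r ≤ x ∧ x ≤ r := fun x => hL.mem_Icc
  have hPF : P ⊆ F := fun x hx => by
    have := hq hx
    rw [Metric.mem_closedBall, dist_zero_right, Real.norm_eq_abs] at this
    exact (hmF x).2 ⟨hP x hx, abs_le.1 (this.trans hqr)⟩
  -- For points of `P` the polar parts cancel and only the constants at `a` are left; the other
  -- points keep distance `δ` from `Z`. The extra `1` keeps the share positive when `F` is empty.
  have hterm : ∀ᶠ n in atTop, ∀ x ∈ F, ∀ z ∈ Z,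
      ‖((Ws n (φ n x) : ℂ) * kern a (φ n x) z - (W x : ℂ) * kern a x z) -
        (if x ∈ P then (Ws n (φ n x) : ℂ) / ((φ n x : ℂ) - z) - (W x : ℂ) / ((x : ℂ) - z)
          else 0)‖ ≤ ε / 5 / (F.card + 1) := by
    rw [Filter.eventually_all_finset]
    intro x hx
    have hxL := ((hmF x).1 hx).1
    have hη : 0 < ε / 5 / (F.card + 1) := by positivity
    set η := ε / 5 / (F.card + 1) with hηdef
    have hxa : x - a ≠ 0 := sub_ne_zero.2 fun he => h.masses.notMem (he ▸ hxL)
    have hφ := h.conv.tendsto x hxL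
    have hw := h.conv.tendsto_weight x hxL
    have hconst : ∀ᶠ n in atTop, |Ws n (φ n x) / (φ n x - a) - W x / (x - a)| < η / 2 := by
      have := (hw.div (hφ.sub_const a) hxa).eventually (Metric.ball_mem_nhds _ (half_pos hη))
      exact this.mono fun n hn => by rwa [Real.dist_eq] at hn
    have hvar : ∀ᶠ n in atTop, |Ws n (φ n x) - W x| * (2 / δ) + |W x| * |φ n x - x| * (2 / δ ^ 2)
        < η / 2 := by
      have h1 : Tendsto (fun n => |Ws n (φ n x) - W x|) atTop (𝓝 0) := by
        simpa using (hw.sub_const (W x)).abs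
      have h2 : Tendsto (fun n => |φ n x - x|) atTop (𝓝 0) := by
        simpa using (hφ.sub_const x).abs
      have h3 := (h1.mul_const (2 / δ)).add ((h2.const_mul |W x|).mul_const (2 / δ ^ 2))
      rw [zero_mul, mul_zero, zero_mul, add_zero] at h3
      exact h3.eventually (gt_mem_nhds (half_pos hη))
    have hδφ : ∀ᶠ n in atTop, |φ n x - x| ≤ δ / 2 := by
      have := hφ.eventually (Metric.closedBall_mem_nhds x (half_pos hδ))
      exact this.mono fun n hn => by rwa [Real.dist_eq] at hn
    filter_upwards [hconst, hvar, hδφ] with n h1 h2 h3 z hz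
    have h1' : ‖(Ws n (φ n x) : ℂ) / ((φ n x : ℂ) - a) - (W x : ℂ) / ((x : ℂ) - a)‖ < η / 2 := by
      rw [← Real.norm_eq_abs, ← Complex.norm_real] at h1
      push_cast at h1
      exact h1
    split_ifs with hxP
    · have e : (Ws n (φ n x) : ℂ) * kern a (φ n x) z - (W x : ℂ) * kern a x z -
          ((Ws n (φ n x) : ℂ) / ((φ n x : ℂ) - z) - (W x : ℂ) / ((x : ℂ) - z)) =
          -((Ws n (φ n x) : ℂ) / ((φ n x : ℂ) - a) - (W x : ℂ) / ((x : ℂ) - a)) := by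
        simp only [kern]; ring
      rw [e, norm_neg]
      linarith
    · have e : (Ws n (φ n x) : ℂ) * kern a (φ n x) z - (W x : ℂ) * kern a x z - 0 =
          ((Ws n (φ n x) : ℂ) / ((φ n x : ℂ) - z) - (W x : ℂ) / ((x : ℂ) - z)) -
          ((Ws n (φ n x) : ℂ) / ((φ n x : ℂ) - a) - (W x : ℂ) / ((x : ℂ) - a)) := by
        simp only [kern]; ring
      rw [e]
      have h4 := norm_div_sub_div_le (w := W x) (w' := Ws n (φ n x)) hδ (hZ z hz x hxL hxP) h3
      have h5 := norm_sub_le ((Ws n (φ n x) : ℂ) / ((φ n x : ℂ) - z) - (W x : ℂ) / ((x : ℂ) - z))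
          ((Ws n (φ n x) : ℂ) / ((φ n x : ℂ) - a) - (W x : ℂ) / ((x : ℂ) - a))
      linarith
  have hs : ∀ᶠ n in atTop, |ss n - s| < ε / 5 := by
    have := h.tendsto.eventually (Metric.ball_mem_nhds s (show 0 < ε / 5 by positivity))
    exact this.mono fun n hn => by rwa [Real.dist_eq] at hn
  filter_upwards [hterm, hs, h.eventually_masses, h.conv.bijOn _ _ hr2 hr1] with n h1 h2 h3 h4 z hz
  have hzr : 2 * ‖z‖ ≤ r := by linarith [hR z hz]
  rw [h3.stieltjes_eq hr0 hzr, h.masses.stieltjes_eq hr0 hzr,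
    sum_window_eq_of_bijOn (hL.finite_inter (Metric.isBounded_Icc _ _)) h4
      fun y => (Ws n y : ℂ) * kern a y z]
  have eP : ∀ g : ℝ → ℂ, ∑ x ∈ P, g x = ∑ x ∈ F, if x ∈ P then g x else 0 := fun g => by
    rw [Finset.sum_ite_mem, Finset.inter_eq_right.2 hPF]
  have e : (((ss n : ℂ) + ∑ x ∈ F, (Ws n (φ n x) : ℂ) * kern a (φ n x) z + outerSum (Ws n) a r z) -
        ∑ x ∈ P, (Ws n (φ n x) : ℂ) / ((φ n x : ℂ) - z)) -
      (((s : ℂ) + ∑ x ∈ F, (W x : ℂ) * kern a x z + outerSum W a r z) -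
        ∑ x ∈ P, (W x : ℂ) / ((x : ℂ) - z)) =
      ((ss n - s : ℝ) : ℂ) + outerSum (Ws n) a r z - outerSum W a r z +
      ∑ x ∈ F, (((Ws n (φ n x) : ℂ) * kern a (φ n x) z - (W x : ℂ) * kern a x z) -
        (if x ∈ P then (Ws n (φ n x) : ℂ) / ((φ n x : ℂ) - z) - (W x : ℂ) / ((x : ℂ) - z)
          else 0)) := by
    rw [Finset.sum_sub_distrib, Finset.sum_sub_distrib, ← eP, Finset.sum_sub_distrib]
    push_cast
    ring
  rw [e]
  have k1 : ‖((ss n - s : ℝ) : ℂ)‖ < ε / 5 := by rwa [Complex.norm_real]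
  have hEnn : ∀ z ∈ Z, 4 * (‖z‖ + |a|) * E r ≤ 4 * (R + |a|) * E r := fun z hz => by
    have hE0 : 0 ≤ E r := by simpa using h.masses.sum_outer_le hr0 ∅
    exact mul_le_mul_of_nonneg_right (by linarith [hR z hz]) hE0
  have k2 := (h3.norm_outerSum_le hr0 hzr).trans (hEnn z hz)
  have k3 := (h.masses.norm_outerSum_le hr0 hzr).trans (hEnn z hz)
  have k4 : ‖∑ x ∈ F, (((Ws n (φ n x) : ℂ) * kern a (φ n x) z - (W x : ℂ) * kern a x z) -
        (if x ∈ P then (Ws n (φ n x) : ℂ) / ((φ n x : ℂ) - z) - (W x : ℂ) / ((x : ℂ) - z)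
          else 0))‖ ≤ ε / 5 := by
    refine (norm_sum_le_of_le F fun x hx => h1 x hx z hz).trans ?_
    rw [Finset.sum_const, nsmul_eq_mul, mul_div_assoc', div_le_iff₀ (by positivity)]
    nlinarith
  refine (norm_add_le _ _).trans_lt ?_
  have k5 := norm_sub_le (((ss n - s : ℝ) : ℂ) + outerSum (Ws n) a r z) (outerSum W a r z)
  have k6 := norm_add_le ((ss n - s : ℝ) : ℂ) (outerSum (Ws n) a r z)
  linarith

/-- Locally uniform convergence away from the limit configuration. -/
lemma exists_ball_eventually_lt (h : StieltjesConv Ls L Ws W φ a r₀ E ss s) {z₀ : ℂ}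
    (hz₀ : z₀ ∉ Complex.ofReal '' L) :
    ∃ ρ > 0, (∀ z ∈ Metric.ball z₀ ρ, z ∉ Complex.ofReal '' L) ∧
      (∀ᶠ n in atTop, ∀ z ∈ Metric.ball z₀ ρ, z ∉ Complex.ofReal '' (Ls n)) ∧
      ∀ ε > 0, ∀ᶠ n in atTop, ∀ z ∈ Metric.ball z₀ ρ,
        ‖stieltjes (Ws n) a (ss n) z - stieltjes W a s z‖ < ε := by
  have hL := h.masses.locallyFinite
  obtain ⟨δ, hδ, hd⟩ : ∃ δ > 0, ∀ x ∈ L, δ ≤ ‖(x : ℂ) - z₀‖ := by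
    obtain ⟨r, hr, hx⟩ := hL.exists_ball z₀.re
    by_cases him : z₀.im = 0
    · have hz : z₀ = (z₀.re : ℂ) := Complex.ext (by simp) (by simp [him])
      refine ⟨r, hr, fun x hxL => ?_⟩
      rw [hz, ← Complex.ofReal_sub, Complex.norm_real, Real.norm_eq_abs]
      by_contra! hlt
      exact hz₀ ⟨x, hxL, by rw [hx x hxL hlt, ← hz]⟩
    · refine ⟨|z₀.im|, abs_pos.2 him, fun x _ => ?_⟩
      have := Complex.abs_im_le_norm ((x : ℂ) - z₀)
      simpa using this
  have hball : ∀ z ∈ Metric.ball z₀ (δ / 2), ∀ x ∈ L, δ / 2 ≤ ‖(x : ℂ) - z‖ := by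
    intro z hz x hx
    rw [mem_ball_iff_norm] at hz
    have := norm_sub_norm_le ((x : ℂ) - z₀) (z - z₀)
    rw [sub_sub_sub_cancel_right] at this
    linarith [hd x hx]
  have hR : ∀ z ∈ Metric.ball z₀ (δ / 2), ‖z‖ ≤ ‖z₀‖ + δ / 2 := fun z hz => by
    rw [mem_ball_iff_norm] at hz
    linarith [norm_le_norm_add_norm_sub' z z₀]
  refine ⟨δ / 2, by positivity, ?_, ?_, fun ε hε => ?_⟩
  · rintro _ hz ⟨x, hx, rfl⟩
    have := hball _ hz x hx
    rw [sub_self, norm_zero] at this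
    linarith
  · obtain ⟨v, hv, hv1, hv2⟩ := hL.exists_mem_Ioo (lt_add_one (‖z₀‖ + δ / 2))
    have hfin : (L ∩ Icc (-v) v).Finite := hL.finite_inter (Metric.isBounded_Icc _ _)
    have hnear : ∀ᶠ n in atTop, ∀ x ∈ L ∩ Icc (-v) v, |φ n x - x| < δ / 2 := by
      rw [eventually_all_finite hfin]
      intro x hx
      have := (h.conv.tendsto x hx.1).eventually (Metric.ball_mem_nhds x (half_pos hδ))
      exact this.mono fun n hn => by rwa [Real.dist_eq] at hn
    filter_upwards [hnear, h.conv.bijOn _ _ hv2 hv1] with n h1 h2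
    rintro _ hz ⟨y, hy, rfl⟩
    have hyv := hR _ hz
    rw [Complex.norm_real, Real.norm_eq_abs] at hyv
    obtain ⟨x, hx, rfl⟩ := h2.surjOn ⟨hy, abs_le.1 (hyv.trans hv.1.le)⟩
    have h3 := hball _ hz x hx.1
    rw [← Complex.ofReal_sub, Complex.norm_real, Real.norm_eq_abs, abs_sub_comm] at h3
    linarith [h1 x hx]
  · have := h.eventually_norm_sub_lt (P := ∅) (by simp) hR (half_pos hδ)
      (fun z hz x hx _ => hball z hz x hx) hε
    simpa using this

/-- The transforms are uniformly large near the points of the limit configuration. -/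
lemma exists_ball_eventually_le (h : StieltjesConv Ls L Ws W φ a r₀ E ss s) {p : ℝ}
    (hp : p ∈ L) (M : ℝ) :
    ∃ ρ > 0, (∀ z ∈ Metric.ball (p : ℂ) ρ, z ∉ Complex.ofReal '' L → M ≤ ‖stieltjes W a s z‖) ∧
      ∀ᶠ n in atTop, ∀ z ∈ Metric.ball (p : ℂ) ρ, z ∉ Complex.ofReal '' (Ls n) →
        M ≤ ‖stieltjes (Ws n) a (ss n) z‖ := by
  have hL := h.masses.locallyFinite
  have hW := h.masses.pos p hp
  obtain ⟨A, hA, hS⟩ := h.masses.exists_polar_part s hp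
  have hB : ∀ᶠ z in 𝓝 (p : ℂ), ‖A z‖ ≤ ‖A p‖ + 1 :=
    (hA.continuousAt.norm.eventually (gt_mem_nhds (lt_add_one _))).mono fun z hz => hz.le
  obtain ⟨ρ₁, hρ₁, h1⟩ := Metric.eventually_nhds_iff_ball.1 (hS.and hB)
  obtain ⟨ρ₂, hρ₂, h2⟩ := hL.exists_ball p
  set B := ‖A p‖ + 1 with hBdef
  have hB0 : 0 < B := by positivity
  set C := |M| + B + 1 with hC
  have hC0 : 0 < C := by positivity
  -- The factor `4` lets the polar term stay at least `C` when the mass is halved and the moving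
  -- pole is up to `2 * ρ` away. In `C`, the `1` absorbs the uniform convergence error.
  set ρ := min (min ρ₁ (ρ₂ / 2)) (W p / (4 * C)) with hρ
  have hρ0 : 0 < ρ := by positivity
  have hρa : ρ ≤ ρ₁ := (min_le_left _ _).trans (min_le_left _ _)
  have hρb : ρ ≤ ρ₂ / 2 := (min_le_left _ _).trans (min_le_right _ _)
  have hρc : C * (4 * ρ) ≤ W p := by
    have : ρ ≤ W p / (4 * C) := min_le_right _ _
    rw [le_div_iff₀ (by positivity)] at this
    linarith
  have hM := le_abs_self M
  refine ⟨ρ, hρ0, fun z hz hzL => ?_, ?_⟩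
  · have hz1 := h1 z (Metric.ball_subset_ball hρa hz)
    rw [mem_ball_iff_norm'] at hz
    have hz0 : 0 < ‖(p : ℂ) - z‖ :=
      norm_pos_iff.2 (sub_ne_zero.2 fun he => hzL ⟨p, hp, he⟩)
    have h3 : C ≤ ‖(W p : ℂ) / ((p : ℂ) - z)‖ := by
      rw [norm_div, Complex.norm_real, Real.norm_of_nonneg hW.le, le_div_iff₀ hz0]
      nlinarith
    have h4 := norm_sub_le (stieltjes W a s z) (A z)
    rw [hz1.1, add_sub_cancel_right, ← hz1.1] at h4
    linarith [hz1.2]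
  · have hZ : ∀ z ∈ Metric.ball (p : ℂ) ρ, ∀ x ∈ L, x ∉ ({p} : Finset ℝ) →
        ρ₂ / 2 ≤ ‖(x : ℂ) - z‖ := by
      intro z hz x hx hxp
      rw [mem_ball_iff_norm] at hz
      have h5 : ρ₂ ≤ |x - p| := by
        by_contra! hlt
        exact hxp (Finset.mem_singleton.2 (h2 x hx hlt))
      have := norm_sub_norm_le ((x : ℂ) - p) (z - p)
      rw [sub_sub_sub_cancel_right, ← Complex.ofReal_sub, Complex.norm_real,
        Real.norm_eq_abs] at this
      linarith
    have hR : ∀ z ∈ Metric.ball (p : ℂ) ρ, ‖z‖ ≤ ‖(p : ℂ)‖ + ρ := fun z hz => by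
      rw [mem_ball_iff_norm] at hz
      linarith [norm_le_norm_add_norm_sub' z p]
    have hev := h.eventually_norm_sub_lt (P := {p}) (by simpa using hp) hR (half_pos hρ₂) hZ one_pos
    have hw := (h.conv.tendsto_weight p hp).eventually (lt_mem_nhds (half_lt_self hW))
    have hφ := (h.conv.tendsto p hp).eventually (Metric.ball_mem_nhds p hρ0)
    filter_upwards [hev, hw, hφ, h.conv.eventually_mem hL hp] with n h3 h4 h5 h6 z hz hzL
    have h3' := h3 z hz
    rw [Finset.sum_singleton, Finset.sum_singleton] at h3'
    have hz1 := h1 z (Metric.ball_subset_ball hρa hz)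
    have hz0 : 0 < ‖(φ n p : ℂ) - z‖ :=
      norm_pos_iff.2 (sub_ne_zero.2 fun he => hzL ⟨_, h6, he⟩)
    rw [mem_ball_iff_norm'] at hz
    rw [Real.dist_eq] at h5
    have h7 : ‖(φ n p : ℂ) - z‖ ≤ 2 * ρ := by
      have := norm_add_le ((φ n p : ℂ) - p) ((p : ℂ) - z)
      rw [sub_add_sub_cancel, ← Complex.ofReal_sub, Complex.norm_real, Real.norm_eq_abs] at this
      linarith
    have h8 : C ≤ ‖(Ws n (φ n p) : ℂ) / ((φ n p : ℂ) - z)‖ := by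
      rw [norm_div, Complex.norm_real, Real.norm_of_nonneg (by linarith), le_div_iff₀ hz0]
      nlinarith
    rw [hz1.1, add_sub_cancel_left] at h3'
    set X := stieltjes (Ws n) a (ss n) z
    set Y := (Ws n (φ n p) : ℂ) / ((φ n p : ℂ) - z)
    have h9 : ‖Y‖ ≤ ‖X‖ + ‖X - Y - A z‖ + ‖A z‖ := by
      have e : Y = X - (X - Y - A z) - A z := by ring
      calc ‖Y‖ = ‖X - (X - Y - A z) - A z‖ := by rw [← e]
        _ ≤ ‖X - (X - Y - A z)‖ + ‖A z‖ := norm_sub_le _ _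
        _ ≤ _ := by linarith [norm_sub_le X (X - Y - A z)]
    linarith [hz1.2]

end StieltjesConv

/-! ### Chordal estimates. -/

section Chordal

lemma chordalDist_coe_le (z w : ℂ) :
    chordalDist (OnePoint.some z) (OnePoint.some w) ≤ ‖w - z‖ := by
  change ‖w - z‖ / Real.sqrt ((1 + ‖z‖ ^ 2) * (1 + ‖w‖ ^ 2)) ≤ ‖w - z‖
  refine div_le_self (norm_nonneg _) ?_
  rw [Real.one_le_sqrt]
  nlinarith [sq_nonneg ‖z‖, sq_nonneg ‖w‖, mul_nonneg (sq_nonneg ‖z‖) (sq_nonneg ‖w‖)]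

lemma norm_le_sqrt_one_add (z : ℂ) : ‖z‖ ≤ Real.sqrt (1 + ‖z‖ ^ 2) :=
  Real.le_sqrt_of_sq_le (by linarith)

lemma one_div_sqrt_le {M : ℝ} (hM : 0 < M) {z : ℂ} (hz : M ≤ ‖z‖) :
    1 / Real.sqrt (1 + ‖z‖ ^ 2) ≤ 1 / M :=
  one_div_le_one_div_of_le hM (hz.trans (norm_le_sqrt_one_add z))

/-- For finite points the distance is at most `|w - z| / (|z| * |w|) ≤ 1 / |z| + 1 / |w|`; at `∞`
the corresponding term vanishes. -/
lemma chordalDist_le_of_large {M : ℝ} (hM : 0 < M) {p q : OnePoint ℂ}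
    (hp : ∀ z : ℂ, p = OnePoint.some z → M ≤ ‖z‖) (hq : ∀ z : ℂ, q = OnePoint.some z → M ≤ ‖z‖) :
    chordalDist p q ≤ 2 / M := by
  have h0 : 0 < 1 / M := by positivity
  have h2 : 2 / M = 1 / M + 1 / M := by ring
  induction p using OnePoint.rec with
  | infty =>
    induction q using OnePoint.rec with
    | infty => change (0 : ℝ) ≤ _; positivity
    | coe w =>
      change 1 / Real.sqrt (1 + ‖w‖ ^ 2) ≤ _
      linarith [one_div_sqrt_le hM (hq w rfl)]
  | coe z =>
    have hz := hp z rfl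
    induction q using OnePoint.rec with
    | infty =>
      change 1 / Real.sqrt (1 + ‖z‖ ^ 2) ≤ _
      linarith [one_div_sqrt_le hM hz]
    | coe w =>
      have hw := hq w rfl
      change ‖w - z‖ / Real.sqrt ((1 + ‖z‖ ^ 2) * (1 + ‖w‖ ^ 2)) ≤ _
      have hz0 : 0 < ‖z‖ := hM.trans_le hz
      have hw0 : 0 < ‖w‖ := hM.trans_le hw
      rw [Real.sqrt_mul (by positivity)]
      calc _ ≤ (‖w‖ + ‖z‖) / (‖z‖ * ‖w‖) := by
            gcongr
            · exact norm_sub_le _ _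
            · exact norm_le_sqrt_one_add z
            · exact norm_le_sqrt_one_add w
        _ = 1 / ‖z‖ + 1 / ‖w‖ := by field_simp
        _ ≤ 1 / M + 1 / M := add_le_add (one_div_le_one_div_of_le hM hz)
            (one_div_le_one_div_of_le hM hw)
        _ = 2 / M := h2.symm

lemma toSphere_of_mem {L : Set ℝ} {S : ℂ → ℂ} {z : ℂ} (hz : z ∈ Complex.ofReal '' L) :
    toSphere L S z = OnePoint.infty := if_pos hz

lemma toSphere_of_notMem {L : Set ℝ} {S : ℂ → ℂ} {z : ℂ} (hz : z ∉ Complex.ofReal '' L) :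
    toSphere L S z = OnePoint.some (S z) := if_neg hz

lemma le_norm_of_toSphere_eq {L : Set ℝ} {S : ℂ → ℂ} {z w : ℂ} {M : ℝ}
    (h : z ∉ Complex.ofReal '' L → M ≤ ‖S z‖) (hw : toSphere L S z = OnePoint.some w) :
    M ≤ ‖w‖ := by
  by_cases hz : z ∈ Complex.ofReal '' L
  · rw [toSphere_of_mem hz] at hw
    exact absurd hw (OnePoint.infty_ne_coe w)
  · rw [toSphere_of_notMem hz, OnePoint.some_eq_iff] at hw
    exact hw ▸ h hz

end Chordal

/-! ### Convergence on the sphere and of the level sets. -/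

namespace StieltjesConv

variable {Ls : ℕ → Set ℝ} {L : Set ℝ} {Ws : ℕ → ℝ → ℝ} {W : ℝ → ℝ} {φ : ℕ → ℝ → ℝ} {a r₀ : ℝ}
  {E : ℝ → ℝ} {ss : ℕ → ℝ} {s : ℝ}

/-- Compactness reduces to small balls. Around a pole both values have norm at least `3 / ε` or are
infinite, so they are within `2 * ε / 3`. Elsewhere the chordal distance is at most the Euclidean
one. -/
lemma tendstoChordalOnCompacts (h : StieltjesConv Ls L Ws W φ a r₀ E ss s) :
    TendstoChordalOnCompacts (fun n => toSphere (Ls n) (stieltjes (Ws n) a (ss n)))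
      (toSphere L (stieltjes W a s)) := by
  intro K hK ε hε
  refine hK.induction_on
    (p := fun K => ∀ᶠ n in atTop, ∀ z ∈ K, chordalDist
      (toSphere (Ls n) (stieltjes (Ws n) a (ss n)) z) (toSphere L (stieltjes W a s) z) < ε)
    (by simp) (fun K K' hKK h' => h'.mono fun n hn z hz => hn z (hKK hz)) (fun K K' h1 h2 => ?_)
    fun z₀ _ => ?_
  · filter_upwards [h1, h2] with n h1 h2 z hz
    exact hz.elim (h1 z) (h2 z)
  · by_cases hz₀ : z₀ ∈ Complex.ofReal '' L
    · obtain ⟨p, hp, rfl⟩ := hz₀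
      obtain ⟨ρ, hρ, h1, h2⟩ := h.exists_ball_eventually_le hp (3 / ε)
      refine ⟨Metric.ball p ρ, mem_nhdsWithin_of_mem_nhds (Metric.ball_mem_nhds _ hρ), ?_⟩
      filter_upwards [h2] with n h2 z hz
      refine (chordalDist_le_of_large (M := 3 / ε) (by positivity)
        (fun w hw => le_norm_of_toSphere_eq (h2 z hz) hw)
        (fun w hw => le_norm_of_toSphere_eq (h1 z hz) hw)).trans_lt ?_
      rw [div_div_eq_mul_div, div_lt_iff₀ (by norm_num)]
      linarith
    · obtain ⟨ρ, hρ, h1, h2, h3⟩ := h.exists_ball_eventually_lt hz₀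
      refine ⟨Metric.ball z₀ ρ, mem_nhdsWithin_of_mem_nhds (Metric.ball_mem_nhds _ hρ), ?_⟩
      filter_upwards [h2, h3 ε hε] with n h2 h3 z hz
      rw [toSphere_of_notMem (h2 z hz), toSphere_of_notMem (h1 z hz)]
      refine (chordalDist_coe_le _ _).trans_lt ?_
      rw [norm_sub_rev]
      exact h3 z hz

lemma eventually_nonempty (h : StieltjesConv Ls L Ws W φ a r₀ E ss s) (hL : L.Nonempty) :
    ∀ᶠ n in atTop, (Ls n).Nonempty := by
  obtain ⟨p, hp⟩ := hL
  exact (h.conv.eventually_mem h.masses.locallyFinite hp).mono fun n hn => ⟨_, hn⟩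

/-- The level sets converge. -/
lemma locConv_realLevelSet (h : StieltjesConv Ls L Ws W φ a r₀ E ss s) {t : ℝ}
    (hne : L.Nonempty ∨ t ≠ s) :
    LocConv (fun n => realLevelSet (Ls n) (stieltjes (Ws n) a (ss n)) t)
      (realLevelSet L (stieltjes W a s) t) := by
  have hball : ∀ x ∉ L, ∃ ρ > 0, (∀ y, |y - x| < ρ → y ∉ L) ∧
      (∀ᶠ n in atTop, ∀ y, |y - x| < ρ → y ∉ Ls n) ∧ ∀ ε > 0, ∀ᶠ n in atTop, ∀ y, |y - x| < ρ →
        |realStieltjes (Ws n) a (ss n) y - realStieltjes W a s y| < ε := by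
    intro x hx
    have hx' : (x : ℂ) ∉ Complex.ofReal '' L := by
      rwa [Function.Injective.mem_set_image Complex.ofReal_injective]
    obtain ⟨ρ, hρ, h1, h2, h3⟩ := h.exists_ball_eventually_lt hx'
    have hb : ∀ y : ℝ, |y - x| < ρ → (y : ℂ) ∈ Metric.ball (x : ℂ) ρ := fun y hy => by
      rwa [mem_ball_iff_norm, ← Complex.ofReal_sub, Complex.norm_real]
    refine ⟨ρ, hρ, fun y hy => ?_, h2.mono fun n hn y hy => ?_, fun ε hε =>
      (h3 ε hε).mono fun n hn y hy => ?_⟩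
    · have := h1 _ (hb y hy)
      rwa [Function.Injective.mem_set_image Complex.ofReal_injective] at this
    · have := hn _ (hb y hy)
      rwa [Function.Injective.mem_set_image Complex.ofReal_injective] at this
    · have := hn _ (hb y hy)
      rwa [stieltjes_ofReal, stieltjes_ofReal, ← Complex.ofReal_sub, Complex.norm_real] at this
  have hLne : ∀ x ∈ realLevelSet L (stieltjes W a s) t, L.Nonempty := by
    intro x hx
    rcases hne with hne | hne
    · exact hne
    · by_contra hemp
      rw [not_nonempty_iff_eq_empty] at hemp
      subst hemp
      have := (mem_realLevelSet_iff.1 hx).2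
      rw [h.masses.stieltjes_of_empty, Complex.ofReal_inj] at this
      exact hne this.symm
  refine ⟨fun x hx ε hε => ?_, fun x hx => ?_, fun x hx => ?_⟩
  · have hL := hLne x hx
    rw [mem_realLevelSet_stieltjes_iff] at hx
    obtain ⟨ρ, hρ, h1, h2, h3⟩ := hball x hx.1
    set η := min ε ρ / 2 with hη
    have hη0 : 0 < η := by positivity
    have hηε : η < ε := by linarith [min_le_left ε ρ]
    have hηρ : η < ρ := by linarith [min_le_right ε ρ]
    have hin : ∀ y ∈ Icc (x - η) (x + η), |y - x| < ρ := fun y hy =>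
      (abs_le.2 ⟨by linarith [hy.1], by linarith [hy.2]⟩ : |y - x| ≤ η).trans_lt hηρ
    -- Strict monotonicity puts the limit values at `x ± η` on opposite sides of `t`. This persists
    -- for large `n`, and the intermediate value theorem gives a nearby solution.
    have hlt1 : realStieltjes W a s (x - η) < t := by
      rw [← hx.2]
      exact h.masses.realStieltjes_lt hL s (by linarith) fun p hp hpI =>
        h1 p (hin p ⟨hpI.1, by linarith [hpI.2]⟩) hp
    have hlt2 : t < realStieltjes W a s (x + η) := by
      rw [← hx.2]
      exact h.masses.realStieltjes_lt hL s (by linarith) fun p hp hpI =>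
        h1 p (hin p ⟨by linarith [hpI.1], hpI.2⟩) hp
    filter_upwards [h2, h3 _ (sub_pos.2 hlt1), h3 _ (sub_pos.2 hlt2), h.eventually_masses]
      with n h2 h4 h5 h6
    have h4' := (abs_lt.1 (h4 (x - η) (hin _ ⟨le_rfl, by linarith⟩))).2
    have h5' := (abs_lt.1 (h5 (x + η) (hin _ ⟨by linarith, le_rfl⟩))).1
    have hcont : ContinuousOn (realStieltjes (Ws n) a (ss n)) (Icc (x - η) (x + η)) :=
      fun y hy => (h6.continuousAt_realStieltjes _ (h2 y (hin y hy))).continuousWithinAt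
    obtain ⟨y, hy, hyt⟩ := intermediate_value_Icc (by linarith) hcont
      (show t ∈ Icc _ _ from ⟨by linarith, by linarith⟩)
    refine ⟨y, mem_realLevelSet_stieltjes_iff.2 ⟨h2 y (hin y hy), hyt⟩, ?_⟩
    exact (abs_le.2 ⟨by linarith [hy.1], by linarith [hy.2]⟩ : |y - x| ≤ η).trans_lt hηε
  · have hL := hLne x hx
    rw [mem_realLevelSet_stieltjes_iff] at hx
    obtain ⟨ρ, hρ, -, h2, -⟩ := hball x hx.1
    refine ⟨ρ, hρ, ?_⟩
    filter_upwards [h2, h.eventually_nonempty hL, h.eventually_masses] with n h2 h3 h4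
    -- Eventually `Ls n` has no point near `x`, so the transform is strictly increasing there and
    -- takes the value `t` at most once.
    have key : ∀ y z, realStieltjes (Ws n) a (ss n) y = t → realStieltjes (Ws n) a (ss n) z = t →
        |y - x| < ρ → |z - x| < ρ → ¬ y < z := by
      intro y z hy hz h5 h6 hyz
      refine (h4.realStieltjes_lt h3 (ss n) hyz fun p hp hpI => ?_).ne (hy.trans hz.symm)
      rw [abs_lt] at h5 h6
      exact h2 p (abs_lt.2 ⟨by linarith [hpI.1], by linarith [hpI.2]⟩) hp
    intro y hy z hz h5 h6
    rw [mem_realLevelSet_stieltjes_iff] at hy hz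
    exact le_antisymm (not_lt.1 (key z y hz.2 hy.2 h6 h5)) (not_lt.1 (key y z hy.2 hz.2 h5 h6))
  · by_cases hxL : x ∈ L
    · obtain ⟨ρ, hρ, -, h2⟩ := h.exists_ball_eventually_le hxL (|t| + 1)
      refine ⟨ρ, hρ, ?_⟩
      filter_upwards [h2] with n h2 y hy
      rw [mem_realLevelSet_iff] at hy
      by_contra! hlt
      have := h2 y (by rwa [mem_ball_iff_norm, ← Complex.ofReal_sub, Complex.norm_real])
        (by rw [Function.Injective.mem_set_image Complex.ofReal_injective]; exact hy.1)
      rw [hy.2, Complex.norm_real, Real.norm_eq_abs] at this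
      linarith
    · obtain ⟨ρ, hρ, -, -, h3⟩ := hball x hxL
      have hxt : realStieltjes W a s x ≠ t := fun he =>
        hx (mem_realLevelSet_stieltjes_iff.2 ⟨hxL, he⟩)
      set d := |realStieltjes W a s x - t| with hd
      have hd0 : 0 < d := abs_pos.2 (sub_ne_zero.2 hxt)
      obtain ⟨ρ', hρ', h4⟩ := Metric.continuousAt_iff.1 (h.masses.continuousAt_realStieltjes s hxL)
        (d / 2) (half_pos hd0)
      refine ⟨min ρ ρ', by positivity, ?_⟩
      filter_upwards [h3 (d / 2) (half_pos hd0)] with n h3 y hy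
      rw [mem_realLevelSet_stieltjes_iff] at hy
      by_contra! hlt
      have h5 := h3 y (hlt.trans_le (min_le_left _ _))
      have h6 := h4 (x := y) (by rw [Real.dist_eq]; exact hlt.trans_le (min_le_right _ _))
      rw [hy.2] at h5
      rw [Real.dist_eq] at h6
      have := abs_sub_le (realStieltjes W a s x) (realStieltjes W a s y) t
      rw [abs_sub_comm] at h5 h6
      linarith

end StieltjesConv

/-! ### Condition (P) for interlacing configurations. -/

lemma PointAssumptions.tail_sum_le {α : ℝ} {L : Set ℝ} {τ : ℝ → ℝ} (hτ : ∀ r, 0 ≤ r → 0 < τ r) :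
    (∀ r : ℝ, 1 ≤ r → ∫⁻ x in {x : ℝ | r < |x|}, ENNReal.ofReal (1 / |x| ^ (1 + α))
      ∂(pointMeasure L) ≤ ENNReal.ofReal (τ r)) ↔
    ∀ r : ℝ, 1 ≤ r → ∀ F : Finset ℝ, (∀ x ∈ F, x ∈ L ∧ r < |x|) →
      ∑ x ∈ F, 1 / |x| ^ (1 + α) ≤ τ r := by
  refine forall₂_congr fun r hr => ?_
  have hm : MeasurableSet {x : ℝ | r < |x|} :=
    (isOpen_lt continuous_const continuous_abs).measurableSet
  exact setLIntegral_pointMeasure_le_iff hm (fun x _ => by positivity) (by fun_prop)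
    (hτ r (by linarith)).le

/-- A convergent principal value has vanishing tails, so the existence of `h_ℓ` alone yields its
limit `0`. -/
lemma tendsto_tail_zero {L : Set ℝ} (hL : LocallyFiniteSet L) {H : ℝ → ℝ}
    (hH : ∀ r, 0 < r → IsTailPrincipalValue L r (H r)) : Tendsto H atTop (𝓝 0) := by
  have h1 := (isTailPrincipalValue_iff hL).1 (hH 1 one_pos)
  have h2 := h1.const_sub (H 1)
  rw [sub_self] at h2
  refine h2.congr' ?_
  filter_upwards [eventually_ge_atTop 1] with r hr
  rw [(hH 1 one_pos).eq_add hL hr (hH r (by linarith)), add_sub_cancel_left]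

/-- Interlacing configurations inherit the conditions on point measures. -/
lemma PointAssumptions.of_interlacing {I I' : Set ℕ} {Ls Ms : ℕ → Set ℝ} {L M : Set ℝ} {α h : ℝ}
    (hΞ : PointAssumptions I Ls L α h) (hα : 0 < α) (hα1 : α < 1) (hI : I' ⊆ I)
    (hI' : ∀ᶠ n in atTop, n ∈ I') (h1 : ∀ n ∈ I', Separates (Ls n) (Ms n))
    (h2 : ∀ n ∈ I', Separates (Ms n) (Ls n)) (h3 : Separates L M) (h4 : Separates M L)
    (hloc : LocConv Ms M) : PointAssumptions I' Ms M α h := by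
  have hL := hΞ.locallyFinite_limit
  have hLs : ∀ n ∈ I', LocallyFiniteSet (Ls n) := fun n hn => hΞ.locallyFinite n (hI hn)
  have hM : LocallyFiniteSet M := h3.locallyFinite hL
  have hMs : ∀ n ∈ I', LocallyFiniteSet (Ms n) := fun n hn => (h1 n hn).locallyFinite (hLs n hn)
  obtain ⟨τ, hτpos, hτlim, hτ⟩ := hΞ.tail
  obtain ⟨H, H₀, G, hH, hH₀, hG, hGlim, hH₀lim⟩ := hΞ.principalValue
  have hH' : ∀ n r, ∃ v, n ∈ I' → 0 < r → IsTailPrincipalValue (Ms n) r v ∧ |v - H n r| ≤ 4 / r := by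
    intro n r
    by_cases hn : n ∈ I' ∧ 0 < r
    · obtain ⟨v, hv⟩ := exists_isTailPrincipalValue (hLs n hn.1) (hMs n hn.1) (h1 n hn.1) (h2 n hn.1)
        hn.2 (hH n (hI hn.1) r hn.2)
      exact ⟨v, fun _ _ => hv⟩
    · exact ⟨0, fun a b => absurd ⟨a, b⟩ hn⟩
  choose H' hH' using hH'
  have hH₀' : ∀ r, ∃ v, 0 < r → IsTailPrincipalValue M r v := by
    intro r
    by_cases hr : 0 < r
    · obtain ⟨v, hv⟩ := exists_isTailPrincipalValue hL hM h3 h4 hr (hH₀ r hr)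
      exact ⟨v, fun _ => hv.1⟩
    · exact ⟨0, fun a => absurd a hr⟩
  choose H₀' hH₀' using hH₀'
  have hH₀'lim := tendsto_tail_zero hM hH₀'
  -- The limit in `n` of the new tail principal values is the tail principal value of `M` plus `h`;
  -- once this is shown, its limit `h` at infinity is immediate.
  refine ⟨hI', hMs, hM, hloc.tendstoLocallyWeakly (hI'.mono hMs) hM, ?_, H', H₀',
    fun r => H₀' r + h, fun n hn r hr => (hH' n r hn hr).1, hH₀', fun r hr hr1 hr2 => ?_, ?_,
    hH₀'lim.mono_left inf_le_left⟩
  · refine ⟨fun r => τ r + 8 / r, fun r hr => ?_, ?_, fun n hn => ?_⟩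
    · have := hτpos r hr
      positivity
    · have h8 : Tendsto (fun r : ℝ => 8 / r) atTop (𝓝 0) := tendsto_const_nhds.div_atTop tendsto_id
      simpa using hτlim.add h8
    · rw [PointAssumptions.tail_sum_le fun r hr => by have := hτpos r hr; positivity]
      intro r hr F hF
      exact sum_rpow_le_of_separates (hLs n hn) (hMs n hn) (h1 n hn) (h2 n hn) hα hα1 hr
        ((PointAssumptions.tail_sum_le hτpos).1 (hτ n (hI hn)) r hr) hF
  · rw [Metric.tendsto_nhds]
    intro ε hε
    -- The radius `r` is compared with a distant `q`. The sums over the annulus converge because its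
    -- boundary avoids `M`. At `q` interlacing costs `4 / q`, and the old principal values converge
    -- because `±q` avoid `L`. Hence `q` must avoid both sets.
    set U := L ∪ M with hU
    have hUf : LocallyFiniteSet U := hL.union hM
    have h4lim : Tendsto (fun q : ℝ => 4 / q) atTop (𝓝 0) := tendsto_const_nhds.div_atTop tendsto_id
    have hne : (atTop ⊓ 𝓟 {q : ℝ | q ∉ U ∧ -q ∉ U}).NeBot := by
      rw [inf_principal_neBot_iff]
      intro V hV
      obtain ⟨b, hb⟩ := mem_atTop_sets.1 hV
      obtain ⟨q, hq, hq1, hq2⟩ := hUf.exists_mem_Ioo (lt_add_one b)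
      exact ⟨q, hb q hq.1.le, hq1, hq2⟩
    have hle : atTop ⊓ 𝓟 {q : ℝ | q ∉ U ∧ -q ∉ U} ≤ atTop ⊓ 𝓟 {q : ℝ | q ∉ L ∧ -q ∉ L} :=
      inf_le_inf_left _ (principal_mono.2 fun q hq =>
        ⟨fun h => hq.1 (Or.inl h), fun h => hq.2 (Or.inl h)⟩)
    have hoff : ∀ᶠ q in atTop ⊓ 𝓟 {q : ℝ | q ∉ U ∧ -q ∉ U}, q ∉ U ∧ -q ∉ U :=
      mem_inf_of_right (mem_principal_self _)
    have hlim : Tendsto (fun q => 4 / q + |G q - h| + |H₀' q|)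
        (atTop ⊓ 𝓟 {q : ℝ | q ∉ U ∧ -q ∉ U}) (𝓝 0) := by
      have e1 := ((hGlim.mono_left hle).sub_const h).abs
      have e2 := (hH₀'lim.mono_left (inf_le_left (b := 𝓟 {q : ℝ | q ∉ U ∧ -q ∉ U}))).abs
      simpa using ((h4lim.mono_left inf_le_left).add e1).add e2
    obtain ⟨q, hq1, hqr, hq2, hq3⟩ := ((hlim.eventually (gt_mem_nhds (half_pos hε))).and
      (((eventually_ge_atTop r).filter_mono inf_le_left).and hoff)).exists
    have hq0 : 0 < q := hr.trans_le hqr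
    have hsum := hloc.tendsto_sum_annulus hM (f := fun x => x⁻¹) hr (t := q)
      (fun x hx => continuousAt_inv₀ (abs_pos.1 (hr.trans_le hx))) hr1 hr2
      (fun h => hq2 (Or.inr h)) (fun h => hq3 (Or.inr h))
    have hGq := hG q hq0 (fun h => hq2 (Or.inl h)) (fun h => hq3 (Or.inl h))
    have hA : Tendsto (fun n => |(∑ x ∈ window (Ms n) (annulus r q), x⁻¹ + H n q) -
        (∑ x ∈ window M (annulus r q), x⁻¹ + G q)|) atTop (𝓝 0) := by
      have := ((hsum.add hGq).sub_const (∑ x ∈ window M (annulus r q), x⁻¹ + G q)).abs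
      simpa using this
    filter_upwards [hA.eventually (gt_mem_nhds (half_pos hε)), hI'] with n h5 hn
    have e1 := (hH' n r hn hr).1.eq_add (hMs n hn) hqr (hH' n q hn hq0).1
    have e2 := (hH₀' r hr).eq_add hM hqr (hH₀' q hq0)
    have e3 := (hH' n q hn hq0).2
    rw [Real.dist_eq, e1, e2]
    set X := ∑ x ∈ window (Ms n) (annulus r q), x⁻¹
    set Y := ∑ x ∈ window M (annulus r q), x⁻¹
    rw [abs_lt] at h5
    rw [abs_le] at e3
    have f1 := le_abs_self (G q - h)
    have f2 := neg_abs_le (G q - h)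
    have f3 := le_abs_self (H₀' q)
    have f4 := neg_abs_le (H₀' q)
    rw [abs_lt]
    constructor <;> linarith
  · have := (hH₀'lim.mono_left (inf_le_left (b := 𝓟 {r : ℝ | r ∉ M ∧ -r ∉ M}))).add_const h
    simpa using this

/-! ### Masses from weights, empty configurations and additive constants. -/

lemma masses_of_tailBounds {L : Set ℝ} {α B γbar c p a : ℝ} {τ : ℝ → ℝ} {γ : ℤ → ℝ}
    (h : TailBounds L α B τ) (ha : a ∉ L) (hα : 0 < α) (hα1 : α < 1) (hp : 0 < p)
    (hp1 : (1 + α) * p < 1) (hγ : WeightBounds γ γbar c p) (hγbar : 0 < γbar) (hc : 0 < c) :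
    Masses L (pointWeight L γ a) a (max 1 (2 * |a|)) (tailError α B γbar c p a τ) where
  locallyFinite := h.locallyFinite
  notMem := ha
  pos x hx := by rw [pointWeight_of_mem hx]; exact hγ.pos _
  zero x hx := indicator_of_notMem hx _
  one_le := le_max_left _ _
  abs_le := le_max_right _ _
  tail r hr t := sum_annulus_pointWeight_inv_sq_le h hα hα1 hp hp1 hγ hγbar hc t
    ((le_max_left _ _).trans hr) (by linarith [(le_max_right _ _).trans hr, abs_nonneg a])

lemma window_empty (A : Set ℝ) : window ∅ A = ∅ := by
  ext x
  rw [mem_window_of_finite (by simp)]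
  simp

lemma eq_zero_of_tendsto_window_empty {f : ℝ → ℝ} {s : ℝ}
    (h : Tendsto (fun t => ∑ x ∈ window ∅ (Icc (-t) t), f x) atTop (𝓝 s)) : s = 0 := by
  refine tendsto_nhds_unique h ?_
  simp [window_empty]

/-- Adding a constant only changes the value at the base point, so `S + γbar * h` is again of the
form covered by `StieltjesConv`. -/
lemma stieltjes_add (W : ℝ → ℝ) (a s b : ℝ) :
    (fun z => stieltjes W a s z + (b : ℂ)) = stieltjes W a (s + b) := by
  funext z
  simp only [stieltjes]
  push_cast
  ring

lemma levelSet_stieltjes_add (L : Set ℝ) (W : ℝ → ℝ) (a s b t : ℝ) :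
    levelSet L (stieltjes W a (s + b)) (t + b) = levelSet L (stieltjes W a s) t := by
  ext z
  rw [mem_levelSet_iff, mem_levelSet_iff, ← stieltjes_add]
  push_cast
  rw [add_left_inj]

lemma PointAssumptions.locConv {I : Set ℕ} {Ls : ℕ → Set ℝ} {L : Set ℝ} {α h : ℝ}
    (hΞ : PointAssumptions I Ls L α h) : LocConv Ls L :=
  LocConv.of_tendsto (hΞ.eventually_mem.mono hΞ.locallyFinite) hΞ.locallyFinite_limit hΞ.tendsto

/-- If the limit configuration is empty but its principal values have the limit `h ≠ 0`, then
almost all the configurations are nonempty. -/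
lemma PointAssumptions.eventually_nonempty {I : Set ℕ} {Ls : ℕ → Set ℝ} {L : Set ℝ} {α h : ℝ}
    (hΞ : PointAssumptions I Ls L α h) (hh : L.Nonempty ∨ h ≠ 0) :
    ∀ᶠ n in atTop, (Ls n).Nonempty := by
  rcases L.eq_empty_or_nonempty with rfl | ⟨p, hp⟩
  · have hh0 : h ≠ 0 := hh.resolve_left not_nonempty_empty
    obtain ⟨H, H₀, G, hH, -, hG, hGlim, -⟩ := hΞ.principalValue
    simp only [mem_empty_iff_false, not_false_eq_true, and_self, forall_const, ofPred_true,
      principal_univ, inf_top_eq] at hG hGlim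
    obtain ⟨r, hr0, hr⟩ := ((eventually_gt_atTop 0).and (hGlim.eventually_ne hh0)).exists
    filter_upwards [(hG r hr0).eventually_ne hr, hΞ.eventually_mem] with n hn hnI
    by_contra hemp
    rw [not_nonempty_iff_eq_empty] at hemp
    have h1 := hH n hnI r hr0
    rw [hemp, isTailPrincipalValue_iff (hemp ▸ hΞ.locallyFinite n hnI)] at h1
    refine hn (tendsto_nhds_unique h1 ?_)
    simp [window_empty]
  · filter_upwards [hΞ.locConv.exists_near p hp 1 one_pos] with n ⟨y, hy, _⟩
    exact ⟨y, hy⟩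

end StieltjesChain

end

/-! ### Proof of the theorem. -/

theorem mainTheorem4
    (Ls : ℕ → Set ℝ) (L : Set ℝ) (α h : ℝ) (hα : α ∈ Set.Ioo (0 : ℝ) 1)
    (hΞ : StieltjesChain.PointAssumptions {n : ℕ | 1 ≤ n} Ls L α h)
    (γs : ℕ → ℤ → ℝ) (γ : ℤ → ℝ)
    (hγs : ∀ n : ℕ, 1 ≤ n → ∀ k : ℤ, 0 < γs n k)
    (hγ : ∀ k : ℤ, 0 < γ k)
    (hγlim : ∀ k : ℤ, Filter.Tendsto (fun n => γs n k) Filter.atTop (nhds (γ k)))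
    (γbar c α' : ℝ) (hγbar : 0 < γbar) (hc : 0 < c)
    (hα'0 : 0 < (1 + α) * α') (hα'1 : (1 + α) * α' < 1)
    (hγpos : ∀ n m : ℕ, 1 ≤ n → 1 ≤ m →
      |(∑ k ∈ Finset.Ico (0 : ℤ) (m : ℤ), γs n k) - γbar * (m : ℝ)| ≤ c * (m : ℝ) ^ α')
    (hγneg : ∀ n m : ℕ, 1 ≤ n → 1 ≤ m →
      |(∑ k ∈ Finset.Ico (-(m : ℤ)) (0 : ℤ), γs n k) - γbar * (m : ℝ)| ≤ c * (m : ℝ) ^ α')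
    (a : ℝ) (ha : a ∉ L) :
    (∀ᶠ n in Filter.atTop, a ∉ Ls n) ∧
    ∃ (Ss : ℕ → ℂ → ℂ) (S : ℂ → ℂ),
      (∀ n : ℕ, 1 ≤ n → a ∉ Ls n →
        StieltjesChain.IsStieltjesTransform (Ls n) (γs n) a (Ss n) ∧
        StieltjesChain.IsMeromorphicWithSimplePoles (Ls n) (Ss n)) ∧
      StieltjesChain.IsStieltjesTransform L γ a S ∧
      StieltjesChain.IsMeromorphicWithSimplePoles L S ∧
      StieltjesChain.TendstoChordalOnCompacts
        (fun n => StieltjesChain.toSphere (Ls n) (Ss n))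
        (StieltjesChain.toSphere L (fun z => S z + ((γbar * h : ℝ) : ℂ))) ∧
      ∀ h' : ℝ, (L.Nonempty ∨ h' ≠ 0) →
        (∀ n : ℕ, 1 ≤ n → a ∉ Ls n → ((Ls n).Nonempty ∨ h' + γbar * h ≠ 0) →
          ∀ z ∈ StieltjesChain.levelSet (Ls n) (Ss n) (h' + γbar * h), z.im = 0) ∧
        (∀ z ∈ StieltjesChain.levelSet L S h', z.im = 0) ∧
        StieltjesChain.PointAssumptions
          {n : ℕ | 1 ≤ n ∧ a ∉ Ls n ∧ ((Ls n).Nonempty ∨ h' + γbar * h ≠ 0)}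
          (fun n => StieltjesChain.realLevelSet (Ls n) (Ss n) (h' + γbar * h))
          (StieltjesChain.realLevelSet L S h') α h := by

  open StieltjesChain Filter Topology Set in
  obtain ⟨hα0, hα1⟩ := hα
  have hp : 0 < α' := pos_of_mul_pos_right hα'0 (by linarith)
  have hL := hΞ.locallyFinite_limit
  have hloc := hΞ.locConv
  have hev : ∀ᶠ n : ℕ in atTop, 1 ≤ n := eventually_ge_atTop 1
  have haev : ∀ᶠ n in atTop, a ∉ Ls n := hloc.eventually_notMem ha
  obtain ⟨τ, hτpos, hτlim, hτ⟩ := hΞ.tail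
  obtain ⟨H, H₀, G, hH, hH₀, hG, hGlim, hH₀lim⟩ := hΞ.principalValue
  have hτ' : ∀ n, 1 ≤ n → ∀ r : ℝ, 1 ≤ r → ∀ F : Finset ℝ, (∀ x ∈ F, x ∈ Ls n ∧ r < |x|) →
      ∑ x ∈ F, 1 / |x| ^ (1 + α) ≤ τ r := fun n hn =>
    (PointAssumptions.tail_sum_le hτpos).1 (hτ n hn)
  obtain ⟨B, hTB, hTBs⟩ := TailBounds.of_locConv hL hloc (hev.mono hΞ.locallyFinite) (hev.mono hτ')
  have hWs : ∀ n, 1 ≤ n → WeightBounds (γs n) γbar c α' := fun n hn =>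
    ⟨hγs n hn, fun m hm => hγpos n m hn hm, fun m hm => hγneg n m hn hm⟩
  have hW : WeightBounds γ γbar c α' := WeightBounds.of_tendsto (hev.mono hWs) hγ hγlim
  set E := tailError α B γbar c α' a τ with hE
  have hElim : ∀ B, Tendsto (tailError α B γbar c α' a τ) atTop (𝓝 0) := fun B =>
    tendsto_tailError hα'1 hτlim
  have hM := masses_of_tailBounds hTB ha hα0 hα1 hp hα'1 hW hγbar hc
  obtain ⟨s, hs, hsr⟩ := exists_principalValue (a := a) hTB hτlim hα0 hα1 hp hα'1 hW hγbar hc hH₀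
  -- The uniform `B` is available only for large `n`. Part (b) concerns every `n`, for which the
  -- actual number of points in `[-1, 1]` serves as bound.
  have hTn : ∀ n, 1 ≤ n →
      TailBounds (Ls n) α ((window (Ls n) (Icc (-1) 1)).card) τ := fun n hn =>
    ⟨hΞ.locallyFinite n hn, hτ' n hn, le_rfl⟩
  have hMn : ∀ n, 1 ≤ n → a ∉ Ls n → Masses (Ls n) (pointWeight (Ls n) (γs n) a) a
      (max 1 (2 * |a|)) (tailError α ((window (Ls n) (Icc (-1) 1)).card) γbar c α' a τ) :=
    fun n hn han => masses_of_tailBounds (hTn n hn) han hα0 hα1 hp hα'1 (hWs n hn) hγbar hc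
  have hss : ∀ n, ∃ v, 1 ≤ n → Tendsto (fun t => ∑ x ∈ window (Ls n) (Icc (-t) t),
      pointWeight (Ls n) (γs n) a x / (x - a)) atTop (𝓝 v) := by
    intro n
    by_cases hn : 1 ≤ n
    · obtain ⟨v, hv, -⟩ := exists_principalValue (a := a) (hTn n hn) hτlim hα0 hα1 hp hα'1
        (hWs n hn) hγbar hc (hH n hn)
      exact ⟨v, fun _ => hv⟩
    · exact ⟨0, fun h => absurd h hn⟩
  choose ss hss using hss
  have hssr : ∀ᶠ n in atTop, ∀ r, max 1 (2 * |a|) ≤ r →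
      |ss n - ∑ x ∈ window (Ls n) (Icc (-r) r), pointWeight (Ls n) (γs n) a x / (x - a) -
        γbar * H n r| ≤ E r := by
    filter_upwards [hev, hTBs] with n hn hTn r hr
    obtain ⟨v, hv, hvr⟩ := exists_principalValue (a := a) hTn hτlim hα0 hα1 hp hα'1
      (hWs n hn) hγbar hc (hH n hn)
    rw [tendsto_nhds_unique (hss n hn) hv]
    exact hvr r ((le_max_left _ _).trans hr) ((le_max_right _ _).trans hr)
  obtain ⟨φ, hφ⟩ := hloc.exists_weightedConv hL ha hγlim
  have hslim : Tendsto ss atTop (𝓝 (s + γbar * h)) :=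
    tendsto_principalValue hL hφ ha (hElim B)
      (fun r hr => hsr r ((le_max_left _ _).trans hr) ((le_max_right _ _).trans hr)) hssr hG hGlim
      hH₀lim
  have hconv : StieltjesConv Ls L (fun n => pointWeight (Ls n) (γs n) a) (pointWeight L γ a) φ a
      (max 1 (2 * |a|)) E ss (s + γbar * h) := by
    refine ⟨hφ, hloc, hM, ?_, hElim B, hslim⟩
    filter_upwards [hev, hTBs, haev] with n hn hTn han
    exact masses_of_tailBounds hTn han hα0 hα1 hp hα'1 (hWs n hn) hγbar hc
  refine ⟨haev, fun n => stieltjes (pointWeight (Ls n) (γs n) a) a (ss n),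
    stieltjes (pointWeight L γ a) a s, fun n hn han =>
      ⟨isStieltjesTransform (hMn n hn han) (hElim _) (hγs n hn) (hss n hn),
        (hMn n hn han).isMeromorphicWithSimplePoles _⟩,
    isStieltjesTransform hM (hElim B) hγ hs, hM.isMeromorphicWithSimplePoles s, ?_, fun h' hh' => ?_⟩
  · rw [stieltjes_add]
    exact hconv.tendstoChordalOnCompacts
  have hlevel : realLevelSet L (stieltjes (pointWeight L γ a) a s) h' =
      realLevelSet L (stieltjes (pointWeight L γ a) a (s + γbar * h)) (h' + γbar * h) := by
    rw [realLevelSet, realLevelSet, levelSet_stieltjes_add]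
  -- For empty `L` the base value `s` is `0`, so the excluded degenerate case is exactly that of a
  -- constant transform equal to the level.
  have hne : L.Nonempty ∨ h' ≠ s := by
    rcases L.eq_empty_or_nonempty with rfl | hLne
    · rw [eq_zero_of_tendsto_window_empty hs]; exact hh'
    · exact Or.inl hLne
  have hne' : L.Nonempty ∨ h' + γbar * h ≠ s + γbar * h :=
    hne.imp id fun h1 h2 => h1 (add_right_cancel h2)
  have hnen : ∀ n, 1 ≤ n → ((Ls n).Nonempty ∨ h' + γbar * h ≠ 0) →
      (Ls n).Nonempty ∨ h' + γbar * h ≠ ss n := by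
    intro n hn hne
    rcases (Ls n).eq_empty_or_nonempty with he | hLne
    · have := hss n hn
      rw [he] at this
      rw [eq_zero_of_tendsto_window_empty this]; exact hne
    · exact Or.inl hLne
  refine ⟨fun n hn han hne z hz => (hMn n hn han).im_eq_zero_of_mem_levelSet (hnen n hn hne) hz,
    fun z hz => hM.im_eq_zero_of_mem_levelSet hne hz, ?_⟩
  refine hΞ.of_interlacing hα0 hα1 (fun n hn => hn.1) ?_
    (fun n hn => (hMn n hn.1 hn.2.1).separates_levelSet (hnen n hn.1 hn.2.2))
    (fun n hn => (hMn n hn.1 hn.2.1).levelSet_separates _ _)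
    (hM.separates_levelSet hne) (hM.levelSet_separates _ _) ?_
  · have hI : ∀ᶠ n in atTop, (Ls n).Nonempty ∨ h' + γbar * h ≠ 0 := by
      by_cases ht : h' + γbar * h = 0
      · refine (hΞ.eventually_nonempty (hh'.imp id fun h1 h2 => h1 ?_)).mono fun n hn => Or.inl hn
        rwa [h2, mul_zero, add_zero] at ht
      · exact Eventually.of_forall fun _ => Or.inr ht
    filter_upwards [hev, haev, hI] with n h1 h2 h3
    exact ⟨h1, h2, h3⟩
  · rw [hlevel]
    exact hconv.locConv_realLevelSet hne'
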